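/- Let $G=(A,B,E)$ denote a finite simple bipartite graph given with its bipartition. For $t,\Delta\in\mathbb{N}$, a $(t,\Delta)$-tree is a tree of maximum degree at most $\Delta$ with at most $t$ vertices of degree at least $3$, and $G$ is $(t,\Delta)$-tree convex if there is a $(t,\Delta)$-tree $T$ with $V(T)=A$ such that for every $b\in B$ the neighbourhood of $b$ in $G$ induces a connected subgraph of $T$ (the empty subgraph counts as connected). An ordering $v_1,\dots,v_n$ of $V(G)=A\cup B$ and a partition of $V(G)$ into at most $k$ classes are consistent if for all $q<r<s$ such that $v_q,v_r$ lie in the same class and $v_qv_s\in E$, also $v_rv_s\in E$. The thinness of $G$ is the least $k$ for which a consistent ordering and partition into $k$ classes exist. Theorem. For every $t,\Delta\in\mathbb{N}$ with $t\ge 1$ and $\Delta\ge 3$, every $(t,\Delta)$-tree convex graph has thinness at most $2+t(\Delta-2)$. Moreover, for every such fixed $t$ and $\Delta$, there is an algorithm that, given a $(t,\Delta)$-tree convex graph $G=(A,B,E)$ (without a tree $T$), computes a consistent ordering and partition of $V(G)$ into at most $2+t(\Delta-2)$ classes in time polynomial in $|V(G)|$. -/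

import Mathlib

/-! ### Thinness -/

section Thinness

variable {V : Type*}

/-- The ordering `v 0, v 1, …` of the vertices of `G` and the partition of the vertices into the
classes `{x | c x = j}`, `j < k`, are consistent. -/
def IsConsistent (G : SimpleGraph V) {n k : ℕ} (v : Fin n ≃ V) (c : V → Fin k) : Prop :=
  ∀ q r s : Fin n, q < r → r < s → c (v q) = c (v r) → G.Adj (v q) (v s) → G.Adj (v r) (v s)

/-- `G` is `k`-thin. Some of the `k` classes may be empty, which does not affect the minimum. -/
def IsThin (G : SimpleGraph V) (k : ℕ) : Prop :=
  ∃ (v : Fin (Nat.card V) ≃ V) (c : V → Fin k), IsConsistent G v c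

/-- The thinness of a finite graph: the minimum `k` such that the graph is `k`-thin. -/
noncomputable def thinness (G : SimpleGraph V) : ℕ := sInf {k | IsThin G k}

/-- The minimum in the definition of thinness is over a nonempty set. -/
theorem isThin_natCard [Finite V] (G : SimpleGraph V) : IsThin G (Nat.card V) := by
  refine ⟨(Finite.equivFin V).symm, Finite.equivFin V, ?_⟩
  intro q r s hqr _ hc
  simp only [Equiv.apply_symm_apply] at hc
  exact absurd hc hqr.ne

/-- The minimum in the definition of thinness is attained. -/
theorem isThin_thinness [Finite V] (G : SimpleGraph V) : IsThin G (thinness G) :=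
  Nat.sInf_mem (s := {k | IsThin G k}) ⟨_, isThin_natCard G⟩

end Thinness

/-! ### Tree convex graphs -/

section Convex

universe u

variable {V : Type u}

/-- A `(t, Δ)`-tree: a tree of maximum degree at most `Δ` with at most `t` vertices of degree at
least `3`. -/
structure IsTDeltaTree (t Δ : ℕ) (T : SimpleGraph V) : Prop where
  isTree : T.IsTree
  degree_le : ∀ x, (T.neighborSet x).encard ≤ Δ
  branching_le : {x | 3 ≤ (T.neighborSet x).encard}.encard ≤ t

/-- The bipartite graph `G = (A, B, E)` is `ℋ`-convex: some member of `ℋ` with vertex set `A` is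
such that the neighbourhood of each `b ∈ B` induces a connected subgraph of it. (The subgraph with
no vertices counts as connected, so `b ∈ B` may be isolated in `G`.) -/
structure IsHConvex (ℋ : {W : Type u} → SimpleGraph W → Prop)
    (G : SimpleGraph V) (A B : Set V) : Prop where
  bipartite : G.IsBipartiteWith A B
  cover : A ∪ B = Set.univ
  support : ∃ H : SimpleGraph A, ℋ H ∧ ∀ b ∈ B, (H.induce {a : A | G.Adj b a}).Preconnected

/-- The bipartite graph `G = (A, B, E)` is `(t, Δ)`-tree convex. -/
def IsTDeltaTreeConvex (t Δ : ℕ) (G : SimpleGraph V) (A B : Set V) : Prop :=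
  IsHConvex (fun H => IsTDeltaTree t Δ H) G A B

end Convex

/-! ### Random access machines with a step count -/

namespace RAM

/-- Memory: registers and arrays, both named by natural numbers, all holding natural numbers.
A program mentions only finitely many registers and arrays. -/
structure State where
  reg : ℕ → ℕ
  arr : ℕ → ℕ → ℕ

/-- `x := c`. -/
def State.setReg (σ : State) (x c : ℕ) : State :=
  { σ with reg := Function.update σ.reg x c }

/-- `a[i] := c`. -/
def State.setArr (σ : State) (a i c : ℕ) : State :=
  { σ with arr := Function.update σ.arr a (Function.update (σ.arr a) i c) }

/-- Programs. The only arithmetic is addition and (truncated) subtraction, so that in `T` steps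
numbers grow by at most `T` bits, and unit cost agrees with Turing machine time up to a
polynomial. -/
inductive Prog where
  | skip : Prog
  | const (x c : ℕ) : Prog
  | add (x y z : ℕ) : Prog
  | sub (x y z : ℕ) : Prog
  | load (x a i : ℕ) : Prog
  | store (a i x : ℕ) : Prog
  | seq (P Q : Prog) : Prog
  | branch (x : ℕ) (P Q : Prog) : Prog
  | loop (x : ℕ) (P : Prog) : Prog

/-- `Runs P σ τ T`: started in the state `σ`, the program `P` halts in the state `τ` after exactly
`T` steps. Every elementary instruction and every test takes one step. -/
inductive Runs : Prog → State → State → ℕ → Prop where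
  | skip (σ : State) : Runs .skip σ σ 1
  /-- `x := c` -/
  | const (σ : State) (x c : ℕ) : Runs (.const x c) σ (σ.setReg x c) 1
  /-- `x := y + z` -/
  | add (σ : State) (x y z : ℕ) : Runs (.add x y z) σ (σ.setReg x (σ.reg y + σ.reg z)) 1
  /-- `x := y - z` -/
  | sub (σ : State) (x y z : ℕ) : Runs (.sub x y z) σ (σ.setReg x (σ.reg y - σ.reg z)) 1
  /-- `x := a[i]` -/
  | load (σ : State) (x a i : ℕ) : Runs (.load x a i) σ (σ.setReg x (σ.arr a (σ.reg i))) 1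
  /-- `a[i] := x` -/
  | store (σ : State) (a i x : ℕ) : Runs (.store a i x) σ (σ.setArr a (σ.reg i) (σ.reg x)) 1
  /-- `P; Q` -/
  | seq {P Q : Prog} {σ τ υ : State} {m n : ℕ} :
      Runs P σ τ m → Runs Q τ υ n → Runs (.seq P Q) σ υ (m + n)
  /-- `if x ≠ 0 then P else Q` -/
  | branch_pos {x : ℕ} {P : Prog} (Q : Prog) {σ τ : State} {m : ℕ} :
      σ.reg x ≠ 0 → Runs P σ τ m → Runs (.branch x P Q) σ τ (m + 1)
  | branch_zero {x : ℕ} (P : Prog) {Q : Prog} {σ τ : State} {m : ℕ} :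
      σ.reg x = 0 → Runs Q σ τ m → Runs (.branch x P Q) σ τ (m + 1)
  /-- `while x ≠ 0 do P` -/
  | loop_pos {x : ℕ} {P : Prog} {σ τ υ : State} {m n : ℕ} :
      σ.reg x ≠ 0 → Runs P σ τ m → Runs (.loop x P) τ υ n → Runs (.loop x P) σ υ (m + n + 1)
  | loop_zero {x : ℕ} (P : Prog) {σ : State} :
      σ.reg x = 0 → Runs (.loop x P) σ σ 1

open Classical in
/-- The input `G = (A, B, E)` with vertices `0, …, n - 1`: register `0` holds `n`, array `0` holds
the `n × n` adjacency matrix row by row, array `1` holds the indicator vector of `A` (its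
complement is `B`), and everything else is `0`. -/
noncomputable def inputState {n : ℕ} (G : SimpleGraph (Fin n)) (A : Set (Fin n)) : State where
  reg x := if x = 0 then n else 0
  arr a k :=
    if (a = 0 ∧ ∃ i j : Fin n, G.Adj i j ∧ k = (i : ℕ) * n + j) ∨
        (a = 1 ∧ ∃ i : Fin n, i ∈ A ∧ k = i) then 1 else 0

/-- The output: array `2` lists the vertices in the order `v`, and array `3` lists the classes of
the vertices `0, …, n - 1` under `c`. -/
def IsOutput {n k : ℕ} (τ : State) (v : Fin n ≃ Fin n) (c : Fin n → Fin k) : Prop :=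
  (∀ i : Fin n, τ.arr 2 i = v i) ∧ ∀ x : Fin n, τ.arr 3 x = c x

end RAM

/-!
Let `N a` be the neighbourhood of `a ∈ A`. A tree `T` on `A` suits `G` if and only if for every `S`
the vertices `a` with `S ⊆ N a` are connected in `T`. For `S = N x ∩ N y`, group the edges of `T`
between two vertices with this intersection: they join the classes of vertices which contain `S`,
two vertices being in the same class if larger intersections link them. If there are `m` classes,
then there are `m - 1` such edges, and all trees which suit `G` are obtained by choosing the ends of
these edges freely, subject to one condition: each class contains an end. So the ends are `m` tokens
bound to a class each and `m - 2` free tokens, and whenever every token is placed on an admissible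
vertex, a tree can be drawn that has its edge ends at the tokens.

A tree has two plus `∑ a, (deg a - 2)` leaves, so that the fewest leaves are achieved by placing as
many tokens as possible in slots, two at each vertex. An auction finds this maximum matching of
tokens to slots without knowing `T`.

Root a tree with `ℓ` leaves at a leaf and order its vertices from the bottom up, inserting every
`b ∈ B` after its highest neighbour. Then `ℓ - 1` descending chains which cover the tree, together
with a class for `B`, form a consistent partition. A `(t, Δ)`-tree has at most `2 + t (Δ - 2)`
leaves.
-/

/-! ### A language compiled to random access machines -/

namespace RAM

open Polynomial

theorem State.setReg_reg (σ : State) (x c y : ℕ) :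
    (σ.setReg x c).reg y = if y = x then c else σ.reg y := by
  simp only [State.setReg, Function.update_apply]

@[simp] theorem State.setReg_reg_self (σ : State) (x c : ℕ) : (σ.setReg x c).reg x = c := by
  simp [State.setReg_reg]

@[simp] theorem State.setReg_reg_of_ne (σ : State) {x c y : ℕ} (h : y ≠ x) :
    (σ.setReg x c).reg y = σ.reg y := by
  simp [State.setReg_reg, h]

@[simp] theorem State.setReg_arr (σ : State) (x c : ℕ) : (σ.setReg x c).arr = σ.arr := rfl

/-- The registers below `q` have the same contents in both states. -/
def AgreeBelow (q : ℕ) (σ τ : State) : Prop := ∀ r < q, τ.reg r = σ.reg r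

theorem AgreeBelow.mono {q q' : ℕ} {σ τ : State} (h : AgreeBelow q' σ τ) (hq : q ≤ q') :
    AgreeBelow q σ τ := fun r hr => h r (hr.trans_le hq)

theorem AgreeBelow.trans {q : ℕ} {σ τ υ : State} (h : AgreeBelow q σ τ) (h' : AgreeBelow q τ υ) :
    AgreeBelow q σ υ := fun r hr => (h' r hr).trans (h r hr)

theorem AgreeBelow.map_reg {q : ℕ} {σ τ : State} (h : AgreeBelow q σ τ) {ρ : List ℕ}
    (hρ : ∀ r ∈ ρ, r < q) : ρ.map τ.reg = ρ.map σ.reg :=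
  List.map_congr_left fun r hr => h r (hρ r hr)

theorem agreeBelow_setReg (σ : State) {q x : ℕ} (hx : q ≤ x) (c : ℕ) :
    AgreeBelow q σ (σ.setReg x c) := fun _ hr => σ.setReg_reg_of_ne (by omega)

/-- Some program takes every state `σ` to a state related to `σ` by `Φ`, in time polynomial in
register `0`, where an instance keeps its size, and without changing the registers below `q`. -/
def Realizable (q : ℕ) (Φ : State → State → Prop) : Prop :=
  ∃ (P : Prog) (p : ℕ[X]), ∀ σ, ∃ τ, (∃ T ≤ p.eval (σ.reg 0), Runs P σ τ T) ∧
    AgreeBelow q σ τ ∧ Φ σ τ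

namespace Realizable

variable {q q' : ℕ} {Φ Ψ : State → State → Prop}

theorem of_step {P : Prog} {f : State → State} (h : ∀ σ, Runs P σ (f σ) 1)
    (hf : ∀ σ, AgreeBelow q σ (f σ)) : Realizable q fun σ τ => τ = f σ :=
  ⟨P, 1, fun σ => ⟨f σ, ⟨1, by simp, h σ⟩, hf σ, rfl⟩⟩

theorem mono (h : Realizable q' Φ) (hq : q ≤ q')
    (hΦ : ∀ σ τ, AgreeBelow q' σ τ → Φ σ τ → Ψ σ τ) : Realizable q Ψ := by
  obtain ⟨P, p, hP⟩ := h
  refine ⟨P, p, fun σ => ?_⟩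
  obtain ⟨τ, hrun, hreg, hτ⟩ := hP σ
  exact ⟨τ, hrun, hreg.mono hq, hΦ σ τ hreg hτ⟩

theorem skip : Realizable q fun σ τ => τ = σ :=
  of_step (f := id) (fun σ => .skip σ) fun _ _ _ => rfl

theorem const {x : ℕ} (hx : q ≤ x) (c : ℕ) : Realizable q fun σ τ => τ = σ.setReg x c :=
  of_step (fun σ => .const σ x c) fun σ => agreeBelow_setReg σ hx c

theorem add {x : ℕ} (hx : q ≤ x) (y z : ℕ) :
    Realizable q fun σ τ => τ = σ.setReg x (σ.reg y + σ.reg z) :=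
  of_step (fun σ => .add σ x y z) fun σ => agreeBelow_setReg σ hx _

theorem sub {x : ℕ} (hx : q ≤ x) (y z : ℕ) :
    Realizable q fun σ τ => τ = σ.setReg x (σ.reg y - σ.reg z) :=
  of_step (fun σ => .sub σ x y z) fun σ => agreeBelow_setReg σ hx _

theorem load {x : ℕ} (hx : q ≤ x) (a i : ℕ) :
    Realizable q fun σ τ => τ = σ.setReg x (σ.arr a (σ.reg i)) :=
  of_step (fun σ => .load σ x a i) fun σ => agreeBelow_setReg σ hx _

theorem store (a i x : ℕ) : Realizable q fun σ τ => τ = σ.setArr a (σ.reg i) (σ.reg x) :=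
  of_step (fun σ => .store σ a i x) fun _ _ _ => rfl

theorem seq {q₁ q₂ : ℕ} (hq : 0 < q) (hΦ : Realizable q₁ Φ) (hΨ : Realizable q₂ Ψ)
    (hq₁ : q ≤ q₁ := by omega) (hq₂ : q ≤ q₂ := by omega) :
    Realizable q fun σ υ => ∃ τ, AgreeBelow q₁ σ τ ∧ Φ σ τ ∧ AgreeBelow q₂ τ υ ∧ Ψ τ υ := by
  obtain ⟨P, p, hP⟩ := hΦ
  obtain ⟨Q, p', hQ⟩ := hΨ
  refine ⟨.seq P Q, p + p', fun σ => ?_⟩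
  obtain ⟨τ, ⟨T, hT, hrun⟩, hreg, hτ⟩ := hP σ
  obtain ⟨υ, ⟨T', hT', hrun'⟩, hreg', hυ⟩ := hQ τ
  rw [hreg 0 (by omega)] at hT'
  exact ⟨υ, ⟨T + T', by simpa using add_le_add hT hT', .seq hrun hrun'⟩,
    (hreg.mono hq₁).trans (hreg'.mono hq₂), τ, hreg, hτ, hreg', hυ⟩

theorem branch (x : ℕ) (hΦ : Realizable q Φ) (hΨ : Realizable q Ψ) :
    Realizable q fun σ τ => if σ.reg x ≠ 0 then Φ σ τ else Ψ σ τ := by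
  obtain ⟨P, p, hP⟩ := hΦ
  obtain ⟨Q, p', hQ⟩ := hΨ
  refine ⟨.branch x P Q, p + p' + 1, fun σ => ?_⟩
  by_cases hx : σ.reg x = 0
  · obtain ⟨τ, ⟨T, hT, hrun⟩, hreg, hτ⟩ := hQ σ
    exact ⟨τ, ⟨T + 1, by simp only [eval_add, eval_one]; omega, .branch_zero P hx hrun⟩, hreg,
      by simpa [hx] using hτ⟩
  · obtain ⟨τ, ⟨T, hT, hrun⟩, hreg, hτ⟩ := hP σ
    exact ⟨τ, ⟨T + 1, by simp only [eval_add, eval_one]; omega, .branch_pos Q hx hrun⟩, hreg,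
      by simpa [hx] using hτ⟩

theorem move {x z : ℕ} (hx : q ≤ x) (hz : q ≤ z) (y : ℕ) (hzy : y ≠ z) (hq : 0 < q) :
    Realizable q fun σ τ => τ = (σ.setReg z 0).setReg x (σ.reg y) :=
  (seq hq (const hz 0) (add hx y z)).mono le_rfl <| by
    rintro σ _ - ⟨_, -, rfl, -, rfl⟩
    simp [hzy]

theorem linear {x : ℕ} (hx : q ≤ x) (hq : 0 < q) (k c : ℕ) :
    Realizable q fun σ τ => τ = σ.setReg x (k * σ.reg 0 + c) := by
  induction k with
  | zero => simpa using const hx c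
  | succ k ih =>
    refine (seq hq ih (add hx x 0)).mono le_rfl ?_
    rintro σ _ - ⟨_, -, rfl, -, rfl⟩
    have hx0 : 0 ≠ x := by omega
    simp only [State.setReg, Function.update_self, Function.update_of_ne hx0,
      Function.update_idem, State.mk.injEq, and_true]
    congr 1
    ring

end Realizable

/-- `while x ≠ 0 do (P; i := i + d; x := x - d)` -/
def countdown (i x d : ℕ) (P : Prog) : Prog :=
  .loop x (.seq P (.seq (.add i i d) (.sub x x d)))

theorem exists_runs_countdown {P : Prog} {B N q : ℕ} {Inv : ℕ → State → Prop}
    (step : ∀ i < N, ∀ σ, Inv i σ → σ.reg q = i → ∃ τ, (∃ T ≤ B, Runs P σ τ T) ∧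
      AgreeBelow (q + 3) σ τ ∧
      ∀ c, Inv (i + 1) ((τ.setReg q (i + 1)).setReg (q + 1) c)) :
    ∀ k i σ, i + k = N → Inv i σ → σ.reg q = i → σ.reg (q + 1) = k → σ.reg (q + 2) = 1 →
      ∃ τ, (∃ T ≤ k * (B + 3) + 1, Runs (countdown q (q + 1) (q + 2) P) σ τ T) ∧
        AgreeBelow q σ τ ∧ Inv N τ
  | 0, i, σ, hik, hInv, _, hk, _ => by
    obtain rfl : i = N := by omega
    exact ⟨σ, ⟨1, by omega, .loop_zero _ hk⟩, fun _ _ => rfl, hInv⟩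
  | k + 1, i, σ, hik, hInv, hi, hk, hone => by
    obtain ⟨τ, ⟨T, hT, hrun⟩, hreg, hτ⟩ := step i (by omega) σ hInv hi
    have hτi : τ.reg q = i := (hreg q (by omega)).trans hi
    have hτk : τ.reg (q + 1) = k + 1 := (hreg (q + 1) (by omega)).trans hk
    have hτone : τ.reg (q + 2) = 1 := (hreg (q + 2) (by omega)).trans hone
    set τ' := (τ.setReg q (i + 1)).setReg (q + 1) k with hτ'
    have hcount : Runs (.seq (.add q q (q + 2)) (.sub (q + 1) (q + 1) (q + 2))) τ τ' 2 := by
      have hsub := Runs.sub (τ.setReg q (τ.reg q + τ.reg (q + 2))) (q + 1) (q + 1) (q + 2)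
      simp only [ne_eq, Nat.add_eq_left, one_ne_zero, OfNat.ofNat_ne_zero, not_false_eq_true,
        State.setReg_reg_of_ne, hτi, hτk, hτone, Nat.add_sub_cancel] at hsub
      exact .seq (by simpa [hτi, hτone] using Runs.add τ q q (q + 2)) hsub
    obtain ⟨υ, ⟨T', hT', hrun'⟩, hreg', hυ⟩ := exists_runs_countdown step k (i + 1) τ' (by omega)
      (hτ k) (by simp [hτ']) (by simp [hτ']) (by simp [hτ', hτone])
    refine ⟨υ, ⟨T + 2 + T' + 1, by linarith, .loop_pos (by omega) (hrun.seq hcount) hrun'⟩,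
      ?_, hυ⟩
    refine (hreg.mono (by omega)).trans (.trans ?_ hreg')
    exact (agreeBelow_setReg _ le_rfl _).trans (agreeBelow_setReg _ (by omega) _)

/-- Registers `q`, `q + 1` and `q + 2` hold the counter, the number of rounds left and `1`. -/
theorem Realizable.loop {q : ℕ} (hq : 0 < q) (k c : ℕ) {Φ : State → State → Prop}
    (hΦ : Realizable (q + 3) Φ) (Inv : State → ℕ → State → Prop)
    (init : ∀ σ d e, Inv σ 0 (((σ.setReg q 0).setReg (q + 1) d).setReg (q + 2) e))
    (step : ∀ σ τ υ i d, i < k * σ.reg 0 + c → AgreeBelow q σ τ → Inv σ i τ → τ.reg q = i →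
      AgreeBelow (q + 3) τ υ → Φ τ υ →
      Inv σ (i + 1) ((υ.setReg q (i + 1)).setReg (q + 1) d)) :
    Realizable q fun σ τ => Inv σ (k * σ.reg 0 + c) τ := by
  obtain ⟨P, p, hP⟩ := hΦ
  have hloop : ∀ σ σ', σ' = ((σ.setReg q 0).setReg (q + 1) (k * σ.reg 0 + c)).setReg (q + 2) 1 →
      ∃ τ, (∃ T ≤ (k * σ.reg 0 + c) * (p.eval (σ.reg 0) + 3) + 1,
        Runs (countdown q (q + 1) (q + 2) P) σ' τ T) ∧ AgreeBelow q σ' τ ∧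
        AgreeBelow q σ τ ∧ Inv σ (k * σ.reg 0 + c) τ := by
    rintro σ σ' hσ'
    have hσσ' : AgreeBelow q σ σ' := hσ' ▸ (agreeBelow_setReg _ le_rfl _).trans
      ((agreeBelow_setReg _ (by omega) _).trans (agreeBelow_setReg _ (by omega) _))
    obtain ⟨υ, hrun, hreg, -, hυ⟩ := exists_runs_countdown (P := P) (B := p.eval (σ.reg 0)) (q := q)
      (Inv := fun i τ => AgreeBelow q σ τ ∧ Inv σ i τ) (fun i hi τ hτ hτi => by
        obtain ⟨υ, hrun, hreg, hυ⟩ := hP τ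
        rw [hτ.1 0 hq] at hrun
        exact ⟨υ, hrun, hreg, fun d => ⟨(hτ.1.trans (hreg.mono (by omega))).trans
          ((agreeBelow_setReg _ le_rfl _).trans (agreeBelow_setReg _ (by omega) _)),
          step σ τ υ i d hi hτ.1 hτ.2 hτi hreg hυ⟩⟩)
      (k * σ.reg 0 + c) 0 σ' (by omega) ⟨hσσ', hσ' ▸ init σ _ _⟩ (by simp [hσ']) (by simp [hσ'])
      (by simp [hσ'])
    exact ⟨υ, hrun, hreg, hσσ'.trans hreg, hυ⟩
  have hinit := seq hq (const (q := q) le_rfl 0) (seq hq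
    (linear (q := q) (x := q + 1) (by omega) hq k c) (const (q := q) (x := q + 2) (by omega) 1))
  obtain ⟨Q, p', hQ⟩ := hinit
  refine ⟨.seq Q (countdown q (q + 1) (q + 2) P),
    p' + ((Polynomial.C k * X + Polynomial.C c) * (p + 3) + 1), fun σ => ?_⟩
  obtain ⟨σ', ⟨T, hT, hrun⟩, -, _, -, rfl, -, _, -, rfl, -, hσ'⟩ := hQ σ
  obtain ⟨υ, ⟨T', hT', hrun'⟩, -, hreg, hυ⟩ :=
    hloop σ σ' (by rw [hσ', State.setReg_reg_of_ne _ hq.ne])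
  refine ⟨υ, ⟨T + T', ?_, hrun.seq hrun'⟩, hreg, hυ⟩
  simp only [eval_add, eval_mul, eval_C, eval_X, eval_one, eval_ofNat]
  exact add_le_add hT hT'

/-- The contents of the arrays. -/
abbrev Mem := ℕ → ℕ → ℕ

/-- Expressions of the language that gets compiled. Variables are numbered from the outermost
binder inwards; `sum k c e` sums over the values below `k * n + c` of a new variable, where `n` is
the size of the instance. -/
inductive Exp where
  | const (c : ℕ)
  | var (i : ℕ)
  | size
  | add (e f : Exp)
  | sub (e f : Exp)
  | read (a : ℕ) (e : Exp)
  | ite (c e f : Exp)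
  | sum (k c : ℕ) (e : Exp)
  | call (k : ℕ) (args : Fin k → Exp) (f : Exp)

/-- The value of an expression in an instance of size `n`, given the values of the variables. -/
def Exp.eval (n : ℕ) (M : Mem) : Exp → List ℕ → ℕ
  | .const c, _ => c
  | .var i, env => env.getD i 0
  | .size, _ => n
  | .add e f, env => e.eval n M env + f.eval n M env
  | .sub e f, env => e.eval n M env - f.eval n M env
  | .read a e, env => M a (e.eval n M env)
  | .ite c e f, env => if c.eval n M env ≠ 0 then e.eval n M env else f.eval n M env
  | .sum k c e, env => ∑ i ∈ Finset.range (k * n + c), e.eval n M (env ++ [i])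
  | .call _ args f, env => f.eval n M (List.ofFn fun i => (args i).eval n M env)

/-- Commands of the language that gets compiled; `loop k c` makes `k * n + c` rounds in an instance
of size `n`, and its new variable counts them. -/
inductive Cmd where
  | skip
  | store (a : ℕ) (e f : Exp)
  | seq (C D : Cmd)
  | ite (e : Exp) (C D : Cmd)
  | loop (k c : ℕ) (C : Cmd)

/-- The effect of a command on the arrays. -/
def Cmd.exec (n : ℕ) : Cmd → Mem → List ℕ → Mem
  | .skip, M, _ => M
  | .store a e f, M, env =>
    Function.update M a (Function.update (M a) (e.eval n M env) (f.eval n M env))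
  | .seq C D, M, env => D.exec n (C.exec n M env) env
  | .ite e C D, M, env => if e.eval n M env ≠ 0 then C.exec n M env else D.exec n M env
  | .loop k c C, M, env => (List.range (k * n + c)).foldl (fun M i => C.exec n M (env ++ [i])) M

/-- With the variables in arbitrary registers below `q`, the value of `f` can be computed into
register `q`. -/
def IsComputable (f : ℕ → Mem → List ℕ → ℕ) : Prop :=
  ∀ (ρ : List ℕ) (q : ℕ), 0 < q → (∀ r ∈ ρ, r < q) →
    Realizable q fun σ τ => τ.arr = σ.arr ∧ τ.reg q = f (σ.reg 0) σ.arr (ρ.map σ.reg)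

/-- With the variables in arbitrary registers below `q`, the arrays can be transformed by `F`
without using the registers below `q`. -/
def IsExecutable (F : ℕ → Mem → List ℕ → Mem) : Prop :=
  ∀ (ρ : List ℕ) (q : ℕ), 0 < q → (∀ r ∈ ρ, r < q) →
    Realizable q fun σ τ => τ.arr = F (σ.reg 0) σ.arr (ρ.map σ.reg)

namespace IsComputable

variable {f g h : ℕ → Mem → List ℕ → ℕ}

theorem const (c : ℕ) : IsComputable fun _ _ _ => c := fun _ _ _ _ =>
  (Realizable.const le_rfl c).mono le_rfl <| by rintro σ _ - rfl; simp

theorem size : IsComputable fun n _ _ => n := fun _ q hq _ =>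
  (Realizable.move le_rfl (Nat.le_add_right q 1) 0 (by omega) hq).mono le_rfl <| by
    rintro σ _ - rfl; simp

theorem var (i : ℕ) : IsComputable fun _ _ env => env.getD i 0 := fun ρ q hq hρ => by
  by_cases hi : i < ρ.length
  · have hiq := hρ _ (List.getElem_mem hi)
    refine (Realizable.move le_rfl (Nat.le_add_right q 1) ρ[i] (by omega) hq).mono le_rfl ?_
    rintro σ _ - rfl
    simp [hi]
  · refine (Realizable.const le_rfl 0).mono le_rfl ?_
    rintro σ _ - rfl
    simp [Nat.not_lt.1 hi]

theorem read (a : ℕ) (hf : IsComputable f) : IsComputable fun n M env => M a (f n M env) :=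
  fun ρ q hq hρ => (Realizable.seq hq (hf ρ q hq hρ) (.load (q := q) le_rfl a q)).mono le_rfl <| by
    rintro σ _ - ⟨τ, -, ⟨harr, hval⟩, -, rfl⟩
    simp [harr, hval]

theorem pair (hf : IsComputable f) (hg : IsComputable g) {ρ : List ℕ} {q : ℕ} (hq : 0 < q)
    (hρ : ∀ r ∈ ρ, r < q) :
    Realizable q fun σ τ => τ.arr = σ.arr ∧ τ.reg q = f (σ.reg 0) σ.arr (ρ.map σ.reg) ∧
      τ.reg (q + 1) = g (σ.reg 0) σ.arr (ρ.map σ.reg) := by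
  have hρ' : ∀ r ∈ ρ, r < q + 1 := fun r hr => (hρ r hr).trans (Nat.lt_succ_self q)
  refine (Realizable.seq hq (hf ρ q hq hρ) (hg ρ (q + 1) (by omega) hρ')).mono
    le_rfl ?_
  rintro σ υ - ⟨τ, hreg, ⟨harr, hval⟩, hreg', harr', hval'⟩
  rw [harr, hreg.map_reg hρ, hreg 0 hq] at hval'
  exact ⟨harr'.trans harr, (hreg' q (by omega)).trans hval, hval'⟩

theorem add (hf : IsComputable f) (hg : IsComputable g) :
    IsComputable fun n M env => f n M env + g n M env := fun _ q hq hρ =>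
  (Realizable.seq hq (hf.pair hg hq hρ) (.add (q := q) le_rfl q (q + 1))).mono le_rfl <| by
    rintro σ _ - ⟨τ, -, ⟨harr, hval, hval'⟩, -, rfl⟩
    simp [harr, hval, hval']

theorem sub (hf : IsComputable f) (hg : IsComputable g) :
    IsComputable fun n M env => f n M env - g n M env := fun _ q hq hρ =>
  (Realizable.seq hq (hf.pair hg hq hρ) (.sub (q := q) le_rfl q (q + 1))).mono le_rfl <| by
    rintro σ _ - ⟨τ, -, ⟨harr, hval, hval'⟩, -, rfl⟩
    simp [harr, hval, hval']

theorem ite (hh : IsComputable h) (hf : IsComputable f) (hg : IsComputable g) :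
    IsComputable fun n M env => if h n M env ≠ 0 then f n M env else g n M env :=
  fun ρ q hq hρ => (Realizable.seq hq (hh ρ q hq hρ)
    (.branch q (hf ρ q hq hρ) (hg ρ q hq hρ))).mono le_rfl <| by
    rintro σ υ - ⟨τ, hreg, ⟨harr, hval⟩, -, hυ⟩
    rw [hval, harr, hreg.map_reg hρ, hreg 0 hq] at hυ
    beta_reduce
    split_ifs at hυ ⊢ <;> exact hυ

theorem sum (k c : ℕ) (hf : IsComputable f) :
    IsComputable fun n M env => ∑ i ∈ Finset.range (k * n + c), f n M (env ++ [i]) := by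
  intro ρ q hq hρ
  have hbody := Realizable.seq (q := q + 3) (by omega)
    (hf (ρ ++ [q]) (q + 4) (by omega) (by grind)) (.add (q := q + 3) le_rfl (q + 3) (q + 4))
  have hloop := hbody.loop hq k c (fun σ i τ => τ.arr = σ.arr ∧ τ.reg (q + 3) =
      σ.reg (q + 3) + ∑ j ∈ Finset.range i, f (σ.reg 0) σ.arr (ρ.map σ.reg ++ [j])) ?_ ?_
  · refine (Realizable.seq (q := q) hq (.const (x := q + 3) (q := q) (by omega) 0)
      (.seq (q := q) hq hloop
        (.move (q := q) le_rfl (z := q + 4) (by omega) (q + 3) (by omega) hq))).mono le_rfl ?_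
    rintro σ _ - ⟨_, hreg, rfl, -, υ, -, ⟨harr, hval⟩, -, rfl⟩
    rw [hreg.map_reg hρ, hreg 0 hq] at hval
    exact ⟨harr, by simpa using hval⟩
  · simp
  · rintro σ τ υ i d - hreg ⟨harr, hval⟩ hi - ⟨τ', hreg', ⟨harr', hval'⟩, -, rfl⟩
    rw [List.map_append, hreg.map_reg hρ, hreg 0 hq, harr] at hval'
    simp [Finset.sum_range_succ, harr', harr, hval', hreg' (q + 3), hval, hi, add_assoc]

theorem list (l : ℕ → ℕ → Mem → List ℕ → ℕ) : ∀ k : ℕ, (∀ i < k, IsComputable (l i)) →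
    ∀ {ρ : List ℕ} {q : ℕ}, 0 < q → (∀ r ∈ ρ, r < q) → Realizable q fun σ τ => τ.arr = σ.arr ∧
      ∀ i < k, τ.reg (q + i) = l i (σ.reg 0) σ.arr (ρ.map σ.reg)
  | 0, _, _, _, _, _ => Realizable.skip.mono le_rfl fun _ _ _ h => ⟨by rw [h], by simp⟩
  | k + 1, hl, ρ, q, hq, hρ => by
    have hlast := hl k (Nat.lt_succ_self k) ρ (q + k) (by omega)
      fun r hr => (hρ r hr).trans_le (Nat.le_add_right q k)
    refine (Realizable.seq hq (list l k (fun i hi => hl i (by omega)) hq hρ) hlast).mono le_rfl ?_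
    rintro σ υ - ⟨τ, hreg, ⟨harr, hval⟩, hreg', harr', hval'⟩
    rw [harr, hreg.map_reg hρ, hreg 0 hq] at hval'
    refine ⟨harr'.trans harr, fun i hi => ?_⟩
    rcases Nat.lt_succ_iff_lt_or_eq.1 hi with hi | rfl
    · exact (hreg' (q + i) (by omega)).trans (hval i hi)
    · exact hval'

theorem call {k : ℕ} {l : Fin k → ℕ → Mem → List ℕ → ℕ} (hl : ∀ i, IsComputable (l i))
    (hf : IsComputable f) :
    IsComputable fun n M env => f n M (List.ofFn fun i => l i n M env) := by
  intro ρ q hq hρ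
  have hargs := list (fun i => if h : i < k then l ⟨i, h⟩ else fun _ _ _ => 0) k
    (fun i hi => by simpa [hi] using hl ⟨i, hi⟩) hq hρ
  have hcall := hf (List.ofFn fun i : Fin k => q + i) (q + k) (by omega) (by grind)
  refine (Realizable.seq hq hargs (.seq (q := q) hq hcall
    (.move (q := q) le_rfl (z := q + k + 1) (by omega) (q + k) (by omega) hq))).mono le_rfl ?_
  rintro σ _ - ⟨τ, hreg, ⟨harr, hval⟩, -, υ, -, ⟨harr', hval'⟩, -, rfl⟩
  have hmap : (List.ofFn fun i : Fin k => q + (i : ℕ)).map τ.reg =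
      List.ofFn fun i => l i (σ.reg 0) σ.arr (ρ.map σ.reg) := by
    rw [List.map_ofFn]
    congr 1
    funext i
    simpa using hval i i.2
  rw [hmap, harr, hreg 0 hq] at hval'
  exact ⟨harr'.trans harr, by simpa using hval'⟩

end IsComputable

theorem Exp.isComputable_eval : ∀ e : Exp, IsComputable fun n M env => e.eval n M env
  | .const c => .const c
  | .var i => .var i
  | .size => .size
  | .add e f => e.isComputable_eval.add f.isComputable_eval
  | .sub e f => e.isComputable_eval.sub f.isComputable_eval
  | .read a e => e.isComputable_eval.read a
  | .ite c e f => c.isComputable_eval.ite e.isComputable_eval f.isComputable_eval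
  | .sum k c e => e.isComputable_eval.sum k c
  | .call _ args f => .call (fun i => (args i).isComputable_eval) f.isComputable_eval

namespace IsExecutable

variable {F G : ℕ → Mem → List ℕ → Mem} {f g : ℕ → Mem → List ℕ → ℕ}

theorem skip : IsExecutable fun _ M _ => M := fun _ _ _ _ =>
  Realizable.skip.mono le_rfl fun _ _ _ h => by rw [h]

theorem store (a : ℕ) (hf : IsComputable f) (hg : IsComputable g) :
    IsExecutable fun n M env =>
      Function.update M a (Function.update (M a) (f n M env) (g n M env)) := fun _ q hq hρ =>
  (Realizable.seq hq (hf.pair hg hq hρ) (.store (q := q) a q (q + 1))).mono le_rfl <| by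
    rintro σ _ - ⟨τ, -, ⟨harr, hval, hval'⟩, -, rfl⟩
    simp only [State.setArr, harr, hval, hval']

theorem seq (hF : IsExecutable F) (hG : IsExecutable G) :
    IsExecutable fun n M env => G n (F n M env) env := fun ρ q hq hρ =>
  (Realizable.seq hq (hF ρ q hq hρ) (hG ρ q hq hρ)).mono le_rfl <| by
    rintro σ υ - ⟨τ, hreg, harr, -, harr'⟩
    rw [harr', harr, hreg.map_reg hρ, hreg 0 hq]

theorem ite (hf : IsComputable f) (hF : IsExecutable F) (hG : IsExecutable G) :
    IsExecutable fun n M env => if f n M env ≠ 0 then F n M env else G n M env :=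
  fun ρ q hq hρ => (Realizable.seq hq (hf ρ q hq hρ)
    (.branch q (hF ρ q hq hρ) (hG ρ q hq hρ))).mono le_rfl <| by
    rintro σ υ - ⟨τ, hreg, ⟨harr, hval⟩, -, hυ⟩
    rw [hval, harr, hreg.map_reg hρ, hreg 0 hq] at hυ
    beta_reduce
    split_ifs at hυ ⊢ <;> exact hυ

theorem loop (k c : ℕ) (hF : IsExecutable F) : IsExecutable fun n M env =>
    (List.range (k * n + c)).foldl (fun M i => F n M (env ++ [i])) M := by
  intro ρ q hq hρ
  refine (hF (ρ ++ [q]) (q + 3) (by omega) (by grind)).loop hq k c (fun σ i τ =>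
    τ.arr = (List.range i).foldl (fun M i => F (σ.reg 0) M (ρ.map σ.reg ++ [i])) σ.arr)
    (by simp) ?_
  intro σ τ υ i d _ hreg harr hi _ harr'
  rw [List.map_append, hreg.map_reg hρ, hreg 0 hq, harr] at harr'
  simp [List.range_succ, harr', hi]

end IsExecutable

theorem Cmd.isExecutable_exec : ∀ C : Cmd, IsExecutable fun n M env => C.exec n M env
  | .skip => .skip
  | .store a e f => .store a e.isComputable_eval f.isComputable_eval
  | .seq C D => C.isExecutable_exec.seq D.isExecutable_exec
  | .ite e C D => .ite e.isComputable_eval C.isExecutable_exec D.isExecutable_exec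
  | .loop k c C => C.isExecutable_exec.loop k c

open Polynomial in
theorem Cmd.exists_runs (C : Cmd) : ∃ (P : Prog) (p : ℕ[X]), ∀ σ : State, ∃ (τ : State) (T : ℕ),
    Runs P σ τ T ∧ T ≤ p.eval (σ.reg 0) ∧ τ.arr = C.exec (σ.reg 0) σ.arr [] := by
  obtain ⟨P, p, hP⟩ := C.isExecutable_exec [] 1 one_pos (by simp)
  refine ⟨P, p, fun σ => ?_⟩
  obtain ⟨τ, ⟨T, hT, hrun⟩, -, harr⟩ := hP σ
  exact ⟨τ, T, hrun, hT, harr⟩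

end RAM

section Rank

variable {ι L : Type*} [LinearOrder L] {s : Finset ι} {f : ι → L} {u v : ι}

/-- The number of elements of `s` that `f` puts before `v`. -/
def rankIn (s : Finset ι) (f : ι → L) (v : ι) : ℕ := (s.filter fun u => f u < f v).card

theorem rankIn_le_rankIn (h : f u ≤ f v) : rankIn s f u ≤ rankIn s f v :=
  Finset.card_le_card <| Finset.monotone_filter_right s fun _ _ hw => hw.trans_le h

theorem lt_of_rankIn_lt (h : rankIn s f u < rankIn s f v) : f u < f v := by
  contrapose! h
  exact rankIn_le_rankIn h

theorem rankIn_lt_rankIn (hu : u ∈ s) (h : f u < f v) : rankIn s f u < rankIn s f v := by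
  refine Finset.card_lt_card (Finset.ssubset_iff_of_subset ?_ |>.2 ⟨u, ?_, ?_⟩)
  · exact Finset.monotone_filter_right s fun _ _ hw => hw.trans h
  · simp [hu, h]
  · simp

theorem rankIn_lt_card (hv : v ∈ s) : rankIn s f v < s.card :=
  Finset.card_lt_card <| Finset.ssubset_iff_of_subset (Finset.filter_subset _ _) |>.2
    ⟨v, hv, by simp⟩

theorem rankIn_injOn (hf : Set.InjOn f s) : Set.InjOn (rankIn s f) s := by
  intro u hu v hv h
  rcases lt_trichotomy (f u) (f v) with h' | h' | h'
  · exact absurd h (rankIn_lt_rankIn hu h').ne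
  · exact hf hu hv h'
  · exact absurd h (rankIn_lt_rankIn hv h').ne'

theorem exists_rankIn_eq (hf : Set.InjOn f s) {i : ℕ} (hi : i < s.card) :
    ∃ v ∈ s, rankIn s f v = i := by
  have himage : s.image (rankIn s f) = Finset.range s.card := by
    refine Finset.eq_of_subset_of_card_le (fun j hj => ?_) ?_
    · obtain ⟨v, hv, rfl⟩ := Finset.mem_image.1 hj
      exact Finset.mem_range.2 (rankIn_lt_card hv)
    · rw [Finset.card_image_of_injOn (rankIn_injOn hf), Finset.card_range]
  simpa only [← himage, Finset.mem_image] using Finset.mem_range.2 hi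

end Rank

/-! ### Rooted trees -/

section Dominator

variable {α : Type*} {T : SimpleGraph α} {r a b x y : α}

/-- In the tree `T` with root `r`, the vertex `a` is `x` or an ancestor of `x`: every walk from `r`
to `x` passes through `a`. -/
def Dom (T : SimpleGraph α) (r a x : α) : Prop := ∀ p : T.Walk r x, a ∈ p.support

theorem Dom.refl (a : α) : Dom T r a a := fun p => p.end_mem_support

theorem dom_root (x : α) : Dom T r r x := fun p => p.start_mem_support

theorem Dom.trans (h : Dom T r a x) (h' : Dom T r x y) : Dom T r a y := by
  classical
  exact fun p => p.support_takeUntil_subset_support (h' p) (h (p.takeUntil x (h' p)))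

theorem not_dom_of_adj (h : ¬ Dom T r a x) (hxy : T.Adj x y) (hy : a ≠ y) : ¬ Dom T r a y := by
  simp only [Dom, not_forall] at h ⊢
  obtain ⟨p, hp⟩ := h
  exact ⟨p.concat hxy, by simp [SimpleGraph.Walk.support_concat, hp, hy]⟩

theorem notMem_support_of_walk_deleteIncidenceSet (hr : r ≠ a)
    (p : (T.deleteIncidenceSet a).Walk r x) : a ∉ p.support := by
  induction p with
  | nil => simpa using hr.symm
  | cons h _ ih =>
    have h' := T.deleteIncidenceSet_adj.1 h
    simpa [h'.2.1.symm] using ih h'.2.2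

theorem reachable_deleteIncidenceSet {p : T.Walk r x} (hp : a ∉ p.support) :
    (T.deleteIncidenceSet a).Reachable r x := by
  induction p with
  | nil => rfl
  | cons h p ih =>
    simp only [SimpleGraph.Walk.support_cons, List.mem_cons, not_or] at hp
    have hadj := T.deleteIncidenceSet_adj.2
      ⟨h, Ne.symm hp.1, fun h' => hp.2 (h' ▸ p.start_mem_support)⟩
    exact hadj.reachable.trans (ih hp.2)

theorem dom_iff_not_reachable_deleteIncidenceSet :
    Dom T r a x ↔ a = x ∨ ¬ (T.deleteIncidenceSet a).Reachable r x := by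
  refine ⟨fun h => ?_, ?_⟩
  · by_contra! ⟨hax, ⟨p⟩⟩
    have hle := T.deleteIncidenceSet_le a
    have hmem : a ∈ p.support := p.support_mapLe_eq_support hle ▸ h (p.mapLe hle)
    by_cases hr : r = a
    · subst hr
      cases p with
      | nil => exact hax rfl
      | cons h _ => exact (T.deleteIncidenceSet_adj.1 h).2.1 rfl
    · exact notMem_support_of_walk_deleteIncidenceSet hr p hmem
  · rintro (rfl | h) p
    · exact p.end_mem_support
    · exact not_imp_comm.1 reachable_deleteIncidenceSet h

theorem Dom.dist_lt (hT : T.Connected) (h : Dom T r a x) (hne : a ≠ x) :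
    T.dist r a < T.dist r x := by
  classical
  obtain ⟨p, hp⟩ := hT.exists_walk_length_eq_dist r x
  rw [← hp]
  exact (SimpleGraph.dist_le _).trans_lt (p.length_takeUntil_lt_length (h p) hne)

theorem Dom.antisymm (hT : T.Connected) (h : Dom T r a x) (h' : Dom T r x a) : a = x := by
  by_contra hne
  exact (h.dist_lt hT hne).asymm (h'.dist_lt hT (Ne.symm hne))

theorem Dom.total (hT : T.Connected) (ha : Dom T r a x) (hb : Dom T r b x) :
    Dom T r a b ∨ Dom T r b a := by
  by_contra! ⟨hab, hba⟩
  have hwalk : ∀ y, T.Walk r y → ¬ Dom T r a y ∨ ¬ Dom T r b y := by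
    intro y p
    induction p using SimpleGraph.Walk.concatRec with
    | @Hnil r =>
      refine or_iff_not_imp_left.2 fun h => ?_
      obtain rfl : a = r := by simpa using not_not.1 h .nil
      exact hba
    | @Hconcat _ _ z _ h ih =>
      rcases ih ha hb hab hba with h' | h'
      · by_cases hz : a = z
        · exact .inr (hz ▸ hba)
        · exact .inl (not_dom_of_adj h' h hz)
      · by_cases hz : b = z
        · exact .inl (hz ▸ hab)
        · exact .inr (not_dom_of_adj h' h hz)
  obtain ⟨p⟩ := hT.preconnected r x
  exact (hwalk x p).elim (· ha) (· hb)

theorem dom_or_dom_of_adj (hT : T.IsAcyclic) (h : T.Adj x y) : Dom T r x y ∨ Dom T r y x := by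
  by_contra! hc
  simp only [Dom, not_forall] at hc
  obtain ⟨⟨p, hp⟩, q, hq⟩ := hc
  have hbridge := SimpleGraph.isAcyclic_iff_forall_adj_isBridge.1 hT h
  have hedge := SimpleGraph.isBridge_iff_forall_walk_mem_edges.1 hbridge (q.reverse.append p)
  rw [SimpleGraph.Walk.edges_append, List.mem_append, SimpleGraph.Walk.edges_reverse,
    List.mem_reverse] at hedge
  rcases hedge with h' | h'
  · exact hq (q.snd_mem_support_of_mem_edges h')
  · exact hp (p.fst_mem_support_of_mem_edges h')

theorem preconnected_induction {S : Set α} (hS : (T.induce S).Preconnected) {P : α → Prop}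
    (ha : a ∈ S) (hP : P a) (step : ∀ x ∈ S, ∀ y ∈ S, T.Adj x y → P x → P y) : ∀ x ∈ S, P x := by
  intro x hx
  obtain ⟨p⟩ := hS ⟨a, ha⟩ ⟨x, hx⟩
  suffices ∀ (u v : S), (T.induce S).Walk u v → P u → P v from this _ _ p hP
  intro u v p
  induction p with
  | nil => exact id
  | cons h _ ih => exact fun hu => ih (step _ (Subtype.coe_prop _) _ (Subtype.coe_prop _) h hu)

theorem mem_of_dom_of_dom (hT : T.Connected) {S : Set α} (hS : (T.induce S).Preconnected)
    (ha : a ∈ S) (hx : x ∈ S) (hab : Dom T r a b) (hbx : Dom T r b x) : b ∈ S := by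
  by_contra hb
  have hba : ¬ Dom T r b a := fun h => hb (h.antisymm hT hab ▸ ha)
  refine preconnected_induction (P := fun y => ¬ Dom T r b y) hS ha hba
    (fun y _ z hz hyz h => ?_) x hx hbx
  exact not_dom_of_adj h hyz fun h' => hb (h' ▸ hz)

/-- The vertex `a` is lowest in the tree with root `r`: it is an ancestor of no other vertex. -/
def IsBottom (T : SimpleGraph α) (r a : α) : Prop := ∀ x, Dom T r a x → x = a

theorem eq_of_adj_of_dom_of_dom (hT : T.Connected) {z : α} (hy : T.Adj x y) (hz : T.Adj x z)
    (hzx : Dom T r z x) (hyz : Dom T r y z) : y = z := by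
  by_contra hne
  exact not_dom_of_adj (fun h => hne (hyz.antisymm hT h)) hy.symm hz.ne' hzx

theorem IsBottom.eq_of_adj (hT : T.IsTree) {z : α} (hx : IsBottom T r x) (hy : T.Adj x y)
    (hz : T.Adj x z) : y = z := by
  have hdom : ∀ {w}, T.Adj x w → Dom T r w x := fun {w} hw =>
    (dom_or_dom_of_adj hT.isAcyclic hw).resolve_left fun h => hw.ne (hx w h).symm
  rcases (hdom hy).total hT.connected (hdom hz) with h | h
  · exact eq_of_adj_of_dom_of_dom hT.connected hy hz (hdom hz) h
  · exact (eq_of_adj_of_dom_of_dom hT.connected hz hy (hdom hy) h).symm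

theorem exists_isBottom [Finite α] (hT : T.Connected) (a : α) :
    ∃ x, IsBottom T r x ∧ Dom T r a x := by
  obtain ⟨x, hx, hmax⟩ := Set.exists_max_image {x | Dom T r a x} (T.dist r) (Set.toFinite _)
    ⟨a, Dom.refl a⟩
  refine ⟨x, fun y hy => ?_, hx⟩
  by_contra hne
  exact absurd (hmax y (hx.trans hy)) (hy.dist_lt hT (Ne.symm hne)).not_ge

variable [Fintype α]

open Classical in
/-- The number of descendants of `a`, itself included, in the tree with root `r`. -/
noncomputable def domSize (T : SimpleGraph α) (r a : α) : ℕ :=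
  (Finset.univ.filter fun x => Dom T r a x).card

theorem Dom.domSize_lt (hT : T.Connected) (h : Dom T r a x) (hne : a ≠ x) :
    domSize T r x < domSize T r a := by
  classical
  refine Finset.card_lt_card (Finset.ssubset_iff_of_subset ?_ |>.2 ⟨a, ?_, ?_⟩)
  · exact Finset.monotone_filter_right _ fun _ _ hy => h.trans hy
  · simp [Dom.refl]
  · simpa using fun h' => hne (h.antisymm hT h')

open Classical in
theorem sum_degree_sub_two_add_two [Nontrivial α] (hT : T.IsTree) :
    ∑ a, (T.degree a - 2) + 2 = (Finset.univ.filter fun a => T.degree a ≤ 1).card := by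
  have hsum := T.sum_degrees_eq_twice_card_edges
  have hcard := hT.card_edgeFinset
  have hdeg : ∑ a, (T.degree a + if T.degree a ≤ 1 then 1 else 0) = ∑ a, (2 + (T.degree a - 2)) :=
    Finset.sum_congr rfl fun a _ => by
      have := hT.connected.preconnected.degree_pos_of_nontrivial a
      split_ifs <;> omega
  rw [Finset.sum_add_distrib, Finset.sum_add_distrib, Finset.sum_const, smul_eq_mul,
    Finset.card_univ, ← Finset.card_filter] at hdeg
  omega

open Classical in
theorem exists_degree_le_one (hT : T.IsTree) : ∃ a, T.degree a ≤ 1 := by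
  have := hT.connected.nonempty
  rcases subsingleton_or_nontrivial α with _ | _
  · exact this.elim fun a => ⟨a, by simp⟩
  · exact hT.exists_vert_degree_one_of_nontrivial.imp fun _ h => h.le

open Classical in
theorem IsBottom.degree_le_one (hT : T.IsTree) (hx : IsBottom T r x) : T.degree x ≤ 1 := by
  rw [← T.card_neighborFinset_eq_degree, Finset.card_le_one]
  exact fun y hy z hz => hx.eq_of_adj hT (by simpa using hy) (by simpa using hz)

open Classical in
theorem card_isBottom_le (hT : T.IsTree) (hr : T.degree r ≤ 1) :
    (Finset.univ.filter (IsBottom T r)).card ≤ 1 + ∑ a, (T.degree a - 2) := by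
  by_cases h : IsBottom T r r
  · have hsub : Finset.univ.filter (IsBottom T r) ⊆ {r} := fun x _ => by
      simpa using h x (dom_root x)
    exact (Finset.card_le_card hsub).trans (by simp)
  · have hlt : (Finset.univ.filter (IsBottom T r)).card
        < (Finset.univ.filter fun a => T.degree a ≤ 1).card :=
      Finset.card_lt_card <| Finset.ssubset_iff_of_subset
        (Finset.monotone_filter_right _ fun _ _ hx => hx.degree_le_one hT) |>.2
          ⟨r, by simpa using hr, by simpa using h⟩
    have : Nontrivial α := by
      by_contra hα
      rw [not_nontrivial_iff_subsingleton] at hα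
      exact h fun x _ => Subsingleton.elim x r
    have := sum_degree_sub_two_add_two hT
    omega

variable [LinearOrder α]

/-- The key by which the vertices of the tree with root `r` are sorted bottom-up. -/
noncomputable def height (T : SimpleGraph α) (r a : α) : ℕ ×ₗ α := toLex (domSize T r a, a)

theorem Dom.of_height_le (hT : T.Connected) (ha : Dom T r a x) (hb : Dom T r b x)
    (h : height T r a ≤ height T r b) : Dom T r b a := by
  rcases ha.total hT hb with h' | h'
  · by_cases hne : a = b
    · exact hne ▸ Dom.refl a
    · have hlt := h'.domSize_lt hT hne
      rw [height, height, Prod.Lex.toLex_le_toLex] at h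
      simp only at h
      omega
  · exact h'

theorem dom_of_forall_height_le (hT : T.IsTree) {S : Set α} (hS : (T.induce S).Preconnected)
    (ha : a ∈ S) (hmax : ∀ x ∈ S, height T r x ≤ height T r a) : ∀ x ∈ S, Dom T r a x := by
  refine preconnected_induction hS ha (Dom.refl a) fun x _ y hy hxy hax => ?_
  rcases dom_or_dom_of_adj (r := r) hT.isAcyclic hxy with h | h
  · exact hax.trans h
  · exact h.of_height_le hT.connected hax (hmax y hy)

theorem mem_of_height_le_of_height_le (hT : T.IsTree) {S : Set α} {l m p q : α}
    (hS : (T.induce S).Preconnected) (hm : m ∈ S)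
    (hmax : ∀ x ∈ S, height T r x ≤ height T r m) (hq : q ∈ S) (hql : Dom T r q l)
    (hpl : Dom T r p l) (hqp : height T r q ≤ height T r p) (hpm : height T r p ≤ height T r m) :
    p ∈ S := by
  have hmq : Dom T r m q := dom_of_forall_height_le hT hS hm hmax q hq
  have hpq : Dom T r p q := hql.of_height_le hT.connected hpl hqp
  have hmp : Dom T r m p := hpq.of_height_le hT.connected hmq hpm
  exact mem_of_dom_of_dom hT.connected hS hm hq hmp hpq

open Classical in
/-- The number of bottoms before the first bottom below `a`. -/
noncomputable def chainOf (T : SimpleGraph α) (r a : α) : ℕ :=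
  (Finset.univ.filter fun l => IsBottom T r l ∧
    ∀ l', IsBottom T r l' → Dom T r a l' → l < l').card

open Classical in
theorem exists_isBottom_chainOf_eq_rankIn (hT : T.Connected) (a : α) :
    ∃ l, IsBottom T r l ∧ Dom T r a l ∧
      chainOf T r a = rankIn (Finset.univ.filter (IsBottom T r)) id l := by
  obtain ⟨l, ⟨hl, hal⟩, hmin⟩ := Set.exists_min_image {l | IsBottom T r l ∧ Dom T r a l} id
    (Set.toFinite _) (exists_isBottom hT a)
  refine ⟨l, hl, hal, ?_⟩
  rw [chainOf, rankIn, Finset.filter_filter]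
  congr 1
  refine Finset.filter_congr fun x _ => and_congr_right fun _ => ?_
  exact ⟨fun h => h l hl hal, fun h l' h1 h2 => h.trans_le (hmin l' ⟨h1, h2⟩)⟩

open Classical in
theorem chainOf_lt (hT : T.Connected) (a : α) :
    chainOf T r a < (Finset.univ.filter (IsBottom T r)).card := by
  obtain ⟨l, hl, -, h⟩ := exists_isBottom_chainOf_eq_rankIn hT (r := r) a
  exact h ▸ rankIn_lt_card (by simpa using hl)

theorem exists_dom_of_chainOf_eq (hT : T.Connected) (h : chainOf T r a = chainOf T r b) :
    ∃ l, Dom T r a l ∧ Dom T r b l := by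
  obtain ⟨l, hl, hal, hl'⟩ := exists_isBottom_chainOf_eq_rankIn hT (r := r) a
  obtain ⟨m, hm, hbm, hm'⟩ := exists_isBottom_chainOf_eq_rankIn hT (r := r) b
  obtain rfl : l = m := rankIn_injOn Function.injective_id.injOn (by simpa using hl)
    (by simpa using hm) (hl'.symm.trans (h.trans hm'))
  exact ⟨l, hal, hbm⟩

end Dominator

/-! ### The ordering and the classes defined by a rooted tree -/

section Ordering

theorem card_height_le_le_card_height_le_iff {α : Type*} [Fintype α] [LinearOrder α]
    {T : SimpleGraph α} {r a b : α} : (Finset.univ.filter fun c => height T r c ≤ height T r a).card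
      ≤ (Finset.univ.filter fun c => height T r c ≤ height T r b).card ↔
        height T r a ≤ height T r b := by
  refine ⟨fun h => ?_, fun h => Finset.card_le_card <|
    Finset.monotone_filter_right _ fun _ _ hc => hc.trans h⟩
  contrapose! h
  refine Finset.card_lt_card (Finset.ssubset_iff_of_subset ?_ |>.2 ⟨a, ?_, ?_⟩)
  · exact Finset.monotone_filter_right _ fun _ _ hc => hc.trans h.le
  · simp
  · simpa using h

variable {V : Type*} [LinearOrder V] (G : SimpleGraph V) (A : Set V) [Fintype A]
  (T : SimpleGraph A) (r : A)

/-- The vertices of `A` that determine where `v` is placed: `v` itself if it is in `A`, and its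
neighbours otherwise. -/
def anchors (v : V) : Set A := {a | v = a ∨ v ∉ A ∧ G.Adj v a}

open Classical in
/-- The key of the consistent ordering: the vertices of `A` come bottom-up (even keys), and each
other vertex comes right after its last neighbour (odd keys). -/
noncomputable def orderKey (v : V) : ℕ :=
  2 * (Finset.univ.filter fun a : A => ∃ b ∈ anchors G A v, height T r a ≤ height T r b).card +
    if v ∈ A then 0 else 1

/-- The index of `v` in the consistent ordering. -/
noncomputable def position [Fintype V] (v : V) : ℕ :=
  rankIn Finset.univ (fun u => (toLex (orderKey G A T r u, u) : ℕ ×ₗ V)) v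

open Classical in
/-- The class of `v` in the consistent partition: one class consists of the vertices outside `A`,
and the others are chains of the tree. -/
noncomputable def classOf (v : V) : ℕ := if h : v ∈ A then 1 + chainOf T r ⟨v, h⟩ else 0

variable {G A T r} {u v : V}

theorem orderKey_of_mem (hv : v ∈ A) : orderKey G A T r v =
    2 * (Finset.univ.filter fun c : A => height T r c ≤ height T r ⟨v, hv⟩).card := by
  have hanchors : anchors G A v = {⟨v, hv⟩} := by
    ext a
    simp [anchors, hv, Subtype.ext_iff, eq_comm]
  simp [orderKey, hanchors, hv]

theorem orderKey_of_notMem (hv : v ∉ A) {m : A} (hm : G.Adj v m)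
    (hmax : ∀ b : A, G.Adj v b → height T r b ≤ height T r m) : orderKey G A T r v =
      2 * (Finset.univ.filter fun c : A => height T r c ≤ height T r m).card + 1 := by
  have hanchors : ∀ c : A, (∃ b ∈ anchors G A v, height T r c ≤ height T r b) ↔
      height T r c ≤ height T r m := by
    refine fun c => ⟨?_, fun h => ⟨m, .inr ⟨hv, hm⟩, h⟩⟩
    rintro ⟨b, hb | hb, h⟩
    · exact absurd (hb ▸ b.2) hv
    · exact h.trans (hmax b hb.2)
  simp [orderKey, hanchors, hv]

theorem exists_highest_neighbor (T : SimpleGraph A) (r : A) {a : A} (ha : G.Adj v a) :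
    ∃ m : A, G.Adj v m ∧ ∀ b : A, G.Adj v b → height T r b ≤ height T r m :=
  Set.exists_max_image {a : A | G.Adj v a} (height T r) (Set.toFinite _) ⟨a, ha⟩

open Classical in
theorem classOf_lt (hT : T.IsTree) (hr : T.degree r ≤ 1) (v : V) :
    classOf A T r v < 2 + ∑ a, (T.degree a - 2) := by
  have hcard := card_isBottom_le hT hr
  unfold classOf
  split_ifs with h
  · have := chainOf_lt hT.connected (r := r) ⟨v, h⟩
    omega
  · omega

variable [Fintype V]

theorem position_injective : Function.Injective (position G A T r) := fun u v h =>
  rankIn_injOn (f := fun u => (toLex (orderKey G A T r u, u) : ℕ ×ₗ V))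
    (fun _ _ _ _ h' => (Prod.mk.inj h').2) (Finset.mem_coe.2 (Finset.mem_univ u))
    (Finset.mem_coe.2 (Finset.mem_univ v)) h

theorem position_lt_card (v : V) : position G A T r v < Fintype.card V :=
  rankIn_lt_card (Finset.mem_univ v)

theorem orderKey_le_of_position_lt (h : position G A T r u < position G A T r v) :
    orderKey G A T r u ≤ orderKey G A T r v := by
  rcases (Prod.Lex.toLex_lt_toLex).1 (lt_of_rankIn_lt h) with h' | h'
  · exact h'.le
  · exact h'.1.le

theorem adj_of_position_lt_of_mem (hT : T.IsTree) {q p s : V} (hq : q ∈ A) (hs : s ∉ A)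
    (hsupp : (T.induce {a : A | G.Adj s a}).Preconnected)
    (hqp : position G A T r q < position G A T r p) (hps : position G A T r p < position G A T r s)
    (hc : classOf A T r q = classOf A T r p) (hqs : G.Adj q s) : G.Adj p s := by
  have hp : p ∈ A := by
    by_contra hp
    simp [classOf, hq, hp] at hc
  obtain ⟨l, hql, hpl⟩ : ∃ l, Dom T r ⟨q, hq⟩ l ∧ Dom T r ⟨p, hp⟩ l :=
    exists_dom_of_chainOf_eq hT.connected (by simpa [classOf, hq, hp] using hc)
  obtain ⟨m, hm, hmax⟩ := exists_highest_neighbor T r (a := ⟨q, hq⟩) hqs.symm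
  have hkeyqp := orderKey_le_of_position_lt hqp
  have hkeyps := orderKey_le_of_position_lt hps
  rw [orderKey_of_mem hq, orderKey_of_mem hp] at hkeyqp
  rw [orderKey_of_mem hp, orderKey_of_notMem hs hm hmax] at hkeyps
  refine SimpleGraph.Adj.symm <| mem_of_height_le_of_height_le hT hsupp hm hmax hqs.symm hql hpl
    (card_height_le_le_card_height_le_iff.1 ?_) (card_height_le_le_card_height_le_iff.1 ?_)
  · omega
  · omega

theorem position_lt_of_adj (hu : u ∈ A) (hv : v ∉ A) (h : G.Adj v u) :
    position G A T r u < position G A T r v := by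
  obtain ⟨m, hm, hmax⟩ := exists_highest_neighbor T r (a := ⟨u, hu⟩) h
  have hcard := card_height_le_le_card_height_le_iff.2 (hmax ⟨u, hu⟩ h)
  refine (le_of_not_gt fun hlt => ?_).lt_of_ne fun heq => hv (position_injective heq ▸ hu)
  have hkey := orderKey_le_of_position_lt hlt
  rw [orderKey_of_mem hu, orderKey_of_notMem hv hm hmax] at hkey
  omega

theorem adj_of_position_lt {B : Set V} (hG : G.IsBipartiteWith A B) (hcover : A ∪ B = Set.univ)
    (hT : T.IsTree) (hsupp : ∀ b ∈ B, (T.induce {a : A | G.Adj b a}).Preconnected)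
    {q p s : V} (hqp : position G A T r q < position G A T r p)
    (hps : position G A T r p < position G A T r s)
    (hc : classOf A T r q = classOf A T r p) (hqs : G.Adj q s) : G.Adj p s := by
  by_cases hq : q ∈ A
  · have hs : s ∈ B := hG.mem_of_mem_adj hq hqs
    exact adj_of_position_lt_of_mem hT hq (fun h => Set.disjoint_left.1 hG.disjoint h hs)
      (hsupp s hs) hqp hps hc hqs
  · have hqB : q ∈ B := ((Set.ext_iff.1 hcover q).2 (Set.mem_univ q)).resolve_left hq
    have hs : s ∈ A := hG.symm.mem_of_mem_adj hqB hqs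
    exact absurd (position_lt_of_adj hs hq hqs) (hqp.trans hps).asymm

theorem exists_isConsistent {B : Set V} (hG : G.IsBipartiteWith A B) (hcover : A ∪ B = Set.univ)
    (hT : T.IsTree) (hsupp : ∀ b ∈ B, (T.induce {a : A | G.Adj b a}).Preconnected)
    {n k : ℕ} (hn : Fintype.card V = n) (hk : ∀ v, classOf A T r v < k) :
    ∃ (v : Fin n ≃ V) (c : V → Fin k), IsConsistent G v c ∧
      (∀ x, ((v.symm x : Fin n) : ℕ) = position G A T r x) ∧
      ∀ x, (c x : ℕ) = classOf A T r x := by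
  let index : V → Fin n := fun x => ⟨position G A T r x, hn ▸ position_lt_card x⟩
  have hindex : Function.Bijective index :=
    (Fintype.bijective_iff_injective_and_card index).2
      ⟨fun x y h => position_injective (Fin.mk.inj_iff.1 h), by simpa using hn⟩
  refine ⟨(Equiv.ofBijective index hindex).symm, fun x => ⟨classOf A T r x, hk x⟩, ?_,
    fun _ => rfl, fun _ => rfl⟩
  have hpos : ∀ i, position G A T r ((Equiv.ofBijective index hindex).symm i) = i := fun i =>
    congrArg Fin.val ((Equiv.ofBijective index hindex).apply_symm_apply i)
  intro q p s hqp hps hc hqs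
  refine adj_of_position_lt hG hcover hT hsupp ?_ ?_ (congrArg Fin.val hc) hqs
  · simpa only [hpos, Fin.val_fin_lt] using hqp
  · simpa only [hpos, Fin.val_fin_lt] using hps

end Ordering

/-! ### Separators, classes and tokens -/

section Separators

variable {α β : Type*}

theorem induce_subset_preconnected {T : SimpleGraph α} (hT : T.IsTree) {N : α → Set β}
    (h : ∀ b, (T.induce {a | b ∈ N a}).Preconnected) (S : Set β) :
    (T.induce {a | S ⊆ N a}).Preconnected := by
  classical
  rintro ⟨a, ha⟩ ⟨b, hb⟩
  obtain ⟨p, hp⟩ := (hT.connected.preconnected a b).exists_isPath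
  refine ⟨p.induce {a | S ⊆ N a} fun x hx s hs => ?_⟩
  obtain ⟨w⟩ := h s ⟨a, ha hs⟩ ⟨b, hb hs⟩
  let w' : T.Walk a b := w.map (SimpleGraph.Embedding.induce _).toHom
  have hpw : p = w'.bypass := congrArg Subtype.val
    ((hT.isAcyclic.subsingleton_path a b).elim ⟨p, hp⟩ ⟨w'.bypass, w'.bypass_isPath⟩)
  have hxw : x ∈ w'.support := w'.support_bypass_subset_support (hpw ▸ hx)
  have hsupp : w'.support = w.support.map Subtype.val := w.support_map _
  obtain ⟨y, -, rfl⟩ := List.mem_map.1 (hsupp ▸ hxw)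
  exact y.2

variable (N : α → Set β)

/-- Vertices are adjacent if they have more than `S` in common. -/
def classGraph (S : Set β) : SimpleGraph α where
  Adj a b := a ≠ b ∧ S ⊂ N a ∩ N b
  symm := ⟨fun a b h => ⟨h.1.symm, by rw [Set.inter_comm]; exact h.2⟩⟩
  loopless := ⟨fun _ h => h.1 rfl⟩

/-- The vertices `a` and `b` are in the same class of `S`. In a tree supporting `N`, the edges `p q`
with `N p ∩ N q = S` are exactly the edges that join distinct classes of `S` within
`{a | S ⊆ N a}`. -/
def SameClass (S : Set β) (a b : α) : Prop := (classGraph N S).Reachable a b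

variable {N} {S : Set β} {a b c x y z w : α} {k l : Bool}

theorem SameClass.refl (a : α) : SameClass N S a a := SimpleGraph.Reachable.refl a

theorem SameClass.symm (h : SameClass N S a b) : SameClass N S b a := SimpleGraph.Reachable.symm h

theorem SameClass.trans (h : SameClass N S a b) (h' : SameClass N S b c) : SameClass N S a c :=
  SimpleGraph.Reachable.trans h h'

theorem SameClass.subset (h : SameClass N S a b) (ha : S ⊆ N a) : S ⊆ N b := by
  obtain ⟨p⟩ := h
  induction p with
  | nil => exact ha
  | cons h _ ih => exact ih (h.2.subset.trans Set.inter_subset_right)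

theorem inter_eq_of_not_sameClass (h : ¬ SameClass N S a b) (ha : S ⊆ N a) (hb : S ⊆ N b) :
    N a ∩ N b = S := by
  by_contra hne
  refine h (SimpleGraph.Adj.reachable ⟨?_, (Set.subset_inter ha hb).ssubset_of_ne (Ne.symm hne)⟩)
  rintro rfl
  exact h (SameClass.refl a)

open Classical in
/-- The oriented edges of `T` with separator `S`. -/
noncomputable def sepDarts [Fintype α] (N : α → Set β) (T : SimpleGraph α) (S : Set β) :
    Finset T.Dart :=
  Finset.univ.filter fun d => N d.fst ∩ N d.snd = S

theorem mem_sepDarts [Fintype α] {T : SimpleGraph α} {d : T.Dart} :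
    d ∈ sepDarts N T S ↔ N d.fst ∩ N d.snd = S := by
  simp [sepDarts]

variable [LinearOrder α]

variable (N)

/-- The pair `x, y` is the chosen one, namely the lexicographically first one, among the pairs in
distinct classes of their common separator `N x ∩ N y`. -/
def IsCanonical (x y : α) : Prop :=
  ¬ SameClass N (N x ∩ N y) x y ∧ ∀ x' y', toLex (x', y') < toLex (x, y) →
    ¬ SameClass N (N x' ∩ N y') x' y' → N x' ∩ N y' ≠ N x ∩ N y

/-- The vertex `z` represents its class of `S`: it is the first member. -/
def IsRep (S : Set β) (z : α) : Prop := S ⊆ N z ∧ ∀ w, SameClass N S z w → z ≤ w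

/-- The tokens stand for the ends of the tree edges with separator `N x ∩ N y`. A separator with `m`
classes, represented by its canonical pair `x, y`, needs `m - 1` edges: there is a bound token
(`k = false`) for each class and a free token (`k = true`) for each class but those of `x`
and `y`. -/
def IsToken (x y z : α) (k : Bool) : Prop :=
  IsCanonical N x y ∧ IsRep N (N x ∩ N y) z ∧
    (k = true → ¬ SameClass N (N x ∩ N y) x z ∧ ¬ SameClass N (N x ∩ N y) y z)

/-- The token `x, y, z, k` can be placed on `a`: a bound token must be placed on its class, a free
token on any class of the separator. -/
def Allowed (x y z : α) (k : Bool) (a : α) : Prop :=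
  if k = true then N x ∩ N y ⊆ N a else SameClass N (N x ∩ N y) z a

variable {N}

theorem IsCanonical.ext {x' y' : α} (h : IsCanonical N x y) (h' : IsCanonical N x' y')
    (he : N x ∩ N y = N x' ∩ N y') : x = x' ∧ y = y' := by
  rcases lt_trichotomy (toLex (x, y)) (toLex (x', y')) with hlt | heq | hgt
  · exact absurd he (h'.2 x y hlt h.1)
  · exact Prod.mk.inj heq
  · exact absurd he.symm (h.2 x' y' hgt h'.1)

theorem IsToken.of_isRep (hxy : IsCanonical N x y) (hz : IsRep N (N x ∩ N y) z) :
    IsToken N x y z false := ⟨hxy, hz, by simp⟩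

theorem exists_isCanonical [Finite α] (h : ¬ SameClass N (N x ∩ N y) x y) :
    ∃ x' y', IsCanonical N x' y' ∧ N x' ∩ N y' = N x ∩ N y := by
  obtain ⟨⟨x', y'⟩, ⟨hne, heq⟩, hmin⟩ := Set.exists_min_image
    {p : α × α | ¬ SameClass N (N p.1 ∩ N p.2) p.1 p.2 ∧ N p.1 ∩ N p.2 = N x ∩ N y} toLex
    (Set.toFinite _) ⟨(x, y), h, rfl⟩
  exact ⟨x', y', ⟨hne, fun a b hlt hab he => absurd (hmin (a, b) ⟨hab, he.trans heq⟩) hlt.not_ge⟩,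
    heq⟩

variable [Fintype α]

variable (N)

open Classical in
/-- The representative of the class of `a`. -/
noncomputable def repOf (S : Set β) (a : α) : α :=
  (Finset.univ.filter (SameClass N S a)).min' ⟨a, by simp [SameClass.refl]⟩

open Classical in
/-- The representatives of the classes of `S`. -/
noncomputable def reps (S : Set β) : Finset α := Finset.univ.filter (IsRep N S)

open Classical in
/-- The representatives that have a free token. -/
noncomputable def frees (x y : α) : Finset α := Finset.univ.filter fun z => IsToken N x y z true

open Classical in
/-- All tokens of all separators. -/
noncomputable def tokens : Finset (α × α × α × Bool) :=
  Finset.univ.filter fun u => IsToken N u.1 u.2.1 u.2.2.1 u.2.2.2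

variable {N}

theorem mem_reps : z ∈ reps N S ↔ IsRep N S z := by simp [reps]

theorem mem_frees : z ∈ frees N x y ↔ IsToken N x y z true := by simp [frees]

theorem mem_tokens : (x, y, z, k) ∈ tokens N ↔ IsToken N x y z k := by simp [tokens]

theorem sameClass_repOf (S : Set β) (a : α) : SameClass N S a (repOf N S a) := by
  classical
  have hmem := Finset.min'_mem (Finset.univ.filter (SameClass N S a)) ⟨a, by simp [SameClass.refl]⟩
  exact (Finset.mem_filter.1 hmem).2

theorem repOf_le (h : SameClass N S a b) : repOf N S a ≤ b := Finset.min'_le _ _ (by simpa using h)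

theorem isRep_repOf (ha : S ⊆ N a) : IsRep N S (repOf N S a) :=
  ⟨(sameClass_repOf S a).subset ha, fun _ hw => repOf_le ((sameClass_repOf S a).trans hw)⟩

theorem repOf_mem_reps (ha : S ⊆ N a) : repOf N S a ∈ reps N S := mem_reps.2 (isRep_repOf ha)

theorem IsRep.repOf_eq (hz : IsRep N S z) (h : SameClass N S z a) : repOf N S a = z :=
  le_antisymm (repOf_le h.symm) (hz.2 _ (h.trans (sameClass_repOf S a)))

theorem repOf_eq_repOf_iff (ha : S ⊆ N a) : repOf N S a = repOf N S b ↔ SameClass N S a b :=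
  ⟨fun h => (sameClass_repOf S a).trans (h ▸ (sameClass_repOf S b).symm),
    fun h => ((isRep_repOf ha).repOf_eq ((sameClass_repOf S a).symm.trans h)).symm⟩

theorem card_frees_add_two (h : IsCanonical N x y) :
    (frees N x y).card + 2 = (reps N (N x ∩ N y)).card := by
  set S := N x ∩ N y with hS
  have hx : S ⊆ N x := Set.inter_subset_left
  have hy : S ⊆ N y := Set.inter_subset_right
  have hne : repOf N S x ≠ repOf N S y := mt (repOf_eq_repOf_iff hx).1 h.1
  have hpair : {repOf N S x, repOf N S y} ⊆ reps N S := by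
    simp [Finset.insert_subset_iff, repOf_mem_reps hx, repOf_mem_reps hy]
  have hfrees : frees N x y = reps N S \ {repOf N S x, repOf N S y} := by
    ext z
    simp only [mem_frees, mem_reps, IsToken, Finset.mem_sdiff, Finset.mem_insert,
      Finset.mem_singleton, not_or, ← hS, h, true_and, forall_const]
    refine and_congr_right fun hz => ?_
    have hrep : ∀ w, SameClass N S w z ↔ z = repOf N S w := fun w =>
      ⟨fun hw => (hz.repOf_eq hw.symm).symm, fun hw => hw ▸ sameClass_repOf S w⟩
    simp only [hrep]
  have hle := Finset.card_le_card hpair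
  rw [Finset.card_pair hne] at hle
  rw [hfrees, Finset.card_sdiff_of_subset hpair, Finset.card_pair hne]
  omega

/-! ### Tokens and the edges of a tree -/

variable {T : SimpleGraph α}

/-- The graph on the classes of `S` in which classes joined by an edge of `T` with separator `S` are
adjacent. -/
def quotGraph (N : α → Set β) (T : SimpleGraph α) (S : Set β) : SimpleGraph (reps N S) where
  Adj z w := z ≠ w ∧ ∃ d ∈ sepDarts N T S, SameClass N S z d.fst ∧ SameClass N S w d.snd
  symm := ⟨by
    rintro z w ⟨hne, d, hd, h1, h2⟩
    refine ⟨hne.symm, d.symm, ?_, h2, h1⟩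
    rw [mem_sepDarts] at hd ⊢
    exact (Set.inter_comm _ _).trans hd⟩
  loopless := ⟨fun _ h => h.1 rfl⟩

theorem quotGraph_preconnected (hT : (T.induce {a | S ⊆ N a}).Preconnected) :
    (quotGraph N T S).Preconnected := by
  rintro ⟨z, hz⟩ ⟨w, hw⟩
  have hz' := mem_reps.1 hz
  have hw' := mem_reps.1 hw
  have hreach : ∀ a ∈ {a | S ⊆ N a}, ∀ h : repOf N S a ∈ reps N S,
      (quotGraph N T S).Reachable ⟨z, hz⟩ ⟨repOf N S a, h⟩ := by
    refine preconnected_induction hT (a := z) hz'.1 ?_ fun a ha b hb hab ih h => ?_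
    · simp only [hz'.repOf_eq (SameClass.refl z)]
      exact fun _ => .refl _
    · refine (ih (repOf_mem_reps ha)).trans ?_
      by_cases hs : SameClass N S a b
      · simp only [(repOf_eq_repOf_iff ha).2 hs]
        rfl
      · exact SimpleGraph.Adj.reachable
          ⟨fun he => hs ((repOf_eq_repOf_iff ha).1 (congrArg Subtype.val he)), ⟨(a, b), hab⟩,
            mem_sepDarts.2 (inter_eq_of_not_sameClass hs ha hb), (sameClass_repOf S a).symm,
            (sameClass_repOf S b).symm⟩
  have hrep := hw'.repOf_eq (SameClass.refl w)
  simpa only [hrep] using hreach w hw'.1 (hrep.symm ▸ hw)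

theorem two_mul_card_reps_le (hT : (T.induce {a | S ⊆ N a}).Preconnected) :
    2 * (reps N S).card ≤ (sepDarts N T S).card + 2 := by
  classical
  rcases (reps N S).eq_empty_or_nonempty with hempty | hne
  · simp [hempty]
  have : Nonempty (reps N S) := hne.coe_sort
  have hconn : (quotGraph N T S).Connected := ⟨quotGraph_preconnected hT⟩
  have hvert := hconn.card_vert_le_card_edgeSet_add_one
  rw [Nat.card_eq_fintype_card, Fintype.card_coe, Nat.card_eq_fintype_card,
    ← SimpleGraph.edgeFinset_card] at hvert
  have hdart := (quotGraph N T S).dart_card_eq_twice_card_edges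
  choose f hf hfst hsnd using fun d : (quotGraph N T S).Dart => d.adj.2
  have hle : Fintype.card (quotGraph N T S).Dart ≤ (sepDarts N T S).card := by
    rw [← Finset.card_univ]
    refine Finset.card_le_card_of_injOn f (fun d _ => hf d) fun d _ e _ hde => ?_
    ext
    · rw [← (mem_reps.1 d.fst.2).repOf_eq (hfst d), hde, (mem_reps.1 e.fst.2).repOf_eq (hfst e)]
    · rw [← (mem_reps.1 d.snd.2).repOf_eq (hsnd d), hde, (mem_reps.1 e.snd.2).repOf_eq (hsnd e)]
  omega

theorem exists_sepDart (hT : (T.induce {a | S ⊆ N a}).Preconnected) (hcard : 2 ≤ (reps N S).card)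
    (hz : z ∈ reps N S) : ∃ d ∈ sepDarts N T S, SameClass N S z d.fst := by
  have : Nontrivial (reps N S) :=
    Fintype.one_lt_card_iff_nontrivial.1 (by rwa [Fintype.card_coe])
  obtain ⟨_, -, d, hd, h, -⟩ := (quotGraph_preconnected hT).exists_adj_of_nontrivial ⟨z, hz⟩
  exact ⟨d, hd, h⟩

theorem exists_embedding_ne {ι κ τ : Type*} [Fintype ι] [Fintype κ] [Fintype τ] (d : ι ↪ τ)
    (h : Fintype.card ι + Fintype.card κ ≤ Fintype.card τ) : ∃ e : κ ↪ τ, ∀ i j, e j ≠ d i := by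
  classical
  obtain ⟨e⟩ : Nonempty (κ ↪ ↥(Set.range d)ᶜ) := Function.Embedding.nonempty_of_card_le <| by
    rw [Fintype.card_compl_set, Set.card_range_of_injective d.injective]
    omega
  exact ⟨e.trans (Function.Embedding.subtype _), fun i j h => (e j).2 ⟨i, h.symm⟩⟩

theorem exists_embedding_sepDarts (hxy : IsCanonical N x y)
    (hT : (T.induce {a | N x ∩ N y ⊆ N a}).Preconnected) :
    ∃ g : {u : α × Bool // IsToken N x y u.1 u.2} ↪ sepDarts N T (N x ∩ N y),
      ∀ u, Allowed N x y u.1.1 u.1.2 (g u).1.fst := by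
  have hcard := card_frees_add_two hxy
  choose d hd hsame using fun z : reps N (N x ∩ N y) =>
    exists_sepDart hT (by omega : 2 ≤ (reps N (N x ∩ N y)).card) z.2
  let bound : reps N (N x ∩ N y) ↪ sepDarts N T (N x ∩ N y) :=
    ⟨fun z => ⟨d z, hd z⟩, fun z w h => Subtype.ext <| by
      have hdz : d z = d w := congrArg Subtype.val h
      rw [← (mem_reps.1 z.2).repOf_eq (hsame z), hdz, (mem_reps.1 w.2).repOf_eq (hsame w)]⟩
  obtain ⟨free, hfree⟩ := exists_embedding_ne (κ := frees N x y) bound (by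
    have := two_mul_card_reps_le hT
    simp only [Fintype.card_coe]
    omega)
  let g (u : {u : α × Bool // IsToken N x y u.1 u.2}) : sepDarts N T (N x ∩ N y) :=
    if h : u.1.2 = true then free ⟨u.1.1, mem_frees.2 (h ▸ u.2)⟩ else
      bound ⟨u.1.1, mem_reps.2 u.2.2.1⟩
  refine ⟨⟨g, ?_⟩, fun u => show Allowed N x y u.1.1 u.1.2 (g u).1.fst from ?_⟩
  · rintro ⟨⟨z, k⟩, hz⟩ ⟨⟨w, l⟩, hw⟩ he
    cases k <;> cases l
    · simpa [g] using he
    · exact absurd he.symm (hfree _ _)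
    · exact absurd he (hfree _ _)
    · simpa [g] using he
  · obtain ⟨⟨z, k⟩, hz⟩ := u
    cases k
    · exact hsame ⟨z, mem_reps.2 hz.2.1⟩
    · have hsep := mem_sepDarts.1 (free ⟨z, mem_frees.2 hz⟩).2
      exact hsep.symm.subset.trans Set.inter_subset_left

theorem exists_embedding_darts (hT : ∀ S, (T.induce {a | S ⊆ N a}).Preconnected) :
    ∃ g : tokens N ↪ T.Dart, ∀ u,
      Allowed N u.1.1 u.1.2.1 u.1.2.2.1 u.1.2.2.2 (g u).fst := by
  choose g hg using fun (x y : α) (h : IsCanonical N x y) => exists_embedding_sepDarts h (hT _)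
  refine ⟨⟨fun u => (g _ _ (mem_tokens.1 u.2).1 ⟨u.1.2.2, mem_tokens.1 u.2⟩).1, ?_⟩,
    fun u => hg _ _ (mem_tokens.1 u.2).1 ⟨u.1.2.2, mem_tokens.1 u.2⟩⟩
  rintro ⟨⟨x, y, z⟩, hu⟩ ⟨⟨x', y', z'⟩, hu'⟩ he
  have hxy := mem_tokens.1 hu |>.1
  have hxy' := mem_tokens.1 hu' |>.1
  have hsep := mem_sepDarts.1 (g x y hxy ⟨z, mem_tokens.1 hu⟩).2
  have hsep' := mem_sepDarts.1 (g x' y' hxy' ⟨z', mem_tokens.1 hu'⟩).2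
  simp only at he
  rw [he] at hsep
  obtain ⟨rfl, rfl⟩ := hxy.ext hxy' (hsep.symm.trans hsep')
  simpa using (g x y hxy).injective (Subtype.ext he)

theorem card_tokens_add_two_le (hT : T.IsTree)
    (hS : ∀ S, (T.induce {a | S ⊆ N a}).Preconnected) :
    (tokens N).card + 2 ≤ 2 * Fintype.card α := by
  classical
  obtain ⟨g, -⟩ := exists_embedding_darts hS
  have hdarts := Fintype.card_le_of_embedding g
  rw [Fintype.card_coe, T.dart_card_eq_twice_card_edges] at hdarts
  have hedges := hT.card_edgeFinset
  omega

variable (N) in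
/-- The map `pos` places every token on a vertex where it is allowed. -/
def IsPlacement (pos : α × α × α × Bool → α) : Prop :=
  ∀ x y z k, IsToken N x y z k → Allowed N x y z k (pos (x, y, z, k))

open Classical in
theorem exists_isPlacement (hT : ∀ S, (T.induce {a | S ⊆ N a}).Preconnected) :
    ∃ pos, IsPlacement N pos ∧ ∀ a, ((tokens N).filter fun u => pos u = a).card ≤ T.degree a := by
  obtain ⟨g, hg⟩ := exists_embedding_darts hT
  let pos : α × α × α × Bool → α := fun u => if h : u ∈ tokens N then (g ⟨u, h⟩).fst else u.1
  have hpos : ∀ u (h : u ∈ tokens N), pos u = (g ⟨u, h⟩).fst := fun u h => dif_pos h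
  refine ⟨pos, fun x y z k h => hpos _ (mem_tokens.2 h) ▸ hg ⟨_, mem_tokens.2 h⟩, fun a => ?_⟩
  rw [← T.dart_fst_fiber_card_eq_degree, ← Finset.card_attach]
  refine Finset.card_le_card_of_injOn (fun u => g ⟨u.1, (Finset.mem_filter.1 u.2).1⟩) ?_ ?_
  · rintro ⟨u, hu⟩ -
    have hmem := Finset.mem_filter.1 hu
    simpa [← hpos u hmem.1] using hmem.2
  · rintro ⟨u, hu⟩ - ⟨v, hv⟩ - h
    simpa using h

end Separators

/-! ### The join graph -/

section JoinGraph

variable {α β : Type*} {N : α → Set β} {S : Set β} {a b : α}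

theorem reachable_induce_of_sameClass {J : SimpleGraph α}
    (hJ : ∀ S', S ⊂ S' → (J.induce {a | S' ⊆ N a}).Preconnected) (ha : S ⊆ N a) (hb : S ⊆ N b)
    (h : SameClass N S a b) : (J.induce {a | S ⊆ N a}).Reachable ⟨a, ha⟩ ⟨b, hb⟩ := by
  obtain ⟨p⟩ := h
  induction p with
  | nil => rfl
  | @cons a b _ h _ ih =>
    have hsub : {c | N a ∩ N b ⊆ N c} ⊆ {c | S ⊆ N c} := fun c hc => h.2.subset.trans hc
    have hab := hJ (N a ∩ N b) h.2 ⟨a, Set.inter_subset_left⟩ ⟨b, Set.inter_subset_right⟩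
    exact (hab.map (SimpleGraph.induceHomOfLE _ hsub).toHom).trans
      (ih (h.2.subset.trans Set.inter_subset_right) hb)

variable [LinearOrder α]

variable (N) (pos : α × α × α × Bool → α)

/-- A free token of the separator of `x` and `y` is placed on the class of `z`. -/
def HasFree (x y z : α) : Prop :=
  ∃ w, IsToken N x y w true ∧ SameClass N (N x ∩ N y) z (pos (x, y, w, true))

variable {N pos} {x y z w : α} {k l : Bool}

theorem IsPlacement.sameClass (hpos : IsPlacement N pos) (hxy : IsCanonical N x y)
    (hz : IsRep N (N x ∩ N y) z) : SameClass N (N x ∩ N y) z (pos (x, y, z, false)) :=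
  hpos x y z false (.of_isRep hxy hz)

theorem IsPlacement.subset (hpos : IsPlacement N pos) (hz : IsToken N x y z true) :
    N x ∩ N y ⊆ N (pos (x, y, z, true)) := hpos x y z true hz

variable (N pos)

open Classical in
/-- The key that orders the classes of the separator of `x` and `y`, those carrying free tokens
first. -/
noncomputable def classKey (x y z : α) : ℕ ×ₗ α := toLex (if HasFree N pos x y z then 0 else 1, z)

variable {N pos}

theorem classKey_injective : Function.Injective (classKey N pos x y) :=
  fun _ _ h => (Prod.mk.inj h).2

theorem HasFree.of_classKey_lt (hw : HasFree N pos x y w)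
    (h : classKey N pos x y z < classKey N pos x y w) : HasFree N pos x y z := by
  by_contra hz
  simp [classKey, Prod.Lex.toLex_lt_toLex, hw, hz] at h

variable [Fintype α]

variable (N pos)

/-- The rank of the class of `z` by `classKey`. -/
noncomputable def classRank (x y z : α) : ℕ :=
  rankIn (reps N (N x ∩ N y)) (classKey N pos x y) z

/-- The key that orders the free tokens of the separator of `x` and `y` by the classes that carry
them. -/
noncomputable def freeKey (x y z : α) : ℕ ×ₗ α :=
  toLex (classRank N pos x y (repOf N (N x ∩ N y) (pos (x, y, z, true))), z)

/-- The rank of the free token of `z` by `freeKey`. -/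
noncomputable def freeRank (x y z : α) : ℕ := rankIn (frees N x y) (freeKey N pos x y) z

/-- The number of the join edge at the token `x, y, z, k`. Among the edges of a separator, edge `1`
joins the bound tokens of the classes of rank `0` and `1`, and edge `i + 2` joins the free token of
rank `i` to the bound token of the class of rank `i + 2`. -/
noncomputable def edgeNo (x y z : α) (k : Bool) : ℕ :=
  if k = true then freeRank N pos x y z + 2 else max 1 (classRank N pos x y z)

/-- The token is the end of its join edge that lies on the class of smaller rank. -/
def IsUpper (x y z : α) (k : Bool) : Prop := k = true ∨ classRank N pos x y z = 0

/-- The graph joining, for every separator, the positions of the two tokens with the same edge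
number. -/
def joinGraph : SimpleGraph α where
  Adj p q := p ≠ q ∧ ∃ x y z k w l, IsToken N x y z k ∧ IsToken N x y w l ∧
    pos (x, y, z, k) = p ∧ pos (x, y, w, l) = q ∧ edgeNo N pos x y z k = edgeNo N pos x y w l ∧
    (IsUpper N pos x y z k ↔ ¬ IsUpper N pos x y w l)
  symm := ⟨by
    rintro p q ⟨hne, x, y, z, k, w, l, h1, h2, h3, h4, h5, h6⟩
    exact ⟨hne.symm, x, y, w, l, z, k, h2, h1, h4, h3, h5.symm, iff_not_comm.1 h6⟩⟩
  loopless := ⟨fun _ h => h.1 rfl⟩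

variable {N pos}

theorem freeKey_injective : Function.Injective (freeKey N pos x y) :=
  fun _ _ h => (Prod.mk.inj h).2

theorem classRank_inj (hz : IsRep N (N x ∩ N y) z) (hw : IsRep N (N x ∩ N y) w)
    (h : classRank N pos x y z = classRank N pos x y w) : z = w :=
  rankIn_injOn classKey_injective.injOn (mem_reps.2 hz) (mem_reps.2 hw) h

theorem freeRank_inj (hz : IsToken N x y z true) (hw : IsToken N x y w true)
    (h : freeRank N pos x y z = freeRank N pos x y w) : z = w :=
  rankIn_injOn freeKey_injective.injOn (mem_frees.2 hz) (mem_frees.2 hw) h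

theorem exists_classRank_eq {i : ℕ} (hi : i < (reps N (N x ∩ N y)).card) :
    ∃ z, IsRep N (N x ∩ N y) z ∧ classRank N pos x y z = i := by
  obtain ⟨z, hz, h⟩ := exists_rankIn_eq classKey_injective.injOn hi
  exact ⟨z, mem_reps.1 hz, h⟩

theorem exists_freeRank_eq {i : ℕ} (hi : i < (frees N x y).card) :
    ∃ z, IsToken N x y z true ∧ freeRank N pos x y z = i := by
  obtain ⟨z, hz, h⟩ := exists_rankIn_eq freeKey_injective.injOn hi
  exact ⟨z, mem_frees.1 hz, h⟩

theorem IsToken.ext (hz : IsToken N x y z k) (hw : IsToken N x y w l)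
    (hno : edgeNo N pos x y z k = edgeNo N pos x y w l)
    (hup : IsUpper N pos x y z k ↔ IsUpper N pos x y w l) : z = w ∧ k = l := by
  cases k <;> cases l <;> simp only [edgeNo, IsUpper, if_true, Bool.false_eq_true, if_false,
    false_or, true_or, true_iff, iff_true] at hno hup
  · exact ⟨classRank_inj hz.2.1 hw.2.1 (pos := pos) (by omega), rfl⟩
  · omega
  · omega
  · exact ⟨freeRank_inj hz hw (pos := pos) (by omega), rfl⟩

open Classical in
theorem degree_joinGraph_le (a : α) :
    (joinGraph N pos).degree a ≤ ((tokens N).filter fun u => pos u = a).card := by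
  have htoken : ∀ q ∈ (joinGraph N pos).neighborFinset a, ∃ x y z k w l, IsToken N x y z k ∧
      IsToken N x y w l ∧ pos (x, y, z, k) = a ∧ pos (x, y, w, l) = q ∧
      edgeNo N pos x y z k = edgeNo N pos x y w l ∧
      (IsUpper N pos x y z k ↔ ¬ IsUpper N pos x y w l) := fun q hq =>
    (((joinGraph N pos).mem_neighborFinset a q).1 hq).2
  choose! x y z k w l hz hw ha hq hno hup using htoken
  rw [← SimpleGraph.card_neighborFinset_eq_degree]
  refine Finset.card_le_card_of_injOn (fun q => (x q, y q, z q, k q))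
    (fun q h => Finset.mem_filter.2 ⟨mem_tokens.2 (hz q h), ha q h⟩) fun q h q' h' he => ?_
  simp only [Prod.mk.injEq] at he
  obtain ⟨hx, hy, hzz, hk⟩ := he
  have hw' := hw q' h'
  have hno' := hno q' h'
  have hup' := hup q' h'
  rw [← hq q h, ← hq q' h']
  rw [← hx, ← hy] at hw' hno' hup' ⊢
  rw [← hzz, ← hk] at hno' hup'
  obtain ⟨h1, h2⟩ := (hw q h).ext hw' ((hno q h).symm.trans hno')
    (not_iff_not.1 ((hup q h).symm.trans hup'))
  rw [h1, h2]

open Classical in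
theorem card_edgeFinset_joinGraph_le :
    2 * (joinGraph N pos).edgeFinset.card ≤ (tokens N).card := by
  rw [← SimpleGraph.sum_degrees_eq_twice_card_edges,
    Finset.card_eq_sum_card_fiberwise (f := pos) (t := Finset.univ) fun _ _ => by simp]
  exact Finset.sum_le_sum fun a _ => degree_joinGraph_le a

/-- The classes before the one that carries the free token of rank `i` all carry an earlier free
token. -/
theorem classRank_le_freeRank (hw : IsToken N x y w true) :
    classRank N pos x y (repOf N (N x ∩ N y) (pos (x, y, w, true))) ≤ freeRank N pos x y w := by
  set S := N x ∩ N y with hS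
  set c := repOf N S (pos (x, y, w, true))
  have hcfree : HasFree N pos x y c := ⟨w, hw, (sameClass_repOf S _).symm⟩
  have htoken : ∀ z ∈ reps N S, classKey N pos x y z < classKey N pos x y c →
      ∃ v, IsToken N x y v true ∧ repOf N S (pos (x, y, v, true)) = z := fun z hz hlt =>
    have ⟨v, hv, hs⟩ := hcfree.of_classKey_lt hlt
    ⟨v, hv, (mem_reps.1 hz).repOf_eq hs⟩
  choose! f hf hfz using htoken
  refine Finset.card_le_card_of_injOn f (fun z hz => ?_) fun z hz z' hz' he => ?_
  · obtain ⟨hzS, hlt⟩ := Finset.mem_filter.1 hz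
    refine Finset.mem_filter.2 ⟨mem_frees.2 (hf z hzS hlt), Prod.Lex.toLex_lt_toLex.2 (.inl ?_)⟩
    have hzc : classRank N pos x y z < classRank N pos x y c := rankIn_lt_rankIn hzS hlt
    simpa only [← hS, hfz z hzS hlt] using hzc
  · obtain ⟨hzS, hlt⟩ := Finset.mem_filter.1 hz
    obtain ⟨hzS', hlt'⟩ := Finset.mem_filter.1 hz'
    rw [← hfz z hzS hlt, ← hfz z' hzS' hlt', he]

theorem exists_adj_classRank_lt (hpos : IsPlacement N pos) (hxy : IsCanonical N x y)
    (hz : IsRep N (N x ∩ N y) z) (h0 : classRank N pos x y z ≠ 0) :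
    ∃ q, N x ∩ N y ⊆ N q ∧ (joinGraph N pos).Adj (pos (x, y, z, false)) q ∧
      classRank N pos x y (repOf N (N x ∩ N y) q) < classRank N pos x y z := by
  have hcard := card_frees_add_two hxy
  have hzrep := hz.repOf_eq (hpos.sameClass hxy hz)
  have hadj : ∀ {w l}, IsToken N x y w l → IsUpper N pos x y w l →
      edgeNo N pos x y w l = classRank N pos x y z →
      classRank N pos x y (repOf N (N x ∩ N y) (pos (x, y, w, l))) < classRank N pos x y z →
      (joinGraph N pos).Adj (pos (x, y, z, false)) (pos (x, y, w, l)) :=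
    fun {w l} hw hup hno hlt => ⟨fun he => by rw [← he, hzrep] at hlt; exact hlt.false,
      x, y, z, false, w, l, .of_isRep hxy hz, hw, rfl, rfl,
      by rw [hno]; simp only [edgeNo, Bool.false_eq_true, if_false]; omega,
      iff_of_false (by simpa [IsUpper] using h0) (not_not.2 hup)⟩
  by_cases h1 : classRank N pos x y z = 1
  · obtain ⟨o, ho, ho0⟩ := exists_classRank_eq (N := N) (pos := pos) (x := x) (y := y) (i := 0)
      (by omega)
    have horep := ho.repOf_eq (hpos.sameClass hxy ho)
    refine ⟨_, (hpos.sameClass hxy ho).subset ho.1, hadj (.of_isRep hxy ho) (.inr ho0) ?_ ?_, ?_⟩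
    · simp [edgeNo, ho0, h1]
    all_goals
      rw [horep]
      omega
  · have hlt : classRank N pos x y z < (reps N (N x ∩ N y)).card := rankIn_lt_card (mem_reps.2 hz)
    obtain ⟨w, hw, hwi⟩ := exists_freeRank_eq (N := N) (pos := pos) (x := x) (y := y)
      (i := classRank N pos x y z - 2) (by omega)
    have hle := classRank_le_freeRank (pos := pos) hw
    refine ⟨_, hpos.subset hw, hadj hw (.inl rfl) ?_ ?_, ?_⟩
    · simp only [edgeNo, if_true]
      omega
    all_goals omega

theorem reachable_induce_joinGraph_repOf (hpos : IsPlacement N pos) (hxy : IsCanonical N x y)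
    {o : α} (ho : IsRep N (N x ∩ N y) o) (ho0 : classRank N pos x y o = 0)
    (hsame : ∀ {a b} (ha : N x ∩ N y ⊆ N a) (hb : N x ∩ N y ⊆ N b), SameClass N (N x ∩ N y) a b →
      ((joinGraph N pos).induce {a | N x ∩ N y ⊆ N a}).Reachable ⟨a, ha⟩ ⟨b, hb⟩)
    {a : α} (ha : N x ∩ N y ⊆ N a) :
    ((joinGraph N pos).induce {a | N x ∩ N y ⊆ N a}).Reachable ⟨a, ha⟩ ⟨o, ho.1⟩ := by
  induction hi : classRank N pos x y (repOf N (N x ∩ N y) a) using Nat.strong_induction_on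
    generalizing a with
  | _ i ih =>
    have hz := isRep_repOf ha
    rcases eq_or_ne i 0 with rfl | h0
    · have hao := classRank_inj hz ho (hi.trans ho0.symm)
      exact hsame ha ho.1 (hao ▸ sameClass_repOf _ a)
    · have hza := (sameClass_repOf (N x ∩ N y) a).trans (hpos.sameClass hxy hz)
      obtain ⟨q, hq, hadj, hlt⟩ := exists_adj_classRank_lt hpos hxy hz (hi ▸ h0)
      have hstep : ((joinGraph N pos).induce {a | N x ∩ N y ⊆ N a}).Adj
        ⟨_, hza.subset ha⟩ ⟨q, hq⟩ := hadj
      exact (hsame ha _ hza).trans (hstep.reachable.trans (ih _ (hi ▸ hlt) hq rfl))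

theorem joinGraph_preconnected [Finite β] (hpos : IsPlacement N pos) (S : Set β) :
    ((joinGraph N pos).induce {a | S ⊆ N a}).Preconnected := by
  induction S using WellFoundedGT.induction with
  | ind S ih =>
    rintro ⟨a, ha⟩ ⟨b, hb⟩
    by_cases hab : SameClass N S a b
    · exact reachable_induce_of_sameClass ih ha hb hab
    have hS := inter_eq_of_not_sameClass hab ha hb
    obtain ⟨x, y, hxy, rfl⟩ : ∃ x y, IsCanonical N x y ∧ N x ∩ N y = S :=
      hS ▸ exists_isCanonical (by rwa [hS])
    have hcard := card_frees_add_two hxy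
    obtain ⟨o, ho, ho0⟩ := exists_classRank_eq (N := N) (pos := pos) (x := x) (y := y) (i := 0)
      (by omega)
    have hreach {c : α} (hc : N x ∩ N y ⊆ N c) := reachable_induce_joinGraph_repOf hpos hxy ho ho0
      (fun ha hb => reachable_induce_of_sameClass ih ha hb) hc
    exact (hreach ha).trans (hreach hb).symm

theorem joinGraph_isTree [Finite β] [Nonempty α] (hpos : IsPlacement N pos)
    (hcard : (tokens N).card + 2 ≤ 2 * Fintype.card α) : (joinGraph N pos).IsTree := by
  classical
  have hconn : (joinGraph N pos).Connected := ⟨fun a b =>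
    (joinGraph_preconnected hpos ∅ ⟨a, Set.empty_subset _⟩ ⟨b, Set.empty_subset _⟩).map
      (SimpleGraph.Embedding.induce _).toHom⟩
  refine SimpleGraph.isTree_iff_connected_and_card.2 ⟨hconn, ?_⟩
  have hedges := card_edgeFinset_joinGraph_le (N := N) (pos := pos)
  have hvert := hconn.card_vert_le_card_edgeSet_add_one
  rw [Nat.card_eq_fintype_card, Nat.card_eq_fintype_card, ← SimpleGraph.edgeFinset_card] at hvert ⊢
  omega

end JoinGraph

/-! ### The auction -/

section Auction

variable {ι U α : Type*} (m : ℕ) (tk : Finset U) (ok : U → ι → Prop)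

/-- The state of an auction in which the bidders `u ∈ tk` compete for the slots `s` with `ok u s`.
The slot `s` has the owner `o s`, if any, and the price `d s`. Every owner has a slot whose price
exceeds the least price of a slot it may bid for by at most one, and prices are at most `m + 1`. -/
structure Auction (o : ι → Option U) (d : ι → ℕ) : Prop where
  mem : ∀ s u, o s = some u → u ∈ tk ∧ ok u s
  inj : ∀ s s' u, o s = some u → o s' = some u → s = s'
  price : ∀ s, d s ≠ 0 → o s ≠ none
  content : ∀ s u, o s = some u → ∀ s', ok u s' → d s ≤ d s' + 1
  le : ∀ s, d s ≤ m + 1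

/-- The bidder `u` owns no slot, and `s` is a cheapest slot for it, of price at most `m`. -/
def Bid (o : ι → Option U) (d : ι → ℕ) (u : U) (s : ι) : Prop :=
  u ∈ tk ∧ (∀ s', o s' ≠ some u) ∧ ok u s ∧ d s ≤ m ∧ ∀ s', ok u s' → d s ≤ d s'

variable {m : ℕ} {tk : Finset U} {ok : U → ι → Prop} {o : ι → Option U} {d : ι → ℕ}

theorem update_eq_some_iff [DecidableEq ι] {u v : U} {s s' : ι} :
    Function.update o s (some u) s' = some v ↔ s' = s ∧ v = u ∨ s' ≠ s ∧ o s' = some v := by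
  by_cases h : s' = s <;> simp [h, eq_comm]

theorem Auction.update [DecidableEq ι] (h : Auction m tk ok o d) {u : U} {s : ι}
    (hb : Bid m tk ok o d u s) :
    Auction m tk ok (Function.update o s (some u)) (Function.update d s (d s + 1)) := by
  obtain ⟨hu, hun, hok, hle, hmin⟩ := hb
  have hmono : d ≤ Function.update d s (d s + 1) :=
    le_update_iff.2 ⟨Nat.le_succ _, fun _ _ => le_rfl⟩
  refine ⟨fun s' v hv => ?_, fun s' s'' v hv hv' => ?_, fun s' hs' => ?_,
    fun s' v hv s'' hs'' => ?_, fun s' => ?_⟩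
  · rcases update_eq_some_iff.1 hv with ⟨rfl, rfl⟩ | ⟨-, hv⟩
    · exact ⟨hu, hok⟩
    · exact h.mem s' v hv
  · rcases update_eq_some_iff.1 hv with ⟨rfl, rfl⟩ | ⟨-, hv⟩ <;>
      rcases update_eq_some_iff.1 hv' with ⟨hs, hvu⟩ | ⟨-, hv'⟩
    · exact hs.symm
    · exact absurd hv' (hun _)
    · exact absurd (hvu ▸ hv) (hun _)
    · exact h.inj s' s'' v hv hv'
  · by_cases hs : s' = s
    · simp [hs]
    · rw [Function.update_of_ne hs] at hs' ⊢
      exact h.price s' hs'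
  · refine le_trans ?_ (Nat.add_le_add_right (hmono s'') 1)
    rcases update_eq_some_iff.1 hv with ⟨rfl, rfl⟩ | ⟨hs, hv⟩
    · rw [Function.update_self]
      exact Nat.add_le_add_right (hmin s'' hs'') 1
    · rw [Function.update_of_ne hs]
      exact h.content s' v hv s'' hs''
  · by_cases hs : s' = s
    · simpa [hs] using hle
    · rw [Function.update_of_ne hs]
      exact h.le s'

theorem Auction.lt_of_not_exists [Finite ι] (hend : ∀ u s, ¬ Bid m tk ok o d u s) {u : U}
    (hu : u ∈ tk) (hun : ∀ s, o s ≠ some u) {s : ι} (hs : ok u s) : m < d s := by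
  by_contra! hle
  obtain ⟨s', hs', hmin⟩ := Set.exists_min_image {s | ok u s} d (Set.toFinite _) ⟨s, hs⟩
  exact hend u s' ⟨hu, hun, hs', (hmin s hs).trans hle, hmin⟩

variable [Fintype ι]

theorem Auction.sum_le (h : Auction m tk ok o d) : ∑ s, d s ≤ Fintype.card ι * (m + 1) :=
  (Finset.sum_le_card_nsmul Finset.univ d _ fun s _ => h.le s).trans (by simp)

theorem exists_forall_ne_of_card_le (hm : Fintype.card ι ≤ m) (d : ι → ℕ) :
    ∃ k, 1 ≤ k ∧ k ≤ m + 1 ∧ ∀ s, d s ≠ k := by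
  by_contra! hc
  have hsub : Finset.Icc 1 (m + 1) ⊆ Finset.univ.image d := fun k hk => by
    obtain ⟨h1, h2⟩ := Finset.mem_Icc.1 hk
    simpa using hc k h1 h2
  have hcard := (Finset.card_le_card hsub).trans Finset.card_image_le
  rw [Nat.card_Icc, Finset.card_univ] at hcard
  omega

open Classical in
/-- Since some price `k` is missing, the slots of price above `k` are all taken, and the unplaced
bidders together with the owners of these slots can bid for these slots only. -/
theorem Auction.exists_card_unplaced_add_le [DecidableEq U] (hm : Fintype.card ι ≤ m)
    (h : Auction m tk ok o d) (hend : ∀ u s, ¬ Bid m tk ok o d u s) :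
    ∃ W ⊆ tk, (tk.filter fun u => ∀ s, o s ≠ some u).card +
      (Finset.univ.filter fun s => ∃ u ∈ W, ok u s).card ≤ W.card := by
  obtain ⟨k, hk, hkm, hkd⟩ := exists_forall_ne_of_card_le hm d
  set X := Finset.univ.filter fun s => k ≤ d s
  set un := tk.filter fun u => ∀ s, o s ≠ some u
  set P := tk.filter fun u => ∃ s ∈ X, o s = some u
  have hdisj : Disjoint un P := Finset.disjoint_left.2 fun u hu hu' => by
    obtain ⟨s, -, hs⟩ := (Finset.mem_filter.1 hu').2
    exact (Finset.mem_filter.1 hu).2 s hs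
  have hslots : (Finset.univ.filter fun s => ∃ u ∈ un ∪ P, ok u s) ⊆ X := fun s hs => by
    obtain ⟨u, hu, hs⟩ := (Finset.mem_filter.1 hs).2
    refine Finset.mem_filter.2 ⟨Finset.mem_univ _, ?_⟩
    rcases Finset.mem_union.1 hu with hu | hu
    · obtain ⟨hutk, hun⟩ := Finset.mem_filter.1 hu
      exact hkm.trans (Auction.lt_of_not_exists hend hutk hun hs)
    · obtain ⟨-, s', hs', ho⟩ := Finset.mem_filter.1 hu
      have hcontent := h.content s' u ho s hs
      have hks' := (Finset.mem_filter.1 hs').2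
      have hne := hkd s'
      omega
  have hX : X.card ≤ P.card := by
    have howner : ∀ s : X, ∃ u, o s = some u := fun s =>
      Option.ne_none_iff_exists'.1 (h.price s (by have := (Finset.mem_filter.1 s.2).2; omega))
    choose f hf using howner
    have hmem : ∀ s, f s ∈ P := fun s =>
      Finset.mem_filter.2 ⟨(h.mem s _ (hf s)).1, s, s.2, hf s⟩
    have hinj : Function.Injective f := fun s s' he =>
      Subtype.ext (h.inj s s' _ (hf s) (he ▸ hf s'))
    simpa using Finset.card_le_card_of_injOn (s := X.attach) f (fun s _ => hmem s) hinj.injOn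
  refine ⟨un ∪ P, Finset.union_subset (Finset.filter_subset _ _) (Finset.filter_subset _ _), ?_⟩
  rw [Finset.card_union_of_disjoint hdisj]
  exact Nat.add_le_add_left ((Finset.card_le_card hslots).trans hX) _

open Classical in
theorem card_le_card_slots_add_sum_sub [Fintype α] [DecidableEq α] {vert : ι → α} {c : ℕ}
    (hvert : ∀ a, c ≤ (Finset.univ.filter fun s => vert s = a).card) (W : Finset U) (g : U → α) :
    W.card ≤ (Finset.univ.filter fun s => ∃ u ∈ W, vert s = g u).card +
      ∑ a, ((W.filter fun u => g u = a).card - c) := by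
  have hslots : c * (W.image g).card ≤
      (Finset.univ.filter fun s => ∃ u ∈ W, vert s = g u).card := by
    rw [mul_comm, Finset.card_eq_sum_card_fiberwise (t := W.image g) (f := vert) (by
      intro s hs
      obtain ⟨u, hu, he⟩ := (Finset.mem_filter.1 hs).2
      exact Finset.mem_image.2 ⟨u, hu, he.symm⟩), ← smul_eq_mul]
    refine Finset.card_nsmul_le_sum _ _ _ fun a ha => (hvert a).trans (Finset.card_le_card ?_)
    obtain ⟨u, hu, rfl⟩ := Finset.mem_image.1 ha
    intro s hs
    have hsu := (Finset.mem_filter.1 hs).2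
    simpa using ⟨⟨u, hu, hsu⟩, hsu⟩
  calc W.card = ∑ a ∈ W.image g, (W.filter fun u => g u = a).card :=
        Finset.card_eq_sum_card_fiberwise fun u hu => Finset.mem_image_of_mem g hu
    _ ≤ ∑ a ∈ W.image g, (c + ((W.filter fun u => g u = a).card - c)) :=
        Finset.sum_le_sum fun a _ => le_add_tsub
    _ = c * (W.image g).card + ∑ a ∈ W.image g, ((W.filter fun u => g u = a).card - c) := by
        rw [Finset.sum_add_distrib, Finset.sum_const, smul_eq_mul, mul_comm]
    _ ≤ _ := Nat.add_le_add hslots (Finset.sum_le_sum_of_subset (Finset.subset_univ _))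

open Classical in
theorem Auction.card_unplaced_le [DecidableEq U] [Fintype α] [DecidableEq α] {vert : ι → α}
    {c : ℕ} (hm : Fintype.card ι ≤ m) (h : Auction m tk ok o d)
    (hend : ∀ u s, ¬ Bid m tk ok o d u s)
    (hvert : ∀ a, c ≤ (Finset.univ.filter fun s => vert s = a).card) {g : U → α}
    (hg : ∀ u ∈ tk, ∀ s, vert s = g u → ok u s) :
    (tk.filter fun u => ∀ s, o s ≠ some u).card ≤
      ∑ a, ((tk.filter fun u => g u = a).card - c) := by
  obtain ⟨W, hW, hcard⟩ := h.exists_card_unplaced_add_le hm hend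
  have hslots : (Finset.univ.filter fun s => ∃ u ∈ W, vert s = g u).card ≤
      (Finset.univ.filter fun s => ∃ u ∈ W, ok u s).card :=
    Finset.card_le_card <| Finset.monotone_filter_right _ fun s _ ⟨u, hu, he⟩ =>
      ⟨u, hu, hg u (hW hu) s he⟩
  have hsum : ∑ a, ((W.filter fun u => g u = a).card - c) ≤
      ∑ a, ((tk.filter fun u => g u = a).card - c) := Finset.sum_le_sum fun a _ =>
    Nat.sub_le_sub_right (Finset.card_le_card (Finset.filter_subset_filter _ hW)) c
  have hcount := card_le_card_slots_add_sum_sub hvert W g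
  omega

end Auction

section OptimalPlacement

variable {α β : Type*} {N : α → Set β} {o : α × Bool → Option (α × α × α × Bool)}

/-- The slot `s` is on a vertex on which the token `u` can be placed. There are two slots on every
vertex. -/
def Fits (N : α → Set β) (u : α × α × α × Bool) (s : α × Bool) : Prop :=
  Allowed N u.1 u.2.1 u.2.2.1 u.2.2.2 s.1

open Classical in
/-- The vertex of the slot of a token, and some other vertex, for definiteness the third
component, if it has none. -/
noncomputable def posOf (o : α × Bool → Option (α × α × α × Bool))
    (u : α × α × α × Bool) : α :=
  if h : ∃ s, o s = some u then h.choose.1 else u.2.2.1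

theorem card_filter_posOf_le [Fintype α] [DecidableEq α] (tk : Finset (α × α × α × Bool)) (a : α) :
    (tk.filter fun u => posOf o u = a).card ≤
      ((tk.filter fun u => ∀ s, o s ≠ some u).filter fun u => posOf o u = a).card + 2 := by
  have hsub : (tk.filter fun u => posOf o u = a) ⊆
      ((tk.filter fun u => ∀ s, o s ≠ some u).filter fun u => posOf o u = a) ∪
        Finset.univ.biUnion fun j : Bool => (o (a, j)).toFinset := by
    intro u hu
    simp only [Finset.mem_filter, Finset.mem_union, Finset.mem_biUnion, Finset.mem_univ,
      true_and, Option.mem_toFinset, Option.mem_def] at hu ⊢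
    by_cases hs : ∃ s, o s = some u
    · have ha : hs.choose.1 = a := by rw [← hu.2, posOf, dif_pos hs]
      exact .inr ⟨hs.choose.2, ha ▸ hs.choose_spec⟩
    · exact .inl ⟨⟨hu.1, not_exists.1 hs⟩, hu.2⟩
  have hslots : (Finset.univ.biUnion fun j : Bool => (o (a, j)).toFinset).card ≤ 2 :=
    Finset.card_biUnion_le.trans <| (Finset.sum_le_card_nsmul _ _ 1 fun j _ => by
      cases o (a, j) <;> simp).trans (by simp)
  exact (Finset.card_le_card hsub).trans <| (Finset.card_union_le _ _).trans <|
    Nat.add_le_add_left hslots _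

variable [LinearOrder α] [Fintype α] {d : α × Bool → ℕ} {m : ℕ}

theorem isPlacement_posOf (h : Auction m (tokens N) (Fits N) o d) :
    IsPlacement N (posOf o) := by
  intro x y z k hz
  rw [posOf]
  split_ifs with hs
  · exact (h.mem _ _ hs.choose_spec).2
  · rw [Allowed]
    split_ifs
    · exact hz.2.1.1
    · exact .refl z

open Classical in
theorem sum_degree_joinGraph_le :
    ∑ a, ((joinGraph N (posOf o)).degree a - 2) ≤
      ((tokens N).filter fun u => ∀ s, o s ≠ some u).card := by
  rw [Finset.card_eq_sum_card_fiberwise (t := Finset.univ) (f := posOf o) (by simp)]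
  exact Finset.sum_le_sum fun a _ =>
    Nat.sub_le_of_le_add ((degree_joinGraph_le a).trans (card_filter_posOf_le _ a))

open Classical in
theorem sum_degree_joinGraph_le_sum_degree {T : SimpleGraph α}
    (hT : ∀ S, (T.induce {a | S ⊆ N a}).Preconnected) (hm : 2 * Fintype.card α ≤ m)
    (h : Auction m (tokens N) (Fits N) o d)
    (hend : ∀ u s, ¬ Bid m (tokens N) (Fits N) o d u s) :
    ∑ a, ((joinGraph N (posOf o)).degree a - 2) ≤ ∑ a, (T.degree a - 2) := by
  obtain ⟨g, hg, hgT⟩ := exists_isPlacement hT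
  have hcard : Fintype.card (α × Bool) ≤ m := by simpa [mul_comm] using hm
  have hslots : ∀ a, 2 ≤ (Finset.univ.filter fun s : α × Bool => s.1 = a).card := fun a => by
    have : (Finset.univ.filter fun s : α × Bool => s.1 = a) = {a} ×ˢ Finset.univ := by
      ext s
      simp only [Finset.mem_filter_univ, Finset.mem_product, Finset.mem_singleton,
        Finset.mem_univ, and_true]
    simp [this]
  calc ∑ a, ((joinGraph N (posOf o)).degree a - 2)
      ≤ ((tokens N).filter fun u => ∀ s, o s ≠ some u).card := sum_degree_joinGraph_le
    _ ≤ ∑ a, (((tokens N).filter fun u => g u = a).card - 2) :=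
        h.card_unplaced_le hcard hend hslots fun ⟨x, y, z, k⟩ hu s hs => by
          rw [Fits, hs]
          exact hg x y z k (mem_tokens.1 hu)
    _ ≤ ∑ a, (T.degree a - 2) := Finset.sum_le_sum fun a _ => Nat.sub_le_sub_right (hgT a) 2

end OptimalPlacement

namespace RAM

/-- Call `f` with the given arguments. -/
def Exp.app (f : Exp) (l : List Exp) : Exp := .call l.length l.get f

/-- `e` does not hold; any value but `0` counts as true. -/
def Exp.not (e : Exp) : Exp := .ite e (.const 0) (.const 1)

/-- `e ∧ f`. -/
def Exp.and (e f : Exp) : Exp := .ite e f (.const 0)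

/-- `e ∨ f`. -/
def Exp.or (e f : Exp) : Exp := .ite e (.const 1) f

/-- `e < f`. -/
def Exp.lt (e f : Exp) : Exp := .sub f e

/-- `e = f`. -/
def Exp.eq (e f : Exp) : Exp := .not (.add (.sub e f) (.sub f e))

/-- `(e, f) < (e', f')` in the lexicographic order. -/
def Exp.lexLt (e f e' f' : Exp) : Exp := .or (.lt e e') (.and (.eq e e') (.lt f f'))

/-- `e * n + f`. -/
def Exp.pair (e f : Exp) : Exp := .add (.app (.sum 1 0 (.var 0)) [e]) f

/-- The number `quad n p q s t` for the values `p`, `q`, `s`, `t` of the expressions. -/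
def Exp.idx4 (e f g h : Exp) : Exp := .pair (.pair (.pair e f) g) h

/-- The number of `i < n` with the property `e`. -/
def Exp.count (e : Exp) : Exp := .sum 1 0 (.ite e (.const 1) (.const 0))

/-- `e` holds. -/
def Tr (n : ℕ) (M : Mem) (e : Exp) (env : List ℕ) : Prop := e.eval n M env ≠ 0

section

variable {n : ℕ} {M : Mem} {env : List ℕ} {e f g : Exp}

@[simp] theorem eval_const (c : ℕ) : (Exp.const c).eval n M env = c := rfl
@[simp] theorem eval_var (i : ℕ) : (Exp.var i).eval n M env = env.getD i 0 := rfl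
@[simp] theorem eval_size : Exp.size.eval n M env = n := rfl
@[simp] theorem eval_add : (Exp.add e f).eval n M env = e.eval n M env + f.eval n M env := rfl
@[simp] theorem eval_sub : (Exp.sub e f).eval n M env = e.eval n M env - f.eval n M env := rfl
@[simp] theorem eval_read (a : ℕ) : (Exp.read a e).eval n M env = M a (e.eval n M env) := rfl

open Classical in
@[simp] theorem eval_ite :
    (Exp.ite e f g).eval n M env = if Tr n M e env then f.eval n M env else g.eval n M env := by
  simp only [Exp.eval, Tr]
  congr

@[simp] theorem eval_app (l : List Exp) :
    (Exp.app f l).eval n M env = f.eval n M (l.map fun e => e.eval n M env) := by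
  rw [Exp.app, Exp.eval]
  congr 1
  rw [← List.ofFn_get (l := l), List.map_ofFn]
  simp [Function.comp_def]

@[simp] theorem eval_pair : (Exp.pair e f).eval n M env = e.eval n M env * n + f.eval n M env := by
  simp [Exp.pair, Exp.eval, mul_comm]

theorem eval_sum (k c : ℕ) : (Exp.sum k c e).eval n M env =
    ∑ i ∈ Finset.range (k * n + c), e.eval n M (env ++ [i]) := rfl

@[simp] theorem tr_var (i : ℕ) : Tr n M (.var i) env ↔ env.getD i 0 ≠ 0 := Iff.rfl
@[simp] theorem tr_read (a : ℕ) : Tr n M (.read a e) env ↔ M a (e.eval n M env) ≠ 0 := Iff.rfl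
@[simp] theorem tr_app (l : List Exp) :
    Tr n M (.app f l) env ↔ Tr n M f (l.map fun e => e.eval n M env) := by simp [Tr]
@[simp] theorem tr_not : Tr n M (.not e) env ↔ ¬ Tr n M e env := by
  by_cases h : e.eval n M env = 0 <;> simp [Tr, Exp.not, Exp.eval, h]
@[simp] theorem tr_and : Tr n M (.and e f) env ↔ Tr n M e env ∧ Tr n M f env := by
  by_cases h : e.eval n M env = 0 <;> simp [Tr, Exp.and, Exp.eval, h]
@[simp] theorem tr_or : Tr n M (.or e f) env ↔ Tr n M e env ∨ Tr n M f env := by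
  by_cases h : e.eval n M env = 0 <;> simp [Tr, Exp.or, Exp.eval, h]
@[simp] theorem tr_lt : Tr n M (.lt e f) env ↔ e.eval n M env < f.eval n M env := by
  simp [Tr, Exp.lt, Nat.sub_eq_zero_iff_le]
@[simp] theorem tr_eq : Tr n M (.eq e f) env ↔ e.eval n M env = f.eval n M env := by
  rw [Exp.eq, tr_not, Tr, eval_add, eval_sub, eval_sub]
  omega
@[simp] theorem tr_lexLt {e' f' : Exp} : Tr n M (.lexLt e f e' f') env ↔
    e.eval n M env < e'.eval n M env ∨
      e.eval n M env = e'.eval n M env ∧ f.eval n M env < f'.eval n M env := by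
  simp [Exp.lexLt]

theorem tr_sum (k c : ℕ) : Tr n M (.sum k c e) env ↔
    ∃ i < k * n + c, Tr n M e (env ++ [i]) := by
  simp [Tr, eval_sum]

@[simp] theorem tr_ex : Tr n M (.sum 1 0 e) env ↔ ∃ i : Fin n, Tr n M e (env ++ [(i : ℕ)]) := by
  rw [tr_sum]
  constructor
  · rintro ⟨i, hi, h⟩
    exact ⟨⟨i, by omega⟩, h⟩
  · rintro ⟨i, h⟩
    exact ⟨i, by omega, h⟩

@[simp] theorem tr_exBool : Tr n M (.sum 0 2 e) env ↔ ∃ b : Bool, Tr n M e (env ++ [b.toNat]) := by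
  rw [tr_sum]
  constructor
  · rintro ⟨i, hi, h⟩
    obtain rfl | rfl : i = 0 ∨ i = 1 := by omega
    · exact ⟨false, h⟩
    · exact ⟨true, h⟩
  · rintro ⟨b, h⟩
    exact ⟨b.toNat, by have := b.toNat_lt; omega, h⟩

open Classical in
@[simp] theorem eval_count : (Exp.count e).eval n M env =
    (Finset.univ.filter fun i : Fin n => Tr n M e (env ++ [(i : ℕ)])).card := by
  rw [Exp.count, eval_sum, Finset.card_filter]
  simp only [one_mul, add_zero, eval_ite, eval_const]
  rw [← Fin.sum_univ_eq_sum_range (fun i => if Tr n M e (env ++ [i]) then 1 else 0)]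

end

theorem pair_inj {n p q p' q' : ℕ} (hq : q < n) (hq' : q' < n) (h : p * n + q = p' * n + q') :
    p = p' ∧ q = q' := by
  have hn : 0 < n := by omega
  have h1 := congrArg (· / n) h
  have h2 := congrArg (· % n) h
  simp only [mul_comm _ n, Nat.mul_add_div hn, Nat.mul_add_mod, Nat.div_eq_of_lt hq,
    Nat.div_eq_of_lt hq', Nat.mod_eq_of_lt hq, Nat.mod_eq_of_lt hq'] at h1 h2
  exact ⟨by simpa using h1, h2⟩

/-- The index of the quadruple of `p`, `q`, `s`, `t` in a table with `n ^ 4` entries. -/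
def quad (n p q s t : ℕ) : ℕ := ((p * n + q) * n + s) * n + t

theorem quad_inj {n p q s t p' q' s' t' : ℕ} (hq : q < n) (hs : s < n) (ht : t < n)
    (hq' : q' < n) (hs' : s' < n) (ht' : t' < n) (h : quad n p q s t = quad n p' q' s' t') :
    p = p' ∧ q = q' ∧ s = s' ∧ t = t' := by
  obtain ⟨hpqs, rfl⟩ := pair_inj ht ht' h
  obtain ⟨hpq, rfl⟩ := pair_inj hs hs' hpqs
  obtain ⟨rfl, rfl⟩ := pair_inj hq hq' hpq
  exact ⟨rfl, rfl, rfl, rfl⟩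

@[simp] theorem eval_idx4 {n : ℕ} {M : Mem} {env : List ℕ} {e f g h : Exp} :
    (Exp.idx4 e f g h).eval n M env =
      quad n (e.eval n M env) (f.eval n M env) (g.eval n M env) (h.eval n M env) := by
  simp [Exp.idx4, quad]

/-- The array `a` occurs in the expression. -/
def Exp.Reads (a : ℕ) : Exp → Prop
  | .const _ | .var _ | .size => False
  | .add e f | .sub e f => e.Reads a ∨ f.Reads a
  | .read b e => b = a ∨ e.Reads a
  | .ite c e f => c.Reads a ∨ e.Reads a ∨ f.Reads a
  | .sum _ _ e => e.Reads a
  | .call _ args f => (∃ i, (args i).Reads a) ∨ f.Reads a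

instance Exp.decidableReads (a : ℕ) : DecidablePred (Exp.Reads a)
  | .const _ | .var _ | .size => .isFalse id
  | .add e f | .sub e f => have := decidableReads a e; have := decidableReads a f; instDecidableOr
  | .read b e => have := decidableReads a e; instDecidableOr (p := b = a)
  | .ite c e f =>
    have := decidableReads a c; have := decidableReads a e; have := decidableReads a f
    instDecidableOr
  | .sum _ _ e => decidableReads a e
  | .call _ args f =>
    have := fun i => decidableReads a (args i); have := decidableReads a f; instDecidableOr

theorem Exp.eval_congr {n : ℕ} {M M' : Mem} : ∀ {e : Exp} {env : List ℕ},
    (∀ a, e.Reads a → M a = M' a) → e.eval n M env = e.eval n M' env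
  | .const _, _, _ | .var _, _, _ | .size, _, _ => rfl
  | .add e f, _, h | .sub e f, _, h => by
    rw [Exp.eval, Exp.eval, eval_congr (e := e) fun a ha => h a (.inl ha),
      eval_congr (e := f) fun a ha => h a (.inr ha)]
  | .read b e, _, h => by
    rw [Exp.eval, Exp.eval, eval_congr (e := e) fun a ha => h a (.inr ha), h b (.inl rfl)]
  | .ite c e f, _, h => by
    rw [Exp.eval, Exp.eval, eval_congr (e := c) fun a ha => h a (.inl ha),
      eval_congr (e := e) fun a ha => h a (.inr (.inl ha)),
      eval_congr (e := f) fun a ha => h a (.inr (.inr ha))]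
  | .sum _ _ e, _, h => Finset.sum_congr rfl fun _ _ => eval_congr (e := e) h
  | .call _ args f, env, h => by
    have hargs : ∀ i, (args i).eval n M env = (args i).eval n M' env := fun i =>
      eval_congr (e := args i) fun a ha => h a (.inl ⟨i, ha⟩)
    simp only [Exp.eval, hargs]
    exact eval_congr (e := f) fun a ha => h a (.inr ha)

/-- The command stores into the array `a`. -/
def Cmd.Writes (a : ℕ) : Cmd → Prop
  | .skip => False
  | .store b _ _ => b = a
  | .seq C D | .ite _ C D => C.Writes a ∨ D.Writes a
  | .loop _ _ C => C.Writes a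

open Classical in
theorem exec_ite {n : ℕ} {e : Exp} {C D : Cmd} {M : Mem} {env : List ℕ} :
    (Cmd.ite e C D).exec n M env = if Tr n M e env then C.exec n M env else D.exec n M env := by
  simp only [Cmd.exec, Tr]
  congr

theorem exec_loop_induction {n k c : ℕ} {C : Cmd} {M : Mem} {env : List ℕ} (Inv : ℕ → Mem → Prop)
    (h0 : Inv 0 M) (step : ∀ i < k * n + c, ∀ M, Inv i M → Inv (i + 1) (C.exec n M (env ++ [i]))) :
    Inv (k * n + c) ((Cmd.loop k c C).exec n M env) := by
  rw [Cmd.exec]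
  suffices ∀ j ≤ k * n + c,
      Inv j ((List.range j).foldl (fun M i => C.exec n M (env ++ [i])) M) from this _ le_rfl
  intro j
  induction j with
  | zero => exact fun _ => h0
  | succ j ih =>
    intro hj
    rw [List.range_succ, List.foldl_append]
    exact step j (by omega) _ (ih (by omega))

theorem Cmd.exec_apply_of_not_writes {n a : ℕ} : ∀ {C : Cmd} {M : Mem} {env : List ℕ},
    ¬ C.Writes a → C.exec n M env a = M a
  | .skip, _, _, _ => rfl
  | .store _ _ _, _, _, h => Function.update_of_ne (Ne.symm h) _ _
  | .seq C D, _, _, h => by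
    rw [Cmd.exec, exec_apply_of_not_writes (C := D) fun hD => h (.inr hD),
      exec_apply_of_not_writes (C := C) fun hC => h (.inl hC)]
  | .ite _ C D, _, _, h => by
    rw [Cmd.exec]
    split_ifs
    · exact exec_apply_of_not_writes (C := C) fun hC => h (.inl hC)
    · exact exec_apply_of_not_writes (C := D) fun hD => h (.inr hD)
  | .loop _ _ C, M, _, h => exec_loop_induction (fun _ M' => M' a = M a) rfl fun _ _ _ hM =>
    (exec_apply_of_not_writes (C := C) h).trans hM

/-- Nested loops with the given bounds. -/
def Cmd.nest (bs : List (ℕ × ℕ)) (C : Cmd) : Cmd := bs.foldr (fun b D => .loop b.1 b.2 D) C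

/-- The values the variables of nested loops with the bounds `bs` take. -/
abbrev InBounds (n : ℕ) : List ℕ → List (ℕ × ℕ) → Prop :=
  List.Forall₂ fun i b => i < b.1 * n + b.2

theorem inBounds_vertex_cons {n : ℕ} {l : List ℕ} {bs : List (ℕ × ℕ)} :
    InBounds n l ((1, 0) :: bs) ↔
      ∃ (i : Fin n) (l' : List ℕ), InBounds n l' bs ∧ l = (i : ℕ) :: l' := by
  simp [List.forall₂_cons_right_iff, Fin.exists_iff]

theorem inBounds_bool_cons {n : ℕ} {l : List ℕ} {bs : List (ℕ × ℕ)} :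
    InBounds n l ((0, 2) :: bs) ↔
      ∃ (b : Bool) (l' : List ℕ), InBounds n l' bs ∧ l = b.toNat :: l' := by
  simp [List.forall₂_cons_right_iff, Nat.le_one_iff_eq_zero_or_eq_one, or_and_right,
    exists_or]

theorem inBounds_nil {n : ℕ} {l : List ℕ} : InBounds n l [] ↔ l = [] := List.forall₂_nil_right_iff

theorem exec_loop_mono {n k c : ℕ} {C : Cmd} {M : Mem} {env : List ℕ} {Le : Mem → Mem → Prop}
    (hrefl : ∀ M, Le M M) (htrans : ∀ M M' M'', Le M M' → Le M' M'' → Le M M'')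
    {Q : ℕ → Mem → Prop} (hQ : ∀ i M M', Le M M' → Q i M → Q i M')
    (step : ∀ i < k * n + c, ∀ M', Le M M' →
      Le M' (C.exec n M' (env ++ [i])) ∧ Q i (C.exec n M' (env ++ [i]))) :
    Le M ((Cmd.loop k c C).exec n M env) ∧
      ∀ i < k * n + c, Q i ((Cmd.loop k c C).exec n M env) := by
  refine exec_loop_induction (fun j M' => Le M M' ∧ ∀ i < j, Q i M') ⟨hrefl M, by simp⟩ ?_
  rintro j hj M' ⟨hle, hq⟩
  obtain ⟨hle', hq'⟩ := step j hj M' hle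
  refine ⟨htrans _ _ _ hle hle', fun i hi => ?_⟩
  rcases Nat.lt_succ_iff_lt_or_eq.1 hi with hi | rfl
  · exact hQ i _ _ hle' (hq i hi)
  · exact hq'

theorem exec_nest_mono {n : ℕ} {C : Cmd} {Le : Mem → Mem → Prop} (hrefl : ∀ M, Le M M)
    (htrans : ∀ M M' M'', Le M M' → Le M' M'' → Le M M'') {bs : List (ℕ × ℕ)} {M : Mem}
    {env : List ℕ} {Q : List ℕ → Mem → Prop} (hQ : ∀ l M M', Le M M' → Q l M → Q l M')
    (step : ∀ l, InBounds n l bs → ∀ M', Le M M' →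
      Le M' (C.exec n M' (env ++ l)) ∧ Q l (C.exec n M' (env ++ l))) :
    Le M ((Cmd.nest bs C).exec n M env) ∧
      ∀ l, InBounds n l bs → Q l ((Cmd.nest bs C).exec n M env) := by
  induction bs generalizing M env Q with
  | nil => simpa [Cmd.nest] using step [] .nil M (hrefl M)
  | cons b bs ih =>
    have hloop := exec_loop_mono (k := b.1) (c := b.2) (C := Cmd.nest bs C) (M := M) (env := env)
      hrefl htrans (Q := fun i M => ∀ l, InBounds n l bs → Q (i :: l) M)
      (fun i M M' hle hq l hl => hQ _ _ _ hle (hq l hl)) fun i hi M' hle =>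
        ih (fun l => hQ (i :: l)) fun l hl M'' hle' => by
          simpa using step (i :: l) (.cons hi hl) M'' (htrans _ _ _ hle hle')
    exact ⟨hloop.1, fun _ hl => match hl with | .cons hi hl => hloop.2 _ hi _ hl⟩

/-! ### Reachability -/

/-- Mark `t` as reachable from `s` if `s = t` or some neighbour of `t` is marked as reachable from
`s`. The adjacency of the graph is `e`, two of whose four parameters name the graph, and the marks
are in the array `arr`. -/
def markStep (arr : ℕ) (e : Exp) : Cmd :=
  .ite (.or (.eq (.var 3) (.var 4)) <| .sum 1 0 <|
      .and (.read arr (.idx4 (.var 1) (.var 2) (.var 3) (.var 5)))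
        (.app e [.var 1, .var 2, .var 5, .var 4]))
    (.store arr (.idx4 (.var 1) (.var 2) (.var 3) (.var 4)) (.const 1)) .skip

/-- Update the marks of all pairs of vertices in all graphs. -/
def closureSweep (arr : ℕ) (e : Exp) : Cmd :=
  .nest [(1, 0), (1, 0), (1, 0), (1, 0)] (markStep arr e)

/-- Tabulate reachability in the graphs with adjacency `e`. -/
def closureCmd (arr : ℕ) (e : Exp) : Cmd := .loop 1 0 (closureSweep arr e)

section Closure

variable {n arr p q : ℕ} {H : SimpleGraph (Fin n)} {M M' M'' : Mem}

/-- The pairs of vertices that are marked in the table of the graph named by `p` and `q`. -/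
def Marked (n arr p q : ℕ) (M : Mem) (s t : Fin n) : Prop := M arr (quad n p q s t) ≠ 0

/-- `M'` differs from `M` only by further marks, which are correct for the graph `H` named by `p`
and `q` if those in `M` are. -/
structure Grows (arr p q : ℕ) (H : SimpleGraph (Fin n)) (M M' : Mem) : Prop where
  apply_eq : ∀ a ≠ arr, M' a = M a
  marked : ∀ s t, Marked n arr p q M s t → Marked n arr p q M' s t
  reachable : (∀ s t, Marked n arr p q M s t → H.Reachable s t) →
    ∀ s t, Marked n arr p q M' s t → H.Reachable s t

theorem Grows.refl (M : Mem) : Grows arr p q H M M := ⟨fun _ _ => rfl, fun _ _ h => h, id⟩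

theorem Grows.trans (h : Grows arr p q H M M') (h' : Grows arr p q H M' M'') :
    Grows arr p q H M M'' :=
  ⟨fun a ha => (h'.apply_eq a ha).trans (h.apply_eq a ha),
    fun s t hst => h'.marked s t (h.marked s t hst), fun hs => h'.reachable (h.reachable hs)⟩

theorem Grows.tr_iff (h : Grows arr p q H M M') {e : Exp} (hr : ¬ e.Reads arr) {env : List ℕ} :
    Tr n M' e env ↔ Tr n M e env := by
  rw [Tr, Tr, Exp.eval_congr fun a ha => h.apply_eq a fun he => hr (he ▸ ha)]

theorem grows_update (hq : q < n) {p' q' : ℕ} (hq' : q' < n) (s t : Fin n)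
    (hok : p' = p → q' = q → (∀ s t, Marked n arr p q M s t → H.Reachable s t) →
      H.Reachable s t) :
    Grows arr p q H M (Function.update M arr (Function.update (M arr) (quad n p' q' s t) 1)) := by
  refine ⟨fun a ha => Function.update_of_ne ha _ _, fun u v huv => ?_, fun hsound u v huv => ?_⟩
  · rw [Marked, Function.update_self]
    by_cases he : quad n p q u v = quad n p' q' s t
    · simp [he]
    · rwa [Function.update_of_ne he]
  · by_cases he : quad n p q u v = quad n p' q' s t
    · obtain ⟨hp, hq, hs, ht⟩ := quad_inj hq u.2 v.2 hq' s.2 t.2 he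
      rw [Fin.ext hs, Fin.ext ht]
      exact hok hp.symm hq.symm hsound
    · rw [Marked, Function.update_self, Function.update_of_ne he] at huv
      exact hsound u v huv

theorem grows_exec_markStep {e : Exp} (hq : q < n)
    (hH : ∀ s t : Fin n, Tr n M e [p, q, s, t] ↔ H.Adj s t) (j : ℕ) (p' q' s t : Fin n) :
    Grows arr p q H M ((markStep arr e).exec n M [j, p', q', s, t]) ∧
      (p' = p → q' = q → (s = t ∨ ∃ c, Marked n arr p q M s c ∧ H.Adj c t) →
        Marked n arr p q ((markStep arr e).exec n M [j, p', q', s, t]) s t) := by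
  have hcond : Tr n M (.or (.eq (.var 3) (.var 4)) <| .sum 1 0 <|
      .and (.read arr (.idx4 (.var 1) (.var 2) (.var 3) (.var 5)))
        (.app e [.var 1, .var 2, .var 5, .var 4])) [j, p', q', s, t] ↔
      s = t ∨ ∃ c : Fin n, Marked n arr p' q' M s c ∧ Tr n M e [p', q', c, t] := by
    simp [Marked, Fin.ext_iff]
  classical
  rw [markStep, exec_ite]
  simp only [hcond]
  split_ifs with hmark
  · simp only [Cmd.exec, eval_idx4, eval_var, eval_const, List.getD_cons_zero,
      List.getD_cons_succ]
    refine ⟨grows_update hq q'.2 s t ?_, ?_⟩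
    · rintro rfl rfl hsound
      obtain rfl | ⟨c, hsc, hct⟩ := hmark
      · rfl
      · exact (hsound s c hsc).trans ((hH c t).1 hct).reachable
    · rintro rfl rfl -
      simp [Marked]
  · refine ⟨Grows.refl M, ?_⟩
    rintro rfl rfl hst
    simp only [hH] at hmark
    exact absurd hst hmark

theorem grows_exec_closureSweep {e : Exp} (hr : ¬ e.Reads arr) (hp : p < n) (hq : q < n)
    (hH : ∀ s t : Fin n, Tr n M e [p, q, s, t] ↔ H.Adj s t) (j : ℕ) :
    Grows arr p q H M ((closureSweep arr e).exec n M [j]) ∧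
      ∀ s t, (s = t ∨ ∃ c, Marked n arr p q M s c ∧ H.Adj c t) →
        Marked n arr p q ((closureSweep arr e).exec n M [j]) s t := by
  have hnest := exec_nest_mono (n := n) (C := markStep arr e) (Le := Grows arr p q H) (M := M)
    (env := [j]) Grows.refl (fun _ _ _ => Grows.trans) (bs := [(1, 0), (1, 0), (1, 0), (1, 0)])
    (Q := fun l M' => ∀ s t : Fin n, l = [p, q, (s : ℕ), (t : ℕ)] →
      (s = t ∨ ∃ c, Marked n arr p q M s c ∧ H.Adj c t) → Marked n arr p q M' s t)
    (fun l M' M'' hle h s t hl hst => hle.marked s t (h s t hl hst)) fun l hl M' hM' => ?_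
  · exact ⟨hnest.1, fun s t => hnest.2 [p, q, s, t] (by simp [hp, hq]) s t rfl⟩
  simp only [inBounds_vertex_cons, inBounds_nil] at hl
  obtain ⟨p', _, ⟨q', _, ⟨s, _, ⟨t, _, rfl, rfl⟩, rfl⟩, rfl⟩, rfl⟩ := hl
  obtain ⟨hgrows, hmark⟩ := grows_exec_markStep hq
    (fun s t => (hM'.tr_iff hr).trans (hH s t)) j p' q' s t
  refine ⟨hgrows, fun s' t' hl hst => ?_⟩
  simp only [List.cons.injEq, and_true, Fin.val_inj] at hl
  obtain ⟨hp', hq', rfl, rfl⟩ := hl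
  exact hmark hp' hq' (hst.imp_right fun ⟨c, hsc, hct⟩ => ⟨c, hM'.marked s c hsc, hct⟩)

theorem marked_exec_closureCmd_iff {e : Exp} (hr : ¬ e.Reads arr) (h0 : ∀ k, M arr k = 0)
    (hp : p < n) (hq : q < n) (hH : ∀ s t : Fin n, Tr n M e [p, q, s, t] ↔ H.Adj s t)
    (s t : Fin n) : Marked n arr p q ((closureCmd arr e).exec n M []) s t ↔ H.Reachable s t := by
  have hinv := exec_loop_induction (k := 1) (c := 0) (C := closureSweep arr e) (M := M) (env := [])
    (fun j M' => Grows arr p q H M M' ∧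
      ∀ s t, ∀ w : H.Walk s t, w.length < j → Marked n arr p q M' s t)
    ⟨Grows.refl M, by simp⟩ (n := n) fun j _ M' ⟨hM', hwalk⟩ => ?_
  · rw [one_mul, add_zero] at hinv
    refine ⟨hinv.1.reachable (fun s t hst => absurd (h0 _) hst) s t, fun hst => ?_⟩
    obtain ⟨w, hw⟩ := hst.exists_isPath
    exact hinv.2 s t w (by simpa using hw.length_lt)
  obtain ⟨hgrows, hmark⟩ := grows_exec_closureSweep hr hp hq
    (fun s t => (hM'.tr_iff hr).trans (hH s t)) j
  refine ⟨hM'.trans hgrows, fun s t w hw => hmark s t ?_⟩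
  by_cases hnil : w.Nil
  · exact .inl hnil.eq
  · refine .inr ⟨w.penultimate, hwalk _ _ w.dropLast ?_, w.adj_penultimate hnil⟩
    have := SimpleGraph.Walk.not_nil_iff_lt_length.1 hnil
    rw [SimpleGraph.Walk.length_dropLast]
    omega

end Closure

end RAM

/-! ### Tokens and bids as expressions -/

theorem reachable_map_iff {V W : Type*} {G : SimpleGraph V} (f : V ↪ W) {a b : V} :
    (G.map f).Reachable (f a) (f b) ↔ G.Reachable a b := by
  refine ⟨fun h => ?_, fun h => h.map (SimpleGraph.Embedding.map f G).toHom⟩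
  suffices hex : ∀ v, (G.map f).Reachable (f a) v → ∃ c, f c = v ∧ G.Reachable a c by
    obtain ⟨c, hc, hac⟩ := hex _ h
    rwa [← f.injective hc]
  intro v hv
  rw [SimpleGraph.reachable_iff_reflTransGen] at hv
  induction hv with
  | refl => exact ⟨a, rfl, .refl a⟩
  | tail _ hadj ih =>
    obtain ⟨c, rfl, hac⟩ := ih
    obtain ⟨c', d, hcd, hc, rfl⟩ := (SimpleGraph.map_adj f G _ _).1 hadj
    exact ⟨d, rfl, hac.trans (f.injective hc ▸ hcd.reachable)⟩

namespace RAM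

open Exp (var)

/-- Adjacency in the input graph, which is stored in array `0`. -/
def Exp.adj (e f : Exp) : Exp := .read 0 (.pair e f)

/-- The existential quantifier over `A`, which is stored in array `1`. The vertex is held in
variable `i`. -/
def Exp.exA (i : ℕ) (e : Exp) : Exp := .sum 1 0 (.and (.read 1 (.var i)) e)

/-- The number of vertices of `A`, held in variable `i`, with the property `e`. -/
def Exp.countA (i : ℕ) (e : Exp) : Exp := .count (.and (.read 1 (.var i)) e)

/-- The unique vertex of `A`, held in variable `i`, with the property `e`. -/
def Exp.theA (i : ℕ) (e : Exp) : Exp :=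
  .sum 1 0 (.ite (.and (.read 1 (.var i)) e) (.var i) (.const 0))

/-- `N x ∩ N y ⊆ N a`, for the arguments `x`, `y`, `a`. -/
def subE : Exp := .not <| .sum 1 0 <|
  .and (.and (.adj (var 0) (var 3)) (.adj (var 1) (var 3))) (.not (.adj (var 2) (var 3)))

/-- Adjacency of `a` and `b` in `classGraph N (N x ∩ N y)`, for the arguments `x`, `y`, `a`, `b`. -/
def classAdjE : Exp :=
  .and (.read 1 (var 2)) <| .and (.read 1 (var 3)) <| .and (.not (.eq (var 2) (var 3))) <|
  .and (.app subE [var 0, var 1, var 2]) <| .and (.app subE [var 0, var 1, var 3]) <|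
  .sum 1 0 (.and (.and (.adj (var 2) (var 4)) (.adj (var 3) (var 4)))
    (.not (.and (.adj (var 0) (var 4)) (.adj (var 1) (var 4)))))

/-- `SameClass N (N x ∩ N y) a b`, tabulated in array `4`. -/
def sameE (x y a b : Exp) : Exp := .read 4 (.idx4 x y a b)

/-- `IsCanonical N x y`, for the arguments `x`, `y`. -/
def canonicalE : Exp :=
  .and (.not (sameE (var 0) (var 1) (var 0) (var 1))) <| .not <| .exA 2 <| .exA 3 <|
  .and (.lexLt (var 2) (var 3) (var 0) (var 1)) <|
  .and (.not (sameE (var 2) (var 3) (var 2) (var 3))) <|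
  .and (.and (.app subE [var 2, var 3, var 0]) (.app subE [var 2, var 3, var 1]))
    (.and (.app subE [var 0, var 1, var 2]) (.app subE [var 0, var 1, var 3]))

/-- `IsRep N (N x ∩ N y) z`, for the arguments `x`, `y`, `z`. -/
def repE : Exp :=
  .and (.app subE [var 0, var 1, var 2]) <| .not <| .exA 3 <|
  .and (sameE (var 0) (var 1) (var 2) (var 3)) (.lt (var 3) (var 2))

/-- `IsToken N x y z k`, for the arguments `x`, `y`, `z`, `k`. -/
def tokenE : Exp :=
  .and (.app canonicalE [var 0, var 1]) <| .and (.app repE [var 0, var 1, var 2]) <|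
  .or (.not (var 3)) (.and (.not (sameE (var 0) (var 1) (var 0) (var 2)))
    (.not (sameE (var 0) (var 1) (var 1) (var 2))))

/-- `Allowed N x y z k a`, for the arguments `x`, `y`, `z`, `k`, `a`. -/
def allowedE : Exp :=
  .or (.and (var 3) (.app subE [var 0, var 1, var 4]))
    (.and (.not (var 3)) (sameE (var 0) (var 1) (var 2) (var 4)))

/-- The number `code (x, y, z, k)`, for the arguments `x`, `y`, `z`, `k`. -/
def codeE : Exp :=
  .add (.add (.add (.pair (.pair (var 0) (var 1)) (var 2)) (.pair (.pair (var 0) (var 1)) (var 2)))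
    (var 3)) (.const 1)

/-- The index of the slot `j` of the vertex `a`. -/
def slotE (a j : Exp) : Exp := .add (.add a a) j

/-- The token given by the first four arguments bids for the slot given by the last two. The codes
of the owners of the slots are in array `5`, the prices in array `6`. -/
def bidE : Exp :=
  .and (.app tokenE [var 0, var 1, var 2, var 3]) <|
  .and (.not <| .exA 6 <| .sum 0 2 <| .eq (.read 5 (slotE (var 6) (var 7)))
    (.app codeE [var 0, var 1, var 2, var 3])) <|
  .and (.app allowedE [var 0, var 1, var 2, var 3, var 4]) <|
  .and (.not (.lt (.add .size .size) (.read 6 (slotE (var 4) (var 5))))) <|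
  .not <| .exA 6 <| .sum 0 2 <| .and (.app allowedE [var 0, var 1, var 2, var 3, var 6]) <|
  .lt (.read 6 (slotE (var 6) (var 7))) (.read 6 (slotE (var 4) (var 5)))

/-- An element of `A` as a natural number. -/
def ix {n : ℕ} {A : Set (Fin n)} (a : A) : ℕ := (a : Fin n)

section

variable {n : ℕ} (G : SimpleGraph (Fin n)) (A : Set (Fin n))

/-- The neighbourhood of an element of `A`. -/
def nbrs (a : A) : Set (Fin n) := {b | G.Adj a b}

/-- The memory holds the graph in array `0` and the side `A` in array `1`. -/
structure HoldsInput (M : Mem) : Prop where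
  adj : ∀ i j : Fin n, M 0 (i * n + j) ≠ 0 ↔ G.Adj i j
  mem : ∀ i : Fin n, M 1 i ≠ 0 ↔ i ∈ A

/-- The memory holds the relations `SameClass` in array `4`. -/
def HoldsClasses (M : Mem) : Prop :=
  ∀ x y a b : A, M 4 (quad n (ix x) (ix y) (ix a) (ix b)) ≠ 0 ↔
    SameClass (nbrs G A) (nbrs G A x ∩ nbrs G A y) a b

variable {G A} {M M' : Mem}

theorem ix_lt_size (a : A) : ix a < n := (a : Fin n).2

@[simp] theorem ix_inj {a b : A} : ix a = ix b ↔ a = b := by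
  rw [ix, ix, Fin.val_inj, Subtype.coe_inj]

@[simp] theorem ix_lt {a b : A} : ix a < ix b ↔ a < b := Iff.rfl

theorem HoldsInput.congr (h : HoldsInput G A M) (h0 : M' 0 = M 0) (h1 : M' 1 = M 1) :
    HoldsInput G A M' :=
  ⟨by rw [h0]; exact h.adj, by rw [h1]; exact h.mem⟩

theorem HoldsClasses.congr (h : HoldsClasses G A M) (h4 : M' 4 = M 4) : HoldsClasses G A M' := by
  rw [HoldsClasses, h4]
  exact h

theorem HoldsInput.tr_exA (h : HoldsInput G A M) {env : List ℕ} {i : ℕ} {e : Exp}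
    (hi : env.length = i) : Tr n M (.exA i e) env ↔ ∃ a : A, Tr n M e (env ++ [ix a]) := by
  subst hi
  simp [Exp.exA, ix, h.mem]

open Classical in
theorem HoldsInput.eval_countA [Fintype A] (h : HoldsInput G A M) {env : List ℕ} {i : ℕ} {e : Exp}
    (hi : env.length = i) : (Exp.countA i e).eval n M env =
      (Finset.univ.filter fun a : A => Tr n M e (env ++ [ix a])).card := by
  subst hi
  rw [Exp.countA, eval_count, ← Finset.card_map (Function.Embedding.subtype _)]
  congr 1
  ext i
  simp only [Finset.mem_filter_univ, Finset.mem_map, Function.Embedding.subtype_apply]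
  simp [ix, h.mem, and_comm]

theorem HoldsInput.eval_theA (h : HoldsInput G A M) {env : List ℕ} {i : ℕ} {e : Exp}
    (hi : env.length = i) (a : A) (ha : ∀ b : A, Tr n M e (env ++ [ix b]) ↔ b = a) :
    (Exp.theA i e).eval n M env = ix a := by
  subst hi
  rw [Exp.theA, eval_sum, one_mul, add_zero, ← Fin.sum_univ_eq_sum_range
    (fun i => (Exp.ite _ _ _).eval n M (env ++ [i])), Finset.sum_eq_single_of_mem (a : Fin n)
    (Finset.mem_univ _) fun b _ hne => ?_]
  · rw [eval_ite, if_pos]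
    · simp [ix]
    · simpa [h.mem] using! (ha a).2 rfl
  · rw [eval_ite, if_neg]
    · rfl
    · simp only [tr_and, tr_read, eval_var, List.getD_append_right _ _ _ _ le_rfl, Nat.sub_self,
        List.getD_cons_zero, h.mem]
      rintro ⟨hb, he⟩
      exact hne (congrArg Subtype.val ((ha ⟨b, hb⟩).1 he))

theorem HoldsInput.tr_adj (h : HoldsInput G A M) {env : List ℕ} {e f : Exp} {a : A} {b : Fin n}
    (he : e.eval n M env = ix a) (hf : f.eval n M env = b) :
    Tr n M (.adj e f) env ↔ b ∈ nbrs G A a := by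
  simp only [Exp.adj, tr_read, eval_pair, he, hf]
  exact h.adj a b

theorem tr_subE (h : HoldsInput G A M) (x y a : A) :
    Tr n M subE [ix x, ix y, ix a] ↔ nbrs G A x ∩ nbrs G A y ⊆ nbrs G A a := by
  have hadj : ∀ (i : ℕ) (c : A) (b : Fin n), [ix x, ix y, ix a, (b : ℕ)].getD i 0 = ix c →
      (Tr n M (.adj (var i) (var 3)) [ix x, ix y, ix a, b] ↔ b ∈ nbrs G A c) :=
    fun i c b hc => h.tr_adj hc rfl
  simp only [subE, tr_not, tr_ex, tr_and, List.cons_append, List.nil_append, hadj 0 x _ rfl,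
    hadj 1 y _ rfl, hadj 2 a _ rfl, not_exists, not_and, not_not, and_imp]
  simp only [Set.subset_def, Set.mem_inter_iff, and_imp]

theorem tr_classAdjE_ix (h : HoldsInput G A M) (x y a b : A) :
    Tr n M classAdjE [ix x, ix y, ix a, ix b] ↔
      (classGraph (nbrs G A) (nbrs G A x ∩ nbrs G A y)).Adj a b := by
  have hadj : ∀ (i : ℕ) (c : A) (d : Fin n), [ix x, ix y, ix a, ix b, (d : ℕ)].getD i 0 = ix c →
      (Tr n M (.adj (var i) (var 4)) [ix x, ix y, ix a, ix b, d] ↔ d ∈ nbrs G A c) :=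
    fun i c d hc => h.tr_adj hc rfl
  have ha : M 1 (ix a) ≠ 0 := (h.mem a).2 a.2
  have hb : M 1 (ix b) ≠ 0 := (h.mem b).2 b.2
  simp only [classAdjE, tr_and, tr_read, eval_var, List.getD_cons_zero, List.getD_cons_succ, ha, hb,
    true_and, tr_not, tr_eq, ix_inj, tr_app, List.map_cons, List.map_nil, tr_subE h, tr_ex,
    List.cons_append, List.nil_append, hadj 0 x _ rfl, hadj 1 y _ rfl, hadj 2 a _ rfl,
    hadj 3 b _ rfl, ne_eq, not_false_eq_true]
  simp only [classGraph, Set.ssubset_iff_exists, Set.subset_inter_iff, Set.mem_inter_iff,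
    and_assoc, ne_eq]

theorem tr_classAdjE (h : HoldsInput G A M) (x y : A) (s t : Fin n) :
    Tr n M classAdjE [ix x, ix y, s, t] ↔
      ((classGraph (nbrs G A) (nbrs G A x ∩ nbrs G A y)).map
        (Function.Embedding.subtype _)).Adj s t := by
  rw [SimpleGraph.map_adj]
  constructor
  · intro hst
    obtain ⟨hs, ht⟩ : M 1 s ≠ 0 ∧ M 1 t ≠ 0 := by
      simp only [classAdjE, tr_and, tr_read, eval_var, List.getD_cons_zero,
        List.getD_cons_succ] at hst
      exact ⟨hst.1, hst.2.1⟩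
    exact ⟨⟨s, (h.mem s).1 hs⟩, ⟨t, (h.mem t).1 ht⟩, (tr_classAdjE_ix h x y _ _).1 hst, rfl, rfl⟩
  · rintro ⟨a, b, hab, rfl, rfl⟩
    exact (tr_classAdjE_ix h x y a b).2 hab

theorem holdsClasses_exec_closureCmd (h : HoldsInput G A M) (h4 : ∀ k, M 4 k = 0) :
    HoldsClasses G A ((closureCmd 4 classAdjE).exec n M []) := fun x y a b =>
  (marked_exec_closureCmd_iff (by decide) h4 (ix_lt_size x)
    (ix_lt_size y) (tr_classAdjE h x y) a b).trans (reachable_map_iff (.subtype (· ∈ A)))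

theorem tr_canonicalE (h : HoldsInput G A M) (hs : HoldsClasses G A M) (x y : A) :
    Tr n M canonicalE [ix x, ix y] ↔ IsCanonical (nbrs G A) x y := by
  simp only [canonicalE, tr_and, tr_not, sameE, tr_read, eval_idx4, eval_var, List.getD_cons_zero,
    List.getD_cons_succ, hs _ _ _ _, h.tr_exA (env := [ix x, ix y]) (i := 2) rfl,
    List.cons_append, List.nil_append]
  simp only [h.tr_exA (env := [ix x, ix y, _]) (i := 3) rfl, List.cons_append, List.nil_append,
    tr_and, tr_lexLt, eval_var, List.getD_cons_zero, List.getD_cons_succ, tr_not, tr_read,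
    eval_idx4, hs _ _ _ _, tr_app, List.map_cons, List.map_nil, tr_subE h, ix_inj, ix_lt]
  rw [IsCanonical]
  refine and_congr_right fun _ => ?_
  simp only [Prod.Lex.toLex_lt_toLex, not_exists, not_and]
  refine forall_congr' fun x' => forall_congr' fun y' => forall_congr' fun _ =>
    forall_congr' fun _ => ?_
  rw [Ne, Set.Subset.antisymm_iff, Set.subset_inter_iff, Set.subset_inter_iff]
  tauto

theorem tr_repE (h : HoldsInput G A M) (hs : HoldsClasses G A M) (x y z : A) :
    Tr n M repE [ix x, ix y, ix z] ↔ IsRep (nbrs G A) (nbrs G A x ∩ nbrs G A y) z := by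
  simp only [repE, tr_and, tr_not, sameE, tr_read, eval_idx4, eval_var, List.getD_cons_zero,
    List.getD_cons_succ, hs _ _ _ _, h.tr_exA (env := [ix x, ix y, ix z]) (i := 3) rfl,
    List.cons_append, List.nil_append, tr_app, List.map_cons, List.map_nil, tr_subE h, tr_lt,
    ix_lt, not_exists, not_and, not_lt, IsRep]

theorem tr_tokenE (h : HoldsInput G A M) (hs : HoldsClasses G A M) (x y z : A) (k : Bool) :
    Tr n M tokenE [ix x, ix y, ix z, k.toNat] ↔ IsToken (nbrs G A) x y z k := by
  simp only [tokenE, tr_and, tr_not, tr_or, sameE, tr_read, eval_idx4, eval_var, tr_var,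
    List.getD_cons_zero, List.getD_cons_succ, hs _ _ _ _, tr_app, List.map_cons, List.map_nil,
    tr_canonicalE h hs, tr_repE h hs, IsToken]
  cases k <;> simp

theorem tr_allowedE (h : HoldsInput G A M) (hs : HoldsClasses G A M) (x y z : A) (k : Bool)
    (a : A) :
    Tr n M allowedE [ix x, ix y, ix z, k.toNat, ix a] ↔ Allowed (nbrs G A) x y z k a := by
  simp only [allowedE, tr_and, tr_not, tr_or, sameE, tr_read, eval_idx4, eval_var, tr_var,
    List.getD_cons_zero, List.getD_cons_succ, hs _ _ _ _, tr_app, List.map_cons, List.map_nil,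
    tr_subE h, Allowed]
  cases k <;> simp

/-- The code of a token. It is positive, since `0` stands for no token. -/
def code (u : A × A × A × Bool) : ℕ :=
  ((ix u.1 * n + ix u.2.1) * n + ix u.2.2.1) + ((ix u.1 * n + ix u.2.1) * n + ix u.2.2.1) +
    u.2.2.2.toNat + 1

/-- The index of a slot. -/
def slotIx (s : A × Bool) : ℕ := ix s.1 + ix s.1 + s.2.toNat

theorem add_self_add_toNat_inj {i j : ℕ} {b c : Bool} :
    i + i + b.toNat = j + j + c.toNat ↔ i = j ∧ b = c := by
  cases b <;> cases c <;> simp <;> omega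

theorem code_injective : Function.Injective (code (n := n) (A := A)) := by
  rintro ⟨x, y, z, k⟩ ⟨x', y', z', k'⟩ h
  obtain ⟨hxyz, rfl⟩ := add_self_add_toNat_inj.1 (Nat.succ_injective h)
  obtain ⟨hxy, hz⟩ := pair_inj (ix_lt_size z) (ix_lt_size z') hxyz
  obtain ⟨hx, hy⟩ := pair_inj (ix_lt_size y) (ix_lt_size y') hxy
  exact Prod.ext (ix_inj.1 hx) (Prod.ext (ix_inj.1 hy) (Prod.ext (ix_inj.1 hz) rfl))

theorem slotIx_injective : Function.Injective (slotIx (n := n) (A := A)) := by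
  rintro ⟨a, j⟩ ⟨a', j'⟩ h
  obtain ⟨ha, rfl⟩ := add_self_add_toNat_inj.1 h
  exact Prod.ext (ix_inj.1 ha) rfl

/-- The memory holds the owners `o` of the slots in array `5` and their prices `d` in array `6`. -/
structure HoldsAuction (M : Mem) (o : A × Bool → Option (A × A × A × Bool)) (d : A × Bool → ℕ) :
    Prop where
  owner : ∀ s, M 5 (slotIx s) = (o s).elim 0 code
  price : ∀ s, M 6 (slotIx s) = d s

@[simp] theorem eval_slotE {env : List ℕ} {e f : Exp} : (slotE e f).eval n M env =
    e.eval n M env + e.eval n M env + f.eval n M env := rfl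

theorem eval_codeE (x y z : A) (k : Bool) :
    codeE.eval n M [ix x, ix y, ix z, k.toNat] = code (x, y, z, k) := by
  simp [codeE, code]

theorem elim_code_eq_iff {o : Option (A × A × A × Bool)} {u : A × A × A × Bool} :
    o.elim 0 code = code u ↔ o = some u := by
  cases o with
  | none => simp [code]
  | some v => simp [code_injective.eq_iff]

theorem tr_bidE [Fintype A] (h : HoldsInput G A M) (hs : HoldsClasses G A M)
    {o : A × Bool → Option (A × A × A × Bool)} {d : A × Bool → ℕ} (hM : HoldsAuction M o d)
    (x y z : A) (k : Bool) (a : A) (j : Bool) :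
    Tr n M bidE [ix x, ix y, ix z, k.toNat, ix a, j.toNat] ↔
      Bid (n + n) (tokens (nbrs G A)) (Fits (nbrs G A)) o d (x, y, z, k) (a, j) := by
  have howner : ∀ (a : A) (j : Bool), M 5 (ix a + ix a + j.toNat) = (o (a, j)).elim 0 code :=
    fun a j => hM.owner (a, j)
  have hprice : ∀ (a : A) (j : Bool), M 6 (ix a + ix a + j.toNat) = d (a, j) :=
    fun a j => hM.price (a, j)
  simp only [bidE, tr_and, tr_not, eval_var,
    List.getD_cons_zero, List.getD_cons_succ, tr_app, List.map_cons, List.map_nil,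
    tr_tokenE h hs, tr_allowedE h hs, tr_exBool,
    h.tr_exA (env := [ix x, ix y, ix z, k.toNat, ix a, j.toNat]) (i := 6) rfl,
    List.cons_append, List.nil_append, tr_eq, tr_lt, eval_read, eval_slotE, eval_app,
    eval_codeE, eval_add, eval_size, howner, hprice, elim_code_eq_iff]
  simp only [Bid, mem_tokens, Fits, not_exists, Prod.forall, not_and, not_lt, ne_eq]

end

/-! ### The auction as a command -/

/-- The command `C`, run with `len` loop variables, preserves `Inv`, does nothing in the states
`Stuck`, and increases `f` by at least `r` unless it ends in `Stuck`. -/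
def Advances (n len : ℕ) (Inv Stuck : Mem → Prop) (f : Mem → ℕ) (r : ℕ) (C : Cmd) : Prop :=
  ∀ M env, env.length = len → Inv M →
    Inv (C.exec n M env) ∧ (Stuck M → C.exec n M env = M) ∧
      (Stuck (C.exec n M env) ∨ f M + r ≤ f (C.exec n M env))

section Advances

variable {n len : ℕ} {Inv Stuck : Mem → Prop} {f : Mem → ℕ} {r : ℕ} {C : Cmd}

theorem Advances.loop (h : Advances n (len + 1) Inv Stuck f r C) (k c : ℕ) :
    Advances n len Inv Stuck f ((k * n + c) * r) (.loop k c C) := by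
  intro M env henv hM
  have hinv := exec_loop_induction (k := k) (c := c) (C := C) (M := M) (env := env) (n := n)
    (fun i M' => Inv M' ∧ (Stuck M → M' = M) ∧ (Stuck M' ∨ f M + i * r ≤ f M'))
    ⟨hM, fun _ => rfl, .inr (by simp)⟩ fun i _ M' ⟨hM', hstuck, hadv⟩ => ?_
  · exact hinv
  obtain ⟨hM'', hstuck', hadv'⟩ := h M' (env ++ [i]) (by simp [henv]) hM'
  refine ⟨hM'', fun hs => ?_, ?_⟩
  · have he := hstuck hs
    rw [hstuck' (he ▸ hs), he]
  · rcases hadv with hs | hle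
    · exact .inl ((hstuck' hs).symm ▸ hs)
    · refine hadv'.imp_right fun hle' => ?_
      rw [add_mul, one_mul]
      omega

theorem advances_nest {bs : List (ℕ × ℕ)} {e : Exp} {P : List ℕ → Mem → Prop}
    (hP : ∀ env l, env.length = len → InBounds n l bs → ∀ M, Inv M →
      (Tr n M e (env ++ l) ↔ P l M))
    (step : ∀ env l, env.length = len → InBounds n l bs → ∀ M, Inv M → P l M →
      Inv (C.exec n M (env ++ l)) ∧ f M < f (C.exec n M (env ++ l))) :
    Advances n len Inv (fun M => ∀ l, InBounds n l bs → ¬ P l M) f 1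
      (.nest bs (.ite e C .skip)) := by
  classical
  intro M env henv hM
  have hnest := exec_nest_mono (n := n) (C := .ite e C .skip) (M := M) (env := env) (bs := bs)
    (Le := fun M M' => Inv M →
      Inv M' ∧ (M' = M ∨ (∃ l, InBounds n l bs ∧ P l M) ∧ f M < f M'))
    (Q := fun l M' => Inv M' ∧ (P l M → f M < f M')) (fun M hM => ⟨hM, .inl rfl⟩)
    (fun M M' M'' h h' hM => ?_) (fun l M' M'' h hQ => ?_) (fun l hl M' h => ?_)
  · obtain ⟨hmono, hQ⟩ := hnest
    obtain ⟨hM', he | ⟨⟨l, hl, hPl⟩, hlt⟩⟩ := hmono hM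
    · refine ⟨hM', fun _ => he, .inl fun l hl hPl => ?_⟩
      rw [he] at hPl hQ
      exact lt_irrefl _ ((hQ l hl).2 hPl)
    · exact ⟨hM', fun hs => absurd hPl (hs l hl), .inr hlt⟩
  · obtain ⟨hM', rfl | ⟨hex, hlt⟩⟩ := h hM
    · exact h' hM
    · obtain ⟨hM'', rfl | ⟨-, hlt'⟩⟩ := h' hM'
      · exact ⟨hM'', .inr ⟨hex, hlt⟩⟩
      · exact ⟨hM'', .inr ⟨hex, hlt.trans hlt'⟩⟩
  · obtain ⟨hM'', rfl | ⟨-, hlt⟩⟩ := h hQ.1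
    · exact hQ
    · exact ⟨hM'', fun hPl => (hQ.2 hPl).trans hlt⟩
  · obtain ⟨hM', hMM'⟩ := h hM
    rw [exec_ite, hP env l henv hl M' hM']
    split_ifs with hPl
    · obtain ⟨hM'', hlt⟩ := step env l henv hl M' hM' hPl
      refine ⟨fun _ => ⟨hM'', .inr ⟨⟨l, hl, hPl⟩, hlt⟩⟩, hM'', fun _ => ?_⟩
      rcases hMM' with rfl | ⟨-, hlt'⟩
      · exact hlt
      · exact hlt'.trans hlt
    · refine ⟨fun hM' => ⟨hM', .inl rfl⟩, hM', fun hPl' => ?_⟩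
      rcases hMM' with rfl | ⟨-, hlt'⟩
      · exact absurd hPl' hPl
      · exact hlt'

end Advances

/-- Enter a bid for the slot given by variables `6` and `7` of the token given by the variables
`2` to `5`. -/
def enterBidCmd : Cmd :=
  .seq (.store 5 (slotE (var 6) (var 7)) (.app codeE [var 2, var 3, var 4, var 5]))
    (.store 6 (slotE (var 6) (var 7)) (.add (.read 6 (slotE (var 6) (var 7))) (.const 1)))

/-- Try all bids once. -/
def auctionSweep : Cmd :=
  .nest [(1, 0), (1, 0), (1, 0), (0, 2), (1, 0), (0, 2)] <|
  .ite (.and (.and (.and (.read 1 (var 2)) (.read 1 (var 3)))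
      (.and (.read 1 (var 4)) (.read 1 (var 6))))
      (.app bidE [var 2, var 3, var 4, var 5, var 6, var 7]))
    enterBidCmd .skip

/-- Run the auction to its end. Each sweep before the end raises a price, and the sum of the prices
of the `2 * n` slots is at most `2 * n * (2 * n + 1)`. -/
def auctionCmd : Cmd := .loop 2 1 (.loop 2 1 auctionSweep)

section

variable {n : ℕ} {G : SimpleGraph (Fin n)} {A : Set (Fin n)} {M : Mem}

/-- The values of the loop variables name a token and a slot for which it bids. -/
def BidAt (n : ℕ) (A : Set (Fin n)) (l : List ℕ) (M : Mem) : Prop :=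
  ∃ (x y z : A) (k : Bool) (a : A) (j : Bool),
    l = [ix x, ix y, ix z, k.toNat, ix a, j.toNat] ∧ Tr n M bidE l

theorem HoldsAuction.update {o : A × Bool → Option (A × A × A × Bool)} {d : A × Bool → ℕ}
    (h : HoldsAuction M o d) (u : A × A × A × Bool) (s : A × Bool) :
    HoldsAuction (Function.update (Function.update M 5
      (Function.update (M 5) (slotIx s) (code u))) 6
      (Function.update (M 6) (slotIx s) (M 6 (slotIx s) + 1)))
      (Function.update o s (some u)) (Function.update d s (d s + 1)) := by
  refine ⟨fun s' => ?_, fun s' => ?_⟩ <;> obtain rfl | hs := eq_or_ne s' s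
  · simp
  · simp [hs, slotIx_injective.eq_iff, h.owner]
  · simp [h.price]
  · simp [hs, slotIx_injective.eq_iff, h.price]

theorem exec_enterBidCmd (i i' : ℕ) (x y z : A) (k : Bool) (a : A) (j : Bool) :
    enterBidCmd.exec n M ([i, i'] ++ [ix x, ix y, ix z, k.toNat, ix a, j.toNat]) =
      Function.update (Function.update M 5
        (Function.update (M 5) (slotIx (a, j)) (code (x, y, z, k)))) 6
        (Function.update (M 6) (slotIx (a, j)) (M 6 (slotIx (a, j)) + 1)) := by
  simp [enterBidCmd, Cmd.exec, eval_codeE, slotIx]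

theorem HoldsInput.tr_bid_iff_bidAt (h : HoldsInput G A M) (i i' : ℕ) {l : List ℕ}
    (hl : InBounds n l [(1, 0), (1, 0), (1, 0), (0, 2), (1, 0), (0, 2)]) :
    Tr n M (.and (.and (.and (.read 1 (var 2)) (.read 1 (var 3)))
      (.and (.read 1 (var 4)) (.read 1 (var 6))))
      (.app bidE [var 2, var 3, var 4, var 5, var 6, var 7])) ([i, i'] ++ l) ↔ BidAt n A l M := by
  simp only [inBounds_vertex_cons, inBounds_bool_cons, inBounds_nil] at hl
  obtain ⟨x, _, ⟨y, _, ⟨z, _, ⟨k, _, ⟨a, _, ⟨j, _, rfl, rfl⟩, rfl⟩, rfl⟩, rfl⟩, rfl⟩, rfl⟩ := hl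
  simp only [tr_and, tr_read, eval_var, tr_app, List.map_cons, List.map_nil, List.getD_cons_zero,
    List.getD_cons_succ, List.cons_append, List.nil_append, h.mem, BidAt]
  constructor
  · rintro ⟨⟨⟨hx, hy⟩, hz, ha⟩, hb⟩
    exact ⟨⟨x, hx⟩, ⟨y, hy⟩, ⟨z, hz⟩, k, ⟨a, ha⟩, j, rfl, hb⟩
  · rintro ⟨x', y', z', k', a', j', hl, hb⟩
    simp only [ix, List.cons.injEq, Fin.val_inj] at hl
    obtain ⟨rfl, rfl, rfl, -, rfl, -⟩ := hl
    exact ⟨⟨⟨x'.2, y'.2⟩, z'.2, a'.2⟩, hb⟩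

variable [Fintype A]

/-- The sum of the prices. -/
def priceSum (A : Set (Fin n)) [Fintype A] (M : Mem) : ℕ := ∑ s : A × Bool, M 6 (slotIx s)

/-- The memory holds the input and a state of the auction. -/
structure AuctionInv (G : SimpleGraph (Fin n)) (A : Set (Fin n)) [Fintype A] (M : Mem) :
    Prop where
  input : HoldsInput G A M
  classes : HoldsClasses G A M
  auction : ∃ o d, HoldsAuction M o d ∧ Auction (n + n) (tokens (nbrs G A)) (Fits (nbrs G A)) o d

theorem AuctionInv.update (h : AuctionInv G A M) {x y z : A} {k : Bool} {a : A} {j : Bool}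
    (hb : Tr n M bidE [ix x, ix y, ix z, k.toNat, ix a, j.toNat]) :
    AuctionInv G A (Function.update (Function.update M 5
      (Function.update (M 5) (slotIx (a, j)) (code (x, y, z, k)))) 6
      (Function.update (M 6) (slotIx (a, j)) (M 6 (slotIx (a, j)) + 1))) := by
  obtain ⟨hI, hs, o, d, hM, hauc⟩ := h
  exact ⟨hI.congr (by simp) (by simp), hs.congr (by simp), _, _, hM.update _ _,
    hauc.update ((tr_bidE hI hs hM x y z k a j).1 hb)⟩

theorem priceSum_lt_priceSum_update (M : Mem) (v : ℕ → ℕ) (s : A × Bool) :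
    priceSum A M < priceSum A (Function.update (Function.update M 5 v) 6
      (Function.update (M 6) (slotIx s) (M 6 (slotIx s) + 1))) := by
  classical
  refine Finset.sum_lt_sum (fun s' _ => ?_) ⟨s, Finset.mem_univ _, by simp⟩
  obtain rfl | hs := eq_or_ne s' s
  · simp
  · simp [hs, slotIx_injective.eq_iff]

theorem AuctionInv.priceSum_le (h : AuctionInv G A M) :
    priceSum A M ≤ 2 * n * (n + n + 1) := by
  classical
  obtain ⟨-, -, o, d, hM, ha⟩ := h
  have hA : Fintype.card A ≤ n := by simpa using set_fintype_card_le_univ A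
  have hsum := ha.sum_le
  rw [Fintype.card_prod, Fintype.card_bool] at hsum
  simp only [priceSum, hM.price]
  exact hsum.trans (Nat.mul_le_mul_right _ (by omega))

theorem advances_auctionSweep : Advances n 2 (AuctionInv G A)
    (fun M => ∀ l, InBounds n l [(1, 0), (1, 0), (1, 0), (0, 2), (1, 0), (0, 2)] → ¬ BidAt n A l M)
    (priceSum A) 1 auctionSweep := by
  refine advances_nest (fun env l henv hl M hM => ?_) (fun env l henv _ M hM hb => ?_) <;>
    obtain ⟨i, i', rfl⟩ := List.length_eq_two.1 henv
  · exact hM.input.tr_bid_iff_bidAt i i' hl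
  · obtain ⟨x, y, z, k, a, j, rfl, hb⟩ := hb
    rw [exec_enterBidCmd]
    exact ⟨hM.update hb, priceSum_lt_priceSum_update _ _ _⟩

theorem exec_auctionCmd (hI : HoldsInput G A M) (hs : HoldsClasses G A M) (h5 : ∀ k, M 5 k = 0)
    (h6 : ∀ k, M 6 k = 0) :
    ∃ o d, (∀ s, auctionCmd.exec n M [] 5 (slotIx s) = (o s).elim 0 code) ∧
      Auction (n + n) (tokens (nbrs G A)) (Fits (nbrs G A)) o d ∧
      ∀ u s, ¬ Bid (n + n) (tokens (nbrs G A)) (Fits (nbrs G A)) o d u s := by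
  have hM : AuctionInv G A M := ⟨hI, hs, fun _ => none, fun _ => 0,
    ⟨fun s => by simp [h5], fun s => by simp [h6]⟩,
    ⟨by simp, by simp, by simp, by simp, by simp⟩⟩
  obtain ⟨hM', -, hstuck⟩ :=
    ((advances_auctionSweep (G := G) (A := A)).loop 2 1).loop 2 1 M [] rfl hM
  replace hstuck := hstuck.resolve_right fun hle => by
    have := hM'.priceSum_le
    nlinarith
  obtain ⟨hI', hs', o, d, hod, hauc⟩ := hM'
  refine ⟨o, d, hod.owner, hauc, ?_⟩
  rintro ⟨x, y, z, k⟩ ⟨a, j⟩ hb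
  refine hstuck [ix x, ix y, ix z, k.toNat, ix a, j.toNat] ?_
    ⟨x, y, z, k, a, j, rfl, (tr_bidE hI' hs' hod x y z k a j).2 hb⟩
  simp [ix_lt_size, Bool.toNat_le]

end

/-! ### The output as expressions -/

/-- The vertex given by the last argument has a slot of the token given by the first four. -/
def ownE : Exp :=
  .sum 0 2 (.eq (.read 5 (slotE (var 4) (var 5))) (.app codeE [var 0, var 1, var 2, var 3]))

/-- `posOf o (x, y, z, k)`, for the arguments `x`, `y`, `z`, `k`. -/
def posE : Exp := .ite (.exA 4 ownE) (.theA 4 ownE) (var 2)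

/-- `HasFree N pos x y z`, for the arguments `x`, `y`, `z`. -/
def hasFreeE : Exp :=
  .exA 3 <| .and (.app tokenE [var 0, var 1, var 3, .const 1])
    (sameE (var 0) (var 1) (var 2) (.app posE [var 0, var 1, var 3, .const 1]))

/-- `classRank N pos x y z`, for the arguments `x`, `y`, `z`. -/
def classRankE : Exp :=
  .countA 3 <| .and (.app repE [var 0, var 1, var 3]) <|
  .lexLt (.ite (.app hasFreeE [var 0, var 1, var 3]) (.const 0) (.const 1)) (var 3)
    (.ite (.app hasFreeE [var 0, var 1, var 2]) (.const 0) (.const 1)) (var 2)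

/-- `repOf N (N x ∩ N y) a`, for the arguments `x`, `y`, `a`. -/
def repOfE : Exp :=
  .theA 3 <| .and (sameE (var 0) (var 1) (var 3) (var 2)) <| .not <| .exA 4 <|
  .and (sameE (var 0) (var 1) (var 3) (var 4)) (.lt (var 4) (var 3))

/-- The first component of `freeKey N pos x y z`, for the arguments `x`, `y`, `z`. -/
def posRankE : Exp :=
  .app classRankE [var 0, var 1,
    .app repOfE [var 0, var 1, .app posE [var 0, var 1, var 2, .const 1]]]

/-- `freeRank N pos x y z`, for the arguments `x`, `y`, `z`. -/
def freeRankE : Exp :=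
  .countA 3 <| .and (.app tokenE [var 0, var 1, var 3, .const 1]) <|
  .lexLt (.app posRankE [var 0, var 1, var 3]) (var 3)
    (.app posRankE [var 0, var 1, var 2]) (var 2)

/-- `edgeNo N pos x y z k`, for the arguments `x`, `y`, `z`, `k`. -/
def edgeNoE : Exp :=
  .ite (var 3) (.add (.app freeRankE [var 0, var 1, var 2]) (.const 2)) <|
  .ite (.app classRankE [var 0, var 1, var 2]) (.app classRankE [var 0, var 1, var 2]) (.const 1)

/-- `IsUpper N pos x y z k`, for the arguments `x`, `y`, `z`, `k`. -/
def isUpperE : Exp := .or (var 3) (.not (.app classRankE [var 0, var 1, var 2]))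

/-- Adjacency in `joinGraph N pos`. -/
def joinE : Exp :=
  .and (.not (.eq (var 0) (var 1))) <| .exA 2 <| .exA 3 <| .exA 4 <| .sum 0 2 <| .exA 6 <|
  .sum 0 2 <|
  .and (.app tokenE [var 2, var 3, var 4, var 5]) <|
  .and (.app tokenE [var 2, var 3, var 6, var 7]) <|
  .and (.eq (.app posE [var 2, var 3, var 4, var 5]) (var 0)) <|
  .and (.eq (.app posE [var 2, var 3, var 6, var 7]) (var 1)) <|
  .and (.eq (.app edgeNoE [var 2, var 3, var 4, var 5])
    (.app edgeNoE [var 2, var 3, var 6, var 7])) <|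
  .or (.and (.app isUpperE [var 2, var 3, var 4, var 5])
      (.not (.app isUpperE [var 2, var 3, var 6, var 7])))
    (.and (.not (.app isUpperE [var 2, var 3, var 4, var 5]))
      (.app isUpperE [var 2, var 3, var 6, var 7]))

/-- Adjacency of `a` and `b` in the tree without the edges at `x`, for the arguments `x`, `y`, `a`,
`b`. The second argument is there because `closureCmd` passes two parameters. -/
def avoidE : Exp :=
  .and (.read 1 (var 2)) <| .and (.read 1 (var 3)) <| .and (.app joinE [var 2, var 3]) <|
  .and (.not (.eq (var 0) (var 2))) (.not (.eq (var 0) (var 3)))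

/-- A vertex has degree at most `1` in the tree. -/
def leafE : Exp := .lt (.countA 1 (.app joinE [var 0, var 1])) (.const 2)

/-- The root: the least vertex of degree at most `1`. -/
def rootE : Exp :=
  .theA 0 <| .and leafE <| .not <| .exA 1 <| .and (.app leafE [var 1]) (.lt (var 1) (var 0))

/-- `Dom T r a x`, for the arguments `a`, `x`. The connectivity of the tree without the edges at a
vertex is tabulated in array `8`. -/
def domE : Exp :=
  .or (.eq (var 0) (var 1)) (.not (.read 8 (.idx4 (var 0) (var 0) (.app rootE []) (var 1))))

/-- `domSize T r a`, for the argument `a`. -/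
def domSizeE : Exp := .countA 1 domE

/-- `height T r a ≤ height T r b`, for the arguments `a`, `b`. -/
def heightLeE : Exp :=
  .not (.lexLt (.app domSizeE [var 1]) (var 1) (.app domSizeE [var 0]) (var 0))

/-- The cardinality in the definition of `orderKey`. -/
def belowE : Exp :=
  .countA 1 <| .exA 2 <| .and
    (.or (.eq (var 0) (var 2)) (.and (.not (.read 1 (var 0))) (.adj (var 2) (var 0))))
    (.app heightLeE [var 1, var 2])

/-- `orderKey G A T r v`, for the argument `v`. -/
def keyE : Exp := .add (.add belowE belowE) (.ite (.read 1 (var 0)) (.const 0) (.const 1))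

/-- `position G A T r v`, for the argument `v`. -/
def positionE : Exp :=
  .count <| .lexLt (.app keyE [var 1]) (var 1) (.app keyE [var 0]) (var 0)

/-- `IsBottom T r a`, for the argument `a`. -/
def bottomE : Exp := .not <| .exA 1 <| .and domE (.not (.eq (var 1) (var 0)))

/-- `classOf A T r v`, for the argument `v`. -/
def classE : Exp :=
  .ite (.read 1 (var 0)) (.add (.const 1) <| .countA 1 <| .and (.app bottomE [var 1]) <|
    .not <| .exA 2 <| .and (.and (.app bottomE [var 2]) (.app domE [var 0, var 2]))
      (.not (.lt (var 1) (var 2)))) (.const 0)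

section

variable {n : ℕ} {G : SimpleGraph (Fin n)} {A : Set (Fin n)} {M : Mem}
  {o : A × Bool → Option (A × A × A × Bool)}

/-- The memory holds the input, the relations `SameClass` and, in array `5`, a placement of the
tokens in the slots. -/
structure HoldsSlots (G : SimpleGraph (Fin n)) (A : Set (Fin n)) (M : Mem)
    (o : A × Bool → Option (A × A × A × Bool)) : Prop where
  input : HoldsInput G A M
  classes : HoldsClasses G A M
  owner : ∀ s, M 5 (slotIx s) = (o s).elim 0 code
  inj : ∀ s s' u, o s = some u → o s' = some u → s = s'

theorem tr_ownE (h : HoldsSlots G A M o) (x y z : A) (k : Bool) (a : A) :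
    Tr n M ownE [ix x, ix y, ix z, k.toNat, ix a] ↔ ∃ j, o (a, j) = some (x, y, z, k) := by
  have howner : ∀ j : Bool, M 5 (ix a + ix a + j.toNat) = (o (a, j)).elim 0 code :=
    fun j => h.owner (a, j)
  simp only [ownE, tr_exBool, tr_eq, eval_read, eval_slotE, eval_app, List.map_cons, List.map_nil,
    List.cons_append, List.nil_append, eval_var, List.getD_cons_zero, List.getD_cons_succ,
    eval_codeE, howner, elim_code_eq_iff]

theorem eval_posE (h : HoldsSlots G A M o) (x y z : A) (k : Bool) :
    posE.eval n M [ix x, ix y, ix z, k.toNat] = ix (posOf o (x, y, z, k)) := by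
  have hex : Tr n M (.exA 4 ownE) [ix x, ix y, ix z, k.toNat] ↔
      ∃ s, o s = some (x, y, z, k) := by
    rw [h.input.tr_exA (env := [ix x, ix y, ix z, k.toNat]) (i := 4) rfl]
    simp only [List.cons_append, List.nil_append, tr_ownE h, Prod.exists]
  rw [posE, eval_ite, posOf]
  by_cases hs : ∃ s, o s = some (x, y, z, k)
  · rw [if_pos (hex.2 hs), dif_pos hs]
    refine h.input.eval_theA rfl hs.choose.1 fun b => ?_
    simp only [List.cons_append, List.nil_append, tr_ownE h]
    refine ⟨fun ⟨j, hj⟩ => ?_, fun hb => ⟨hs.choose.2, hb ▸ hs.choose_spec⟩⟩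
    rw [h.inj _ _ _ hs.choose_spec hj]
  · rw [if_neg (mt hex.1 hs), dif_neg hs]
    rfl

theorem tr_tokenE_one (h : HoldsSlots G A M o) (x y z : A) :
    Tr n M tokenE [ix x, ix y, ix z, 1] ↔ IsToken (nbrs G A) x y z true :=
  tr_tokenE h.input h.classes x y z true

theorem eval_posE_one (h : HoldsSlots G A M o) (x y z : A) :
    posE.eval n M [ix x, ix y, ix z, 1] = ix (posOf o (x, y, z, true)) := eval_posE h x y z true

theorem tr_hasFreeE (h : HoldsSlots G A M o) (x y z : A) :
    Tr n M hasFreeE [ix x, ix y, ix z] ↔ HasFree (nbrs G A) (posOf o) x y z := by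
  rw [hasFreeE, h.input.tr_exA (env := [ix x, ix y, ix z]) (i := 3) rfl]
  simp only [tr_and, tr_app, sameE, tr_read, eval_idx4, eval_app, List.map_cons, List.map_nil,
    List.cons_append, List.nil_append, eval_var, List.getD_cons_zero, List.getD_cons_succ,
    eval_const, tr_tokenE_one h, eval_posE_one h, h.classes _ _ _ _, HasFree]

variable [Fintype A]

theorem eval_classRankE (h : HoldsSlots G A M o) (x y z : A) :
    classRankE.eval n M [ix x, ix y, ix z] = classRank (nbrs G A) (posOf o) x y z := by
  classical
  rw [classRankE, h.input.eval_countA (env := [ix x, ix y, ix z]) (i := 3) rfl, classRank,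
    rankIn, reps, Finset.filter_filter]
  congr 1
  ext w
  simp only [tr_and, tr_lexLt, eval_ite, tr_app, List.map_cons, List.map_nil, eval_const,
    List.cons_append, List.nil_append, eval_var, List.getD_cons_zero, List.getD_cons_succ,
    tr_repE h.input h.classes, tr_hasFreeE h, ix_lt, Finset.mem_filter_univ, classKey,
    Prod.Lex.toLex_lt_toLex]

theorem tr_classRankE (h : HoldsSlots G A M o) (x y z : A) :
    Tr n M classRankE [ix x, ix y, ix z] ↔ classRank (nbrs G A) (posOf o) x y z ≠ 0 := by
  rw [Tr, eval_classRankE h]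

theorem eval_repOfE (h : HoldsSlots G A M o) (x y a : A) :
    repOfE.eval n M [ix x, ix y, ix a] = ix (repOf (nbrs G A) (nbrs G A x ∩ nbrs G A y) a) := by
  refine h.input.eval_theA rfl _ fun b => ?_
  simp only [tr_and, tr_not, sameE, tr_read, eval_idx4, List.cons_append, List.nil_append,
    eval_var, List.getD_cons_zero, List.getD_cons_succ, h.classes _ _ _ _,
    h.input.tr_exA (env := [ix x, ix y, ix a, ix b]) (i := 4) rfl, tr_lt, ix_lt, not_exists,
    not_and, not_lt]
  constructor
  · rintro ⟨hba, hmin⟩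
    exact le_antisymm (hmin _ (hba.trans (sameClass_repOf _ a))) (repOf_le hba.symm)
  · rintro rfl
    exact ⟨(sameClass_repOf _ a).symm, fun w hw => repOf_le ((sameClass_repOf _ a).trans hw)⟩

theorem eval_posRankE (h : HoldsSlots G A M o) (x y w : A) :
    posRankE.eval n M [ix x, ix y, ix w] = classRank (nbrs G A) (posOf o) x y
      (repOf (nbrs G A) (nbrs G A x ∩ nbrs G A y) (posOf o (x, y, w, true))) := by
  simp only [posRankE, eval_app, List.map_cons, List.map_nil, eval_var, List.getD_cons_zero,
    List.getD_cons_succ, eval_const, eval_posE_one h, eval_repOfE h, eval_classRankE h]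

theorem eval_freeRankE (h : HoldsSlots G A M o) (x y z : A) :
    freeRankE.eval n M [ix x, ix y, ix z] = freeRank (nbrs G A) (posOf o) x y z := by
  classical
  rw [freeRankE, h.input.eval_countA (env := [ix x, ix y, ix z]) (i := 3) rfl, freeRank,
    rankIn, frees, Finset.filter_filter]
  congr 1
  ext w
  simp only [tr_and, tr_lexLt, tr_app, eval_app, List.map_cons, List.map_nil,
    List.cons_append, List.nil_append, eval_var, List.getD_cons_zero, List.getD_cons_succ,
    eval_const, tr_tokenE_one h, eval_posRankE h, ix_lt, Finset.mem_filter_univ, freeKey,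
    Prod.Lex.toLex_lt_toLex]

theorem eval_edgeNoE (h : HoldsSlots G A M o) (x y z : A) (k : Bool) :
    edgeNoE.eval n M [ix x, ix y, ix z, k.toNat] = edgeNo (nbrs G A) (posOf o) x y z k := by
  simp only [edgeNoE, eval_ite, tr_var, tr_app, tr_classRankE h, eval_app, eval_add,
    List.map_cons, List.map_nil, eval_var, List.getD_cons_zero, List.getD_cons_succ, eval_const,
    eval_classRankE h, eval_freeRankE h, edgeNo]
  cases k
  · simp only [Bool.toNat_false, ne_eq, not_true_eq_false, if_false, Bool.false_eq_true]
    split_ifs <;> omega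
  · simp

theorem tr_isUpperE (h : HoldsSlots G A M o) (x y z : A) (k : Bool) :
    Tr n M isUpperE [ix x, ix y, ix z, k.toNat] ↔ IsUpper (nbrs G A) (posOf o) x y z k := by
  simp only [isUpperE, tr_or, tr_not, tr_var, tr_app, List.map_cons, List.map_nil,
    eval_var, List.getD_cons_zero, List.getD_cons_succ, tr_classRankE h, IsUpper]
  cases k <;> simp

theorem tr_joinE (h : HoldsSlots G A M o) (p q : A) :
    Tr n M joinE [ix p, ix q] ↔ (joinGraph (nbrs G A) (posOf o)).Adj p q := by
  simp only [joinE, tr_and, tr_not, tr_eq, eval_var, List.getD_cons_zero, List.getD_cons_succ,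
    ix_inj, h.input.tr_exA (env := [ix p, ix q]) (i := 2) rfl, List.cons_append, List.nil_append]
  simp only [h.input.tr_exA (env := [ix p, ix q, _]) (i := 3) rfl, List.cons_append,
    List.nil_append]
  simp only [h.input.tr_exA (env := [ix p, ix q, _, _]) (i := 4) rfl, List.cons_append,
    List.nil_append, tr_exBool]
  simp only [h.input.tr_exA (env := [ix p, ix q, _, _, _, _]) (i := 6) rfl, List.cons_append,
    List.nil_append, tr_exBool, tr_and, tr_or, tr_not, tr_app, tr_eq, eval_app, List.map_cons,
    List.map_nil, eval_var, List.getD_cons_zero, List.getD_cons_succ, eval_posE h, eval_edgeNoE h,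
    tr_isUpperE h, tr_tokenE h.input h.classes, ix_inj]
  have iff_not : ∀ P Q : Prop, (P ∧ ¬ Q ∨ ¬ P ∧ Q) ↔ (P ↔ ¬ Q) := fun P Q => by tauto
  simp only [iff_not]
  rfl

theorem tr_avoidE_ix (h : HoldsSlots G A M o) (x y a b : A) :
    Tr n M avoidE [ix x, ix y, ix a, ix b] ↔
      ((joinGraph (nbrs G A) (posOf o)).deleteIncidenceSet x).Adj a b := by
  have ha : M 1 (ix a) ≠ 0 := (h.input.mem a).2 a.2
  have hb : M 1 (ix b) ≠ 0 := (h.input.mem b).2 b.2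
  simp only [avoidE, tr_and, tr_read, eval_var, List.getD_cons_zero, List.getD_cons_succ, ha, hb,
    true_and, tr_not, tr_eq, ix_inj, tr_app, List.map_cons, List.map_nil, tr_joinE h,
    SimpleGraph.deleteIncidenceSet_adj, ne_eq, not_false_eq_true, eq_comm]

theorem tr_avoidE (h : HoldsSlots G A M o) (x y : A) (s t : Fin n) :
    Tr n M avoidE [ix x, ix y, s, t] ↔
      (((joinGraph (nbrs G A) (posOf o)).deleteIncidenceSet x).map
        (Function.Embedding.subtype _)).Adj s t := by
  rw [SimpleGraph.map_adj]
  constructor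
  · intro hst
    obtain ⟨hs, ht⟩ : M 1 s ≠ 0 ∧ M 1 t ≠ 0 := by
      simp only [avoidE, tr_and, tr_read, eval_var, List.getD_cons_zero, List.getD_cons_succ] at hst
      exact ⟨hst.1, hst.2.1⟩
    exact ⟨⟨s, (h.input.mem s).1 hs⟩, ⟨t, (h.input.mem t).1 ht⟩,
      (tr_avoidE_ix h x y _ _).1 hst, rfl, rfl⟩
  · rintro ⟨a, b, hab, rfl, rfl⟩
    exact (tr_avoidE_ix h x y a b).2 hab

open Classical in
/-- In addition, the memory holds in array `8` the connectivity of the trees obtained by removing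
the edges at a vertex. The tree is rooted at `r`. -/
structure HoldsTree (G : SimpleGraph (Fin n)) (A : Set (Fin n)) [Fintype A] (M : Mem)
    (o : A × Bool → Option (A × A × A × Bool)) (r : A) : Prop extends HoldsSlots G A M o where
  reach : ∀ x y a b : A, M 8 (quad n (ix x) (ix y) (ix a) (ix b)) ≠ 0 ↔
    ((joinGraph (nbrs G A) (posOf o)).deleteIncidenceSet x).Reachable a b
  leaf : (joinGraph (nbrs G A) (posOf o)).degree r ≤ 1
  first : ∀ b, (joinGraph (nbrs G A) (posOf o)).degree b ≤ 1 → r ≤ b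

variable {r : A}

open Classical in
theorem tr_leafE (h : HoldsSlots G A M o) (a : A) :
    Tr n M leafE [ix a] ↔ (joinGraph (nbrs G A) (posOf o)).degree a ≤ 1 := by
  rw [leafE, tr_lt, h.input.eval_countA (env := [ix a]) (i := 1) rfl, eval_const, Nat.lt_succ_iff,
    ← SimpleGraph.card_neighborFinset_eq_degree]
  simp only [tr_app, List.cons_append, List.nil_append, List.map_cons, List.map_nil, eval_var,
    List.getD_cons_zero, List.getD_cons_succ, tr_joinE h]
  rw [SimpleGraph.neighborFinset_eq_filter]

theorem eval_rootE (h : HoldsTree G A M o r) : rootE.eval n M [] = ix r := by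
  refine h.input.eval_theA rfl _ fun b => ?_
  simp only [tr_and, tr_not, tr_app, List.cons_append, List.nil_append, List.map_cons,
    List.map_nil, eval_var, List.getD_cons_zero, List.getD_cons_succ, tr_leafE h.toHoldsSlots,
    h.input.tr_exA (env := [ix b]) (i := 1) rfl, tr_lt, ix_lt, not_exists, not_and, not_lt]
  constructor
  · rintro ⟨hleaf, hmin⟩
    exact le_antisymm (hmin _ h.leaf) (h.first _ hleaf)
  · rintro rfl
    exact ⟨h.leaf, h.first⟩

theorem tr_domE (h : HoldsTree G A M o r) (a x : A) :
    Tr n M domE [ix a, ix x] ↔ Dom (joinGraph (nbrs G A) (posOf o)) r a x := by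
  rw [dom_iff_not_reachable_deleteIncidenceSet]
  simp only [domE, tr_or, tr_eq, tr_not, tr_read, eval_idx4, eval_app, List.map_nil, eval_rootE h,
    eval_var, List.getD_cons_zero, List.getD_cons_succ, ix_inj]
  rw [h.reach]

theorem eval_domSizeE (h : HoldsTree G A M o r) (a : A) :
    domSizeE.eval n M [ix a] = domSize (joinGraph (nbrs G A) (posOf o)) r a := by
  rw [domSizeE, h.input.eval_countA (env := [ix a]) (i := 1) rfl, domSize]
  congr 1
  ext x
  simp only [List.cons_append, List.nil_append, tr_domE h, Finset.mem_filter_univ]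

theorem tr_heightLeE (h : HoldsTree G A M o r) (a b : A) :
    Tr n M heightLeE [ix a, ix b] ↔ height (joinGraph (nbrs G A) (posOf o)) r a ≤
      height (joinGraph (nbrs G A) (posOf o)) r b := by
  simp only [heightLeE, tr_not, tr_lexLt, eval_app, List.map_cons, List.map_nil, eval_var,
    List.getD_cons_zero, List.getD_cons_succ, eval_domSizeE h, ix_lt, ← not_lt, height,
    Prod.Lex.toLex_lt_toLex]

open Classical in
theorem eval_belowE (h : HoldsTree G A M o r) (v : Fin n) :
    belowE.eval n M [(v : ℕ)] = (Finset.univ.filter fun a : A => ∃ b ∈ anchors G A v,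
      height (joinGraph (nbrs G A) (posOf o)) r a ≤
        height (joinGraph (nbrs G A) (posOf o)) r b).card := by
  rw [belowE, h.input.eval_countA (env := [(v : ℕ)]) (i := 1) rfl]
  congr 1
  ext a
  have hadj : ∀ b : A, Tr n M (.adj (var 2) (var 0)) [(v : ℕ), ix a, ix b] ↔ G.Adj v b :=
    fun b => (h.input.tr_adj rfl rfl).trans (G.adj_comm _ _)
  have heq : ∀ b : A, (v : ℕ) = ix b ↔ v = b := fun b => Fin.val_inj
  have hanchors : ∀ b : A, (v = b ∨ v ∉ A ∧ G.Adj v b) ↔ b ∈ anchors G A v := fun b => Iff.rfl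
  simp only [List.cons_append, List.nil_append,
    h.input.tr_exA (env := [(v : ℕ), ix a]) (i := 2) rfl, tr_and, tr_or, tr_not, tr_eq,
    tr_read, tr_app, List.map_cons, List.map_nil, eval_var, List.getD_cons_zero,
    List.getD_cons_succ, tr_heightLeE h, hadj, heq, h.input.mem, hanchors, Finset.mem_filter_univ]

theorem eval_keyE (h : HoldsTree G A M o r) (v : Fin n) :
    keyE.eval n M [(v : ℕ)] = orderKey G A (joinGraph (nbrs G A) (posOf o)) r v := by
  classical
  simp only [keyE, eval_add, eval_belowE h, eval_ite, tr_read, eval_var, List.getD_cons_zero,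
    h.input.mem, eval_const, orderKey, two_mul]

theorem eval_positionE (h : HoldsTree G A M o r) (v : Fin n) :
    positionE.eval n M [(v : ℕ)] = position G A (joinGraph (nbrs G A) (posOf o)) r v := by
  rw [positionE, eval_count, position, rankIn]
  simp only [List.cons_append, List.nil_append, tr_lexLt, eval_app, List.map_cons, List.map_nil,
    eval_var, List.getD_cons_zero, List.getD_cons_succ, eval_keyE h, Fin.val_fin_lt,
    Prod.Lex.toLex_lt_toLex]

theorem tr_bottomE (h : HoldsTree G A M o r) (a : A) :
    Tr n M bottomE [ix a] ↔ IsBottom (joinGraph (nbrs G A) (posOf o)) r a := by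
  simp only [bottomE, tr_not, h.input.tr_exA (env := [ix a]) (i := 1) rfl, List.cons_append,
    List.nil_append, tr_and, tr_domE h, tr_eq, eval_var, List.getD_cons_zero, List.getD_cons_succ,
    ix_inj, not_exists, not_and, not_not, IsBottom]

theorem eval_classE (h : HoldsTree G A M o r) (v : Fin n) :
    classE.eval n M [(v : ℕ)] = classOf A (joinGraph (nbrs G A) (posOf o)) r v := by
  classical
  simp only [classE, eval_ite, tr_read, eval_var, List.getD_cons_zero, h.input.mem, classOf,
    eval_const, eval_add, h.input.eval_countA (env := [(v : ℕ)]) (i := 1) rfl]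
  by_cases hv : v ∈ A
  · have hix : (v : ℕ) = ix (⟨v, hv⟩ : A) := rfl
    rw [if_pos hv, dif_pos hv, hix, chainOf]
    congr 2
    ext l
    simp only [List.cons_append, List.nil_append, tr_and, tr_not, tr_lt, tr_app, List.map_cons,
      List.map_nil, eval_var, List.getD_cons_zero, List.getD_cons_succ, tr_bottomE h, tr_domE h,
      h.input.tr_exA (env := [ix (⟨v, hv⟩ : A), ix l]) (i := 2) rfl, ix_lt, not_exists, not_and,
      not_not, and_imp, Finset.mem_filter_univ]
  · rw [if_neg hv, dif_neg hv]

end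

end RAM

/-! ### Leaves -/

section Leaves

variable {α : Type*} {T : SimpleGraph α} {ℓ t Δ : ℕ}

/-- An `ℓ`-leaf tree: a tree with at most `ℓ` leaves, that is, vertices of degree at most `1`. The
vertex of a tree with one vertex is thus a leaf. -/
structure IsLeafTree (ℓ : ℕ) (T : SimpleGraph α) : Prop where
  isTree : T.IsTree
  leaves_le : {a | (T.neighborSet a).encard ≤ 1}.encard ≤ ℓ

variable [Fintype α]

open Classical in
theorem encard_neighborSet_eq_degree (a : α) : (T.neighborSet a).encard = T.degree a := by
  rw [← T.card_neighborFinset_eq_degree, ← Set.encard_coe_eq_coe_finsetCard,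
    SimpleGraph.coe_neighborFinset]

open Classical in
theorem encard_leaves_eq : {a | (T.neighborSet a).encard ≤ 1}.encard =
    (Finset.univ.filter fun a => T.degree a ≤ 1).card := by
  simp only [encard_neighborSet_eq_degree, ← Set.encard_coe_eq_coe_finsetCard, Finset.coe_filter,
    Finset.mem_univ, true_and, Nat.cast_le_one]

open Classical in
theorem IsLeafTree.two_add_sum_degree_le (h : IsLeafTree ℓ T) (hℓ : 2 ≤ ℓ) :
    2 + ∑ a, (T.degree a - 2) ≤ ℓ := by
  rcases subsingleton_or_nontrivial α with _ | _
  · simpa using hℓ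
  · have hleaves := h.leaves_le
    rw [encard_leaves_eq, Nat.cast_le, ← sum_degree_sub_two_add_two h.isTree] at hleaves
    omega

open Classical in
theorem IsTDeltaTree.sum_degree_le (h : IsTDeltaTree t Δ T) :
    ∑ a, (T.degree a - 2) ≤ t * (Δ - 2) := by
  have hdeg : ∀ a, T.degree a ≤ Δ := fun a => by
    exact_mod_cast encard_neighborSet_eq_degree (T := T) a ▸ h.degree_le a
  have hbranching : (Finset.univ.filter fun a => 3 ≤ T.degree a).card ≤ t := by
    have hle := h.branching_le
    simp only [encard_neighborSet_eq_degree, Nat.ofNat_le_cast] at hle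
    rw [← Nat.cast_le (α := ℕ∞), ← Set.encard_coe_eq_coe_finsetCard]
    simpa using hle
  calc ∑ a, (T.degree a - 2) = ∑ a with 3 ≤ T.degree a, (T.degree a - 2) :=
        (Finset.sum_filter_of_ne fun a _ ha => by omega).symm
    _ ≤ (Finset.univ.filter fun a => 3 ≤ T.degree a).card • (Δ - 2) :=
        Finset.sum_le_card_nsmul _ _ _ fun a _ => Nat.sub_le_sub_right (hdeg a) 2
    _ ≤ t * (Δ - 2) := Nat.mul_le_mul_right _ hbranching

open Classical in
theorem exists_least_degree_le_one [LinearOrder α] (hT : T.IsTree) :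
    ∃ r, T.degree r ≤ 1 ∧ ∀ b, T.degree b ≤ 1 → r ≤ b := by
  obtain ⟨a, ha⟩ := exists_degree_le_one hT
  obtain ⟨r, hr, hmin⟩ := Finset.exists_min_image (Finset.univ.filter fun a => T.degree a ≤ 1) id
    ⟨a, by simpa using ha⟩
  exact ⟨r, by simpa using hr, fun b hb => hmin b (by simpa using hb)⟩

omit [Fintype α] in
theorem IsTDeltaTree.isLeafTree [Finite α] (h : IsTDeltaTree t Δ T) :
    IsLeafTree (2 + t * (Δ - 2)) T := by
  classical
  have := Fintype.ofFinite α
  refine ⟨h.isTree, ?_⟩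
  rw [encard_leaves_eq, Nat.cast_le]
  rcases subsingleton_or_nontrivial α with _ | _
  · exact (Finset.card_le_one_of_subsingleton _).trans (by omega)
  · rw [← sum_degree_sub_two_add_two h.isTree, add_comm 2]
    exact Nat.add_le_add_right h.sum_degree_le 2

end Leaves

section Convex

universe u

variable {V : Type u} {G : SimpleGraph V} {A B : Set V} {ℓ : ℕ}

theorem IsHConvex.mono {ℋ ℋ' : {W : Type u} → SimpleGraph W → Prop} (h : IsHConvex ℋ G A B)
    (hle : ∀ H : SimpleGraph A, ℋ H → ℋ' H) : IsHConvex ℋ' G A B :=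
  ⟨h.bipartite, h.cover, h.support.imp fun H hH => ⟨hle H hH.1, hH.2⟩⟩

theorem IsTDeltaTreeConvex.isLeafTreeConvex [Finite V] {t Δ : ℕ}
    (h : IsTDeltaTreeConvex t Δ G A B) :
    IsHConvex (fun H => IsLeafTree (2 + t * (Δ - 2)) H) G A B :=
  h.mono fun _ hH => hH.isLeafTree

theorem thinness_le_of_isLeafTree [Finite V] (hℓ : 2 ≤ ℓ)
    (h : IsHConvex (fun H => IsLeafTree ℓ H) G A B) : thinness G ≤ ℓ := by
  classical
  have := Fintype.ofFinite V
  let : LinearOrder V := LinearOrder.lift' _ (Fintype.equivFin V).injective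
  obtain ⟨T, hT, hsupp⟩ := h.support
  obtain ⟨r, hr⟩ := exists_degree_le_one hT.isTree
  obtain ⟨v, c, hvc, -⟩ := exists_isConsistent h.bipartite h.cover hT.isTree hsupp
    Nat.card_eq_fintype_card.symm
    fun v => (classOf_lt hT.isTree hr v).trans_le (hT.two_add_sum_degree_le hℓ)
  exact Nat.sInf_le ⟨v, c, hvc⟩

end Convex

/-! ### The algorithm -/

namespace RAM

open Exp (var)

/-- Find an optimal placement of the tokens. -/
def placeCmd : Cmd := .seq (closureCmd 4 classAdjE) auctionCmd

/-- Find an optimal placement of the tokens and tabulate the connectivity of its join graph. -/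
def treeCmd : Cmd := .seq placeCmd (closureCmd 8 avoidE)

/-- Write down the order and the classes given by the join graph. -/
def outputCmd : Cmd :=
  .seq (.loop 1 0 (.store 2 positionE (var 0))) (.loop 1 0 (.store 3 (var 0) classE))

theorem not_writes_closureCmd {a arr : ℕ} (h : a ≠ arr) (e : Exp) :
    ¬ (closureCmd arr e).Writes a := by
  simp [closureCmd, closureSweep, markStep, Cmd.nest, Cmd.Writes, h.symm]

theorem not_writes_auctionCmd {a : ℕ} (h5 : a ≠ 5) (h6 : a ≠ 6) : ¬ auctionCmd.Writes a := by
  simp [auctionCmd, auctionSweep, enterBidCmd, Cmd.nest, Cmd.Writes, h5.symm, h6.symm]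

theorem exec_loop_store {n arr : ℕ} {e f : Exp} {M₀ : Mem} {i v : Fin n → ℕ}
    (hi : Function.Injective i)
    (h : ∀ M, (∀ a ≠ arr, M a = M₀ a) → ∀ x : Fin n,
      e.eval n M [(x : ℕ)] = i x ∧ f.eval n M [(x : ℕ)] = v x) (x : Fin n) :
    (Cmd.loop 1 0 (.store arr e f)).exec n M₀ [] arr (i x) = v x := by
  have hinv := exec_loop_induction (n := n) (k := 1) (c := 0) (C := .store arr e f) (M := M₀)
    (env := []) (fun j M => (∀ a ≠ arr, M a = M₀ a) ∧ ∀ x : Fin n, (x : ℕ) < j → M arr (i x) = v x)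
    ⟨fun _ _ => rfl, by simp⟩ ?_
  · exact hinv.2 x (by omega)
  · rintro j hj M ⟨hframe, hdone⟩
    obtain ⟨he, hf⟩ := h M hframe ⟨j, by omega⟩
    simp only [Cmd.exec, List.nil_append, he, hf]
    refine ⟨fun a ha => by simp [ha, hframe a ha], fun x hx => ?_⟩
    by_cases hxj : x = ⟨j, by omega⟩
    · simp [hxj]
    · have : (x : ℕ) ≠ j := fun h' => hxj (Fin.ext h')
      simp [hi.eq_iff, hxj, hdone x (by omega)]

theorem HoldsSlots.congr {n : ℕ} {G : SimpleGraph (Fin n)} {A : Set (Fin n)} {M M' : Mem}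
    {o : A × Bool → Option (A × A × A × Bool)} (h : HoldsSlots G A M o)
    (hM : ∀ a < 6, a ≠ 2 → a ≠ 3 → M' a = M a) : HoldsSlots G A M' o where
  input := h.input.congr (hM 0 (by simp) (by simp) (by simp)) (hM 1 (by simp) (by simp) (by simp))
  classes := h.classes.congr (hM 4 (by simp) (by simp) (by simp))
  owner := by
    rw [hM 5 (by simp) (by simp) (by simp)]
    exact h.owner
  inj := h.inj

section

variable {n : ℕ} {G : SimpleGraph (Fin n)} {A B : Set (Fin n)}

theorem inputState_arr_eq_zero {a : ℕ} (ha : 2 ≤ a) (k : ℕ) : (inputState G A).arr a k = 0 := by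
  have h0 : a ≠ 0 := by omega
  have h1 : a ≠ 1 := by omega
  simp [inputState, h0, h1]

theorem holdsInput_inputState : HoldsInput G A (inputState G A).arr where
  adj i j := by
    have : (∃ i' j' : Fin n, G.Adj i' j' ∧ (i : ℕ) * n + j = i' * n + j') ↔ G.Adj i j := by
      refine ⟨fun ⟨i', j', h, he⟩ => ?_, fun h => ⟨i, j, h, rfl⟩⟩
      obtain ⟨hi, hj⟩ := pair_inj j.2 j'.2 he
      rwa [Fin.ext hi, Fin.ext hj]
    simp [inputState, this]
  mem i := by simp [inputState, Fin.val_inj]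

theorem induce_nbrs_preconnected {T : SimpleGraph A} (hG : G.IsBipartiteWith A B) (hT : T.IsTree)
    (hsupp : ∀ b ∈ B, (T.induce {a : A | G.Adj b a}).Preconnected) (S : Set (Fin n)) :
    (T.induce {a | S ⊆ nbrs G A a}).Preconnected := by
  refine induce_subset_preconnected hT (fun b => ?_) S
  by_cases hb : b ∈ B
  · have : {a : A | b ∈ nbrs G A a} = {a : A | G.Adj b a} := Set.ext fun a => G.adj_comm _ _
    rw [this]
    exact hsupp b hb
  · exact fun ⟨a, ha⟩ => absurd (hG.mem_of_mem_adj a.2 ha) hb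

theorem induce_adj_preconnected {T : SimpleGraph A}
    (hT : ∀ S, (T.induce {a | S ⊆ nbrs G A a}).Preconnected) (b : Fin n) :
    (T.induce {a : A | G.Adj b a}).Preconnected := by
  have : {a : A | {b} ⊆ nbrs G A a} = {a : A | G.Adj b a} := by
    ext a
    simp [nbrs, G.adj_comm]
  exact this ▸ hT {b}

variable [Fintype A]

theorem exists_holdsSlots_exec_placeCmd : ∃ o d,
    HoldsSlots G A (placeCmd.exec n (inputState G A).arr []) o ∧
    Auction (n + n) (tokens (nbrs G A)) (Fits (nbrs G A)) o d ∧
    ∀ u s, ¬ Bid (n + n) (tokens (nbrs G A)) (Fits (nbrs G A)) o d u s := by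
  set M := (closureCmd 4 classAdjE).exec n (inputState G A).arr []
  have hclosure : ∀ a ≠ 4, M a = (inputState G A).arr a := fun a ha =>
    Cmd.exec_apply_of_not_writes (not_writes_closureCmd ha _)
  have hauction : ∀ a < 5, auctionCmd.exec n M [] a = M a := fun a ha =>
    Cmd.exec_apply_of_not_writes (not_writes_auctionCmd (by omega) (by omega))
  have hinput : HoldsInput G A M :=
    holdsInput_inputState.congr (hclosure 0 (by simp)) (hclosure 1 (by simp))
  have hclasses : HoldsClasses G A M :=
    holdsClasses_exec_closureCmd holdsInput_inputState (inputState_arr_eq_zero (by simp))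
  have hzero : ∀ a ≥ 5, ∀ k, M a k = 0 := fun a ha k => by
    rw [hclosure a (by omega), inputState_arr_eq_zero (by omega)]
  obtain ⟨o, d, ho, h, hend⟩ := exec_auctionCmd hinput hclasses (hzero 5 (by simp))
    (hzero 6 (by simp))
  exact ⟨o, d, ⟨hinput.congr (hauction 0 (by simp)) (hauction 1 (by simp)),
    hclasses.congr (hauction 4 (by simp)), ho, h.inj⟩, h, hend⟩

open Classical in
theorem exists_holdsTree_exec_treeCmd {ℓ : ℕ} (hℓ : 2 ≤ ℓ)
    (h : IsHConvex (fun H => IsLeafTree ℓ H) G A B) : ∃ o r,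
    HoldsTree G A (treeCmd.exec n (inputState G A).arr []) o r ∧ IsPlacement (nbrs G A) (posOf o) ∧
      (joinGraph (nbrs G A) (posOf o)).IsTree ∧
      2 + ∑ a, ((joinGraph (nbrs G A) (posOf o)).degree a - 2) ≤ ℓ := by
  obtain ⟨T, hT, hsupp⟩ := h.support
  have := hT.isTree.connected.nonempty
  have hS := induce_nbrs_preconnected h.bipartite hT.isTree hsupp
  have hA : 2 * Fintype.card A ≤ n + n := by
    have := set_fintype_card_le_univ A
    rw [Fintype.card_fin] at this
    omega
  obtain ⟨o, d, ho, hauction, hend⟩ := exists_holdsSlots_exec_placeCmd (G := G) (A := A)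
  have hpos := isPlacement_posOf hauction
  have hJ := joinGraph_isTree hpos (card_tokens_add_two_le hT.isTree hS)
  obtain ⟨r, hr, hmin⟩ := exists_least_degree_le_one hJ
  have hwrites : ¬ placeCmd.Writes 8 :=
    not_or.2 ⟨not_writes_closureCmd (by simp) _, not_writes_auctionCmd (by simp) (by simp)⟩
  have h8 : ∀ k, placeCmd.exec n (inputState G A).arr [] 8 k = 0 := fun k => by
    rw [Cmd.exec_apply_of_not_writes hwrites, inputState_arr_eq_zero (by simp)]
  refine ⟨o, r, ⟨ho.congr fun a ha _ _ => ?_, fun x y a b => ?_, hr, hmin⟩, hpos, hJ,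
    (Nat.add_le_add_left (sum_degree_joinGraph_le_sum_degree hS hA hauction hend) 2).trans
      (hT.two_add_sum_degree_le hℓ)⟩
  · exact Cmd.exec_apply_of_not_writes (not_writes_closureCmd (show a ≠ 8 by omega) avoidE)
  · exact (marked_exec_closureCmd_iff (by decide) h8 (ix_lt_size x) (ix_lt_size y)
      (tr_avoidE ho x y) a b).trans (reachable_map_iff (.subtype (· ∈ A)))

theorem HoldsTree.congr {M M' : Mem} {o : A × Bool → Option (A × A × A × Bool)} {r : A}
    (h : HoldsTree G A M o r) (hM : ∀ a, a ≠ 2 → a ≠ 3 → M' a = M a) : HoldsTree G A M' o r where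
  toHoldsSlots := h.toHoldsSlots.congr fun a _ => hM a
  reach := by
    rw [hM 8 (by simp) (by simp)]
    exact h.reach
  leaf := h.leaf
  first := h.first

theorem exec_outputCmd {M : Mem} {o : A × Bool → Option (A × A × A × Bool)} {r : A}
    (h : HoldsTree G A M o r) (x : Fin n) :
    outputCmd.exec n M [] 2 (position G A (joinGraph (nbrs G A) (posOf o)) r x) = x ∧
      outputCmd.exec n M [] 3 x = classOf A (joinGraph (nbrs G A) (posOf o)) r x := by
  rw [outputCmd, Cmd.exec]
  set M' := (Cmd.loop 1 0 (.store 2 positionE (var 0))).exec n M []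
  have hM' : ∀ a ≠ 2, M' a = M a := fun a ha =>
    Cmd.exec_apply_of_not_writes (by simpa [Cmd.Writes] using ha.symm)
  constructor
  · rw [Cmd.exec_apply_of_not_writes (by simp [Cmd.Writes])]
    exact exec_loop_store position_injective (fun M₁ hM₁ x =>
      ⟨eval_positionE (h.congr fun a h2 _ => hM₁ a h2) x, rfl⟩) x
  · exact exec_loop_store Fin.val_injective (fun M₁ hM₁ x =>
      ⟨rfl, eval_classE (h.congr fun a h2 h3 => (hM₁ a h3).trans (hM' a h2)) x⟩) x

end

theorem exists_isConsistent_exec {n : ℕ} {G : SimpleGraph (Fin n)} {A B : Set (Fin n)} {ℓ : ℕ}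
    (hℓ : 2 ≤ ℓ) (h : IsHConvex (fun H => IsLeafTree ℓ H) G A B) {τ : State}
    (hτ : τ.arr = (Cmd.seq treeCmd outputCmd).exec n (inputState G A).arr []) :
    ∃ (v : Fin n ≃ Fin n) (c : Fin n → Fin ℓ), IsConsistent G v c ∧ IsOutput τ v c := by
  classical
  obtain ⟨o, r, hM, hpos, hJ, hdeg⟩ := exists_holdsTree_exec_treeCmd hℓ h
  obtain ⟨v, c, hvc, hv, hc⟩ := exists_isConsistent h.bipartite h.cover hJ
    (fun b _ => induce_adj_preconnected (joinGraph_preconnected hpos) b) (Fintype.card_fin n)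
    fun x => (classOf_lt hJ hM.leaf x).trans_le hdeg
  have hout := exec_outputCmd hM
  refine ⟨v, c, hvc, fun i => ?_, fun x => ?_⟩ <;> rw [hτ, Cmd.exec]
  · rw [← (hout (v i)).1, ← hv, v.symm_apply_apply]
  · rw [hc, (hout x).2]

end RAM

theorem mainTheorem6_general :
    (∀ ℓ, 2 ≤ ℓ → ∀ (V : Type*) [Finite V] (G : SimpleGraph V) (A B : Set V),
      IsHConvex (fun H => IsLeafTree ℓ H) G A B → thinness G ≤ ℓ) ∧
    ∃ (P : RAM.Prog) (p : Polynomial ℕ), ∀ ℓ, 2 ≤ ℓ →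
      ∀ (n : ℕ) (G : SimpleGraph (Fin n)) (A B : Set (Fin n)),
        IsHConvex (fun H => IsLeafTree ℓ H) G A B →
        ∃ (τ : RAM.State) (T : ℕ), RAM.Runs P (RAM.inputState G A) τ T ∧ T ≤ p.eval n ∧
          ∃ (v : Fin n ≃ Fin n) (c : Fin n → Fin ℓ),
            IsConsistent G v c ∧ RAM.IsOutput τ v c := by
  refine ⟨fun ℓ hℓ V _ G A B h => thinness_le_of_isLeafTree hℓ h, ?_⟩
  obtain ⟨P, p, hP⟩ := (RAM.Cmd.seq RAM.treeCmd RAM.outputCmd).exists_runs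
  refine ⟨P, p, fun ℓ hℓ n G A B h => ?_⟩
  obtain ⟨τ, T, hrun, hT, hτ⟩ := hP (RAM.inputState G A)
  exact ⟨τ, T, hrun, hT, RAM.exists_isConsistent_exec hℓ h hτ⟩

theorem mainTheorem6 (t Δ : ℕ) (ht : 1 ≤ t) (hΔ : 3 ≤ Δ) :
    (∀ (V : Type*) [Finite V] (G : SimpleGraph V) (A B : Set V),
      IsTDeltaTreeConvex t Δ G A B → thinness G ≤ 2 + t * (Δ - 2)) ∧
    ∃ (P : RAM.Prog) (p : Polynomial ℕ),
      ∀ (n : ℕ) (G : SimpleGraph (Fin n)) (A B : Set (Fin n)), IsTDeltaTreeConvex t Δ G A B →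
        ∃ (τ : RAM.State) (T : ℕ), RAM.Runs P (RAM.inputState G A) τ T ∧ T ≤ p.eval n ∧
          ∃ (v : Fin n ≃ Fin n) (c : Fin n → Fin (2 + t * (Δ - 2))),
            IsConsistent G v c ∧ RAM.IsOutput τ v c := by
  have hℓ : 2 ≤ 2 + t * (Δ - 2) := Nat.le_add_right _ _
  obtain ⟨hthin, P, p, hP⟩ := mainTheorem6_general
  exact ⟨fun V _ G A B h => hthin _ hℓ V G A B h.isLeafTreeConvex,
    P, p, fun n G A B h => hP _ hℓ n G A B h.isLeafTreeConvex⟩
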